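/- **Conventions.** A *restriction category* is a category with an operation sending each map $f\colon A\to B$ to $\bar f\colon A\to A$ such that $f\bar f=f$, $\bar f\bar g=\bar g\bar f$, $\overline{g\bar f}=\bar g\bar f$ and $\bar g f=f\,\overline{gf}$ whenever these make sense. Maps $\bar f$ are *restriction idempotents*; $\mathcal O(A)$ is the set of those on $A$. Parallel maps are ordered by $f\leqslant g$ iff $f=g\bar f$, and are *compatible* if $f\bar g=g\bar f$; joins are least upper bounds. A map $f$ is *total* if $\bar f=1$; maps $s\colon A\to B$ and $s^*\colon B\to A$ are *partial inverse*, and then called *partial isomorphisms*, if $s^*s=\bar s$ and $ss^*=\overline{s^*}$. A *local homeomorphism* is a total map which is a join of partial isomorphisms. A *partial section* of $p\colon A\to X$ is a map $s\colon X\to A$ with $ps=\bar s$. A *join restriction category* is a restriction category in which every (possibly empty) pairwise compatible family of parallel maps has a join, these joins being preserved by precomposition. A *local atlas* on $X$ is a set $I$ with $\varphi_{ij}\in\mathcal O(X)$ $(i,j\in I)$ such that $\varphi_{ij}=\varphi_{ji}$ and $\varphi_{jk}\varphi_{ij}\leqslant\varphi_{ik}$; a *glueing* of it is a local homeomorphism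 $p=\bigvee_i p_i\colon A\to X$, with each $p_i$ a partial isomorphism with partial inverse $s_i$, such that $p_js_i=\varphi_{ij}$. A join restriction category has *local glueings* if every local atlas has a glueing. Let $\mathcal C$ be a join restriction category with local glueings (with small hom-sets; local atlases are indexed by small sets). *Partite groupoids.* A *partite internal category* $\mathbb A$ in $\mathcal C$ has a set $I$ of components, objects $A_i$, objects $A_{ij}$ with total maps $\sigma_{ij}\colon A_{ij}\to A_i$ and $\tau_{ij}\colon A_{ij}\to A_j$ such that $\sigma_{ij}$ has a pullback along every total map, and maps $\eta_i\colon A_i\to A_{ii}$ and $\mu_{ijk}\colon A_{jk}\times_{A_j}A_{ij}\to A_{ik}$, compatible with source and target ($\sigma_{ii}\eta_i=1=\tau_{ii}\eta_i$, $\sigma_{ik}\mu_{ijk}=\sigma_{ij}\pi_2$, $\tau_{ik}\mu_{ijk}=\tau_{jk}\pi_1$), unital and associative. It is a *partite internal groupoid* if there are (necessarily unique) total maps $\iota_{ij}\colon A_{ij}\to A_{ji}$ with $\iota_{ij}\iota_{ji}=1$, $\sigma_{ji}\iota_{ij}=\tau_{ij}$ and $\mu_{iji}(\iota_{ij},1)=\eta_i\sigma_{ij}$;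 it is *étale* if all $\sigma_{ij}$ are local homeomorphisms. A *partite cofunctor* $F\colon\mathbb A\rightsquigarrow\mathbb B$ consists of a map $i\mapsto Fi$ on components, total maps $F_i\colon B_{Fi}\to A_i$ and total maps $F_{ij}\colon A_{ij}\times_{A_i}B_{Fi}\to B_{Fi,Fj}$ such that $\sigma_{Fi,Fj}F_{ij}=\pi_2$, $F_j\tau_{Fi,Fj}F_{ij}=\tau_{ij}\pi_1$, $F_{ii}(\eta_iF_i,1)=\eta_{Fi}$, and, on generalised elements, $F_{ik}(\mu_{ijk}(y,x),b)=\mu_{Fi,Fj,Fk}\bigl(F_{jk}(y,\tau_{Fi,Fj}F_{ij}(x,b)),F_{ij}(x,b)\bigr)$. Cofunctors compose by $(GF)i=G(Fi)$, $(GF)_i=F_iG_{Fi}$ and $(GF)_{ij}(x,c)=G_{Fi,Fj}(F_{ij}(x,G_{Fi}c),c)$. Let $\mathrm{pGpd}_c(\mathcal C)$ be the category of partite internal groupoids and cofunctors, and $\mathrm{peGpd}_c(\mathcal C)$ its full subcategory of étale ones. *Inverse categories over $\mathcal C$.* An *inverse category* is a category in which each map $s$ has a unique $s^*$ with $ss^*s=s$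 and $s^*ss^*=s^*$, made a restriction category by $\bar s=s^*s$. It is a *join inverse category* if every family of parallel maps that are pairwise bicompatible ($s,t$ compatible and $s^*,t^*$ compatible) has a join, preserved by precomposition. The category $\mathrm{iCat}/\!/\mathcal C$ has as objects restriction functors $P\colon\mathcal A\to\mathcal C$ with $\mathcal A$ an inverse category. A map $(\mathcal A,P)\to(\mathcal B,Q)$ is a restriction functor $F\colon\mathcal A\to\mathcal B$ with a natural transformation $\alpha\colon QF\Rightarrow P$ having total components, composed by pasting. Call $P$ *hyperconnected* if each $\mathcal O(i)\to\mathcal O(Pi)$, $e\mapsto Pe$, is bijective, and let $\mathrm{jiCat}/\!/_h\mathcal C$ be the full subcategory of $\mathrm{iCat}/\!/\mathcal C$ on those $P$ which are hyperconnected with $\mathcal A$ a join inverse category. *The functor $\Phi_g\colon\mathrm{pGpd}_c(\mathcal C)\to\mathrm{iCat}/\!/\mathcal C$.* The objects of $\Phi_g\mathbb A$ are the components of $\mathbb A$. Its maps $i\to j$ are the partial bisections, that is, the partial sections $s$ of $\sigma_{ij}$ with $\tau_{ij}s$ a partial isomorphism. Identities are the $\eta_i$; the composite of $s\colon i\to j$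 and $t\colon j\to k$ is $t*s=\mu_{ijk}\circ\tau_{ij}^*(t)\circ s$, where $\tau_{ij}^*(t)=(t\tau_{ij},\overline{t\tau_{ij}})$; the restriction of $s$ is $\eta_i\bar s$; and the functor to $\mathcal C$ is $i\mapsto A_i$, $s\mapsto\tau_{ij}s$. On a cofunctor $F$, $\Phi_gF$ sends $i$ to $Fi$ and $s$ to $F_{ij}\circ(sF_i,\overline{sF_i})$, with natural transformation of components $F_i$. *The objects $\Psi P$.* For $P\colon\mathcal A\to\mathcal C$ in $\mathrm{iCat}/\!/\mathcal C$ and $f,g\in\mathcal A(i,j)$ put $[\![f=g]\!]=\bigvee\{Pe: e\in\mathcal O(i),\ e\leqslant\bar f\bar g,\ fe=ge\}\in\mathcal O(Pi)$. Then $\Psi P$ is a partite internal category whose components are the objects of $\mathcal A$, with $(\Psi P)_i=Pi$, with $\sigma_{ij}\colon\Psi P_{ij}\to Pi$ a glueing of the local atlas $([\![f=g]\!])_{f,g\in\mathcal A(i,j)}$, with associated partial sections $s_f\colon Pi\to\Psi P_{ij}$, and with remaining structure determined by $\tau_{ij}s_f=Pf$, $\eta_i=s_{1_i}$ and $s_g*s_f=s_{gf}$.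 **Theorem.** 1. For every $P$ in $\mathrm{iCat}/\!/\mathcal C$ such a $\Psi P$ exists, and however the $\Psi P$ are chosen, each is a partite internal groupoid. 2. For every choice of the $\Psi P$, the assignment $P\mapsto\Psi P$ is the action on objects of a functor $\Psi\colon\mathrm{iCat}/\!/\mathcal C\to\mathrm{pGpd}_c(\mathcal C)$ which is left adjoint to $\Phi_g$. The unit at $P$ is the map $P\to\Phi_g\Psi P$ which is the identity on objects, sends $f$ to $s_f$, and has identity natural transformation. 3. The unit at $P$ is invertible if and only if $P$ is in $\mathrm{jiCat}/\!/_h\mathcal C$, and the counit at $\mathbb A$ is invertible if and only if $\mathbb A$ is étale. Moreover $\Psi$ and $\Phi_g$, with the same unit and counit, restrict to an adjoint equivalence $$\mathrm{peGpd}_c(\mathcal C)\;\simeq\;\mathrm{jiCat}/\!/_h\mathcal C$$ between the category of étale partite internal groupoids in $\mathcal C$ and the category of join inverse categories hyperconnected over $\mathcal C$. -/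

import Mathlib

open CategoryTheory CategoryTheory.Limits

universe w v u

namespace RestrictionTheory

/-- A restriction category. Composition is written in diagrammatic order: `f ≫ g` means first `f`, then `g`. -/
class RestrictionCategory (C : Type u) [Category.{v} C] where
  /-- The restriction of a map. -/
  rest : ∀ {X Y : C}, (X ⟶ Y) → (X ⟶ X)
  rest_comp_self : ∀ {X Y : C} (f : X ⟶ Y), rest f ≫ f = f
  rest_comm : ∀ {X Y Z : C} (f : X ⟶ Y) (g : X ⟶ Z), rest f ≫ rest g = rest g ≫ rest f
  rest_rest_comp : ∀ {X Y Z : C} (f : X ⟶ Y) (g : X ⟶ Z),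
    rest (rest f ≫ g) = rest f ≫ rest g
  comp_rest : ∀ {X Y Z : C} (f : X ⟶ Y) (g : Y ⟶ Z), f ≫ rest g = rest (f ≫ g) ≫ f

open RestrictionCategory

section Basic

variable {C : Type u} [Category.{v} C] [RestrictionCategory C] {X Y Z W : C}

/-- A map is total when its restriction is the identity. -/
class IsTotal (f : X ⟶ Y) : Prop where
  rest_eq : rest f = 𝟙 X

/-- Parallel maps are compatible when they agree on their common domain of definition. -/
def Compatible (f g : X ⟶ Y) : Prop := rest g ≫ f = rest f ≫ g

/-- A family of parallel maps is pairwise compatible. -/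
def PairwiseCompatible (S : Set (X ⟶ Y)) : Prop := ∀ s ∈ S, ∀ t ∈ S, Compatible s t

/-- The canonical partial order on the maps `X ⟶ Y`. Joins are least upper bounds (`IsLUB`)
for this order. -/
instance homPartialOrder : PartialOrder (X ⟶ Y) where
  le f g := f = rest f ≫ g
  le_refl f := (rest_comp_self f).symm
  le_trans f g h hfg hgh := by
    have hfg' : f = rest f ≫ g := hfg
    have hgh' : g = rest g ≫ h := hgh
    have e : rest f ≫ rest g = rest f := by rw [← rest_rest_comp, ← hfg']
    calc f = rest f ≫ g := hfg'
      _ = rest f ≫ rest g ≫ h := by rw [← hgh']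
      _ = rest f ≫ h := by rw [← Category.assoc, e]
  le_antisymm f g hfg hgf := by
    have hfg' : f = rest f ≫ g := hfg
    have hgf' : g = rest g ≫ f := hgf
    calc f = rest f ≫ rest g ≫ f := by rw [← hgf', ← hfg']
      _ = rest g ≫ rest f ≫ f := by rw [← Category.assoc, rest_comm, Category.assoc]
      _ = g := by rw [rest_comp_self, ← hgf']

theorem le_def (f g : X ⟶ Y) : f ≤ g ↔ f = rest f ≫ g := Iff.rfl

/-- The restriction idempotents on `X`: the maps of the form `rest f`, equivalently (as `rest` is
idempotent) the maps fixed by `rest`. -/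
def RestrictionIdempotent (X : C) : Type v := {e : X ⟶ X // rest e = e}

/-- A partial inverse `t` of `s`. -/
def IsPartialInverse (s : X ⟶ Y) (t : Y ⟶ X) : Prop := s ≫ t = rest s ∧ t ≫ s = rest t

/-- A partial isomorphism is a map with a partial inverse. -/
def IsPartialIso (s : X ⟶ Y) : Prop := ∃ t : Y ⟶ X, IsPartialInverse s t

/-- Parallel partial isomorphisms are bicompatible when they are compatible and so are their
partial inverses (which are unique). -/
def Bicompatible (s t : X ⟶ Y) : Prop :=
  Compatible s t ∧
    ∃ s' t' : Y ⟶ X, IsPartialInverse s s' ∧ IsPartialInverse t t' ∧ Compatible s' t'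

/-- An étale map is a join of partial isomorphisms. -/
def IsEtaleMap (f : X ⟶ Y) : Prop :=
  ∃ S : Set (X ⟶ Y), (∀ s ∈ S, IsPartialIso s) ∧ IsLUB S f

/-- A local homeomorphism is a total étale map. -/
def IsLocalHomeo (f : X ⟶ Y) : Prop := IsTotal f ∧ IsEtaleMap f

/-- A partial section of `p`. -/
def IsPartialSection (p : X ⟶ Y) (s : Y ⟶ X) : Prop := s ≫ p = rest s

@[simp] theorem rest_id : rest (𝟙 X) = 𝟙 X := by
  have := rest_comp_self (𝟙 X); rwa [Category.comp_id] at this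

@[simp] theorem rest_rest (f : X ⟶ Y) : rest (rest f) = rest f := by
  have := rest_rest_comp f (𝟙 X); rwa [Category.comp_id, rest_id, Category.comp_id] at this

theorem rest_comp_rest (f : X ⟶ Y) (g : Y ⟶ Z) : rest (f ≫ rest g) = rest (f ≫ g) := by
  have h1 : rest (f ≫ g) ≫ rest f = rest (f ≫ g) := by
    rw [rest_comm, ← rest_rest_comp, ← Category.assoc, rest_comp_self]
  rw [comp_rest, rest_rest_comp, h1]

theorem rest_comp_total (f : X ⟶ Y) (g : Y ⟶ Z) [hg : IsTotal g] : rest (f ≫ g) = rest f := by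
  rw [← rest_comp_rest, hg.rest_eq, Category.comp_id]

theorem rest_idem (f : X ⟶ Y) : rest f ≫ rest f = rest f := by
  rw [← rest_rest_comp, rest_comp_self]

theorem rest_comp_comp (f : X ⟶ Y) (g : Y ⟶ Z) : rest (f ≫ g) ≫ rest f = rest (f ≫ g) := by
  rw [rest_comm, ← rest_rest_comp, ← Category.assoc, rest_comp_self]

theorem isTotal_of_comp (f : X ⟶ Y) (g : Y ⟶ Z) [h : IsTotal (f ≫ g)] : IsTotal f where
  rest_eq := by
    have := rest_comp_comp f g
    rwa [h.rest_eq, Category.id_comp] at this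

instance isTotal_id : IsTotal (𝟙 X) := ⟨rest_id⟩

instance isTotal_comp (f : X ⟶ Y) (g : Y ⟶ Z) [hf : IsTotal f] [IsTotal g] :
    IsTotal (f ≫ g) := ⟨by rw [rest_comp_total, hf.rest_eq]⟩

instance isTotal_pullback_fst (f : X ⟶ Z) (g : Y ⟶ Z) [HasPullback f g] [IsTotal f] [IsTotal g] :
    IsTotal (pullback.fst f g) where
  rest_eq := by
    have h : rest (pullback.fst f g) = rest (pullback.snd f g) := by
      rw [← rest_comp_total (pullback.fst f g) f, pullback.condition, rest_comp_total]
    apply pullback.hom_ext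
    · rw [rest_comp_self, Category.id_comp]
    · rw [h, rest_comp_self, Category.id_comp]

instance isTotal_pullback_snd (f : X ⟶ Z) (g : Y ⟶ Z) [HasPullback f g] [IsTotal f] [IsTotal g] :
    IsTotal (pullback.snd f g) where
  rest_eq := by
    have h : rest (pullback.fst f g) = rest (pullback.snd f g) := by
      rw [← rest_comp_total (pullback.fst f g) f, pullback.condition, rest_comp_total]
    rw [← h, (isTotal_pullback_fst f g).rest_eq]

theorem isPartialInverse_symm {s : X ⟶ Y} {t : Y ⟶ X} (h : IsPartialInverse s t) :
    IsPartialInverse t s := ⟨h.2, h.1⟩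

theorem IsPartialInverse.comp {s : X ⟶ Y} {s' : Y ⟶ X} {t : Y ⟶ Z} {t' : Z ⟶ Y}
    (hs : IsPartialInverse s s') (ht : IsPartialInverse t t') :
    IsPartialInverse (s ≫ t) (t' ≫ s') := by
  have key : ∀ {X Y Z : C} {s : X ⟶ Y} {s' : Y ⟶ X} {t : Y ⟶ Z} {t' : Z ⟶ Y},
      IsPartialInverse s s' → IsPartialInverse t t' →
      (s ≫ t) ≫ t' ≫ s' = rest (s ≫ t) := by
    intro X Y Z s s' t t' hs ht
    calc (s ≫ t) ≫ t' ≫ s' = s ≫ (t ≫ t') ≫ s' := by simp only [Category.assoc]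
      _ = (s ≫ rest t) ≫ s' := by rw [ht.1, Category.assoc]
      _ = rest (s ≫ t) ≫ rest s := by rw [comp_rest, Category.assoc, hs.1]
      _ = rest (s ≫ t) := rest_comp_comp s t
  exact ⟨key hs ht, key (isPartialInverse_symm ht) (isPartialInverse_symm hs)⟩

theorem isPartialIso_comp {s : X ⟶ Y} {t : Y ⟶ Z} (hs : IsPartialIso s) (ht : IsPartialIso t) :
    IsPartialIso (s ≫ t) := by
  obtain ⟨s', hs⟩ := hs
  obtain ⟨t', ht⟩ := ht
  exact ⟨_, hs.comp ht⟩

theorem isPartialIso_rest (f : X ⟶ Y) : IsPartialIso (rest f) :=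
  ⟨rest f, by rw [rest_rest, rest_idem], by rw [rest_rest, rest_idem]⟩

theorem isPartialIso_id : IsPartialIso (𝟙 X) := by
  have := isPartialIso_rest (𝟙 X); rwa [rest_id] at this

end Basic

/-- A join restriction category: every pairwise compatible family of parallel maps (possibly empty)
has a join, and precomposition preserves these joins. -/
class JoinRestrictionCategory (C : Type u) [Category.{v} C] [RestrictionCategory C] : Prop where
  exists_join : ∀ {X Y : C} (S : Set (X ⟶ Y)), PairwiseCompatible S → ∃ f, IsLUB S f
  precomp_join : ∀ {X' X Y : C} (g : X' ⟶ X) (S : Set (X ⟶ Y)), PairwiseCompatible S →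
    ∀ f, IsLUB S f → IsLUB ((fun s => g ≫ s) '' S) (g ≫ f)

/-- A restriction category is (the restriction category underlying) an inverse category when every
map `s` has exactly one `s*` with `s s* s = s` and `s* s s* = s*`, and the restriction of `s` is
`s*` after `s`. -/
structure IsInverseCategory (A : Type u) [Category.{v} A] [RestrictionCategory A] : Prop where
  existsUnique_star : ∀ {X Y : A} (s : X ⟶ Y),
    ∃! t : Y ⟶ X, s ≫ t ≫ s = s ∧ t ≫ s ≫ t = t
  rest_eq : ∀ {X Y : A} (s : X ⟶ Y) (t : Y ⟶ X),
    s ≫ t ≫ s = s → t ≫ s ≫ t = t → rest s = s ≫ t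

/-- A join inverse category: an inverse category in which every pairwise bicompatible family of
parallel maps has a join, and precomposition preserves these joins. -/
structure IsJoinInverseCategory (A : Type u) [Category.{v} A] [RestrictionCategory A] : Prop
    extends IsInverseCategory A where
  exists_join : ∀ {X Y : A} (S : Set (X ⟶ Y)), (∀ s ∈ S, ∀ t ∈ S, Bicompatible s t) →
    ∃ f, IsLUB S f
  precomp_join : ∀ {X' X Y : A} (g : X' ⟶ X) (S : Set (X ⟶ Y)),
    (∀ s ∈ S, ∀ t ∈ S, Bicompatible s t) →
    ∀ f, IsLUB S f → IsLUB ((fun s => g ≫ s) '' S) (g ≫ f)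

section Idempotents

variable {A : Type u} [Category.{v} A] [RestrictionCategory A] {X Y : A}

/-- In a restriction category all of whose maps are partial isomorphisms, every idempotent is a
restriction idempotent. -/
theorem rest_eq_of_idem (h : ∀ {X Y : A} (s : X ⟶ Y), IsPartialIso s) (e : X ⟶ X)
    (he : e ≫ e = e) : rest e = e := by
  obtain ⟨t, ht⟩ := h e
  calc rest e = e ≫ t := ht.1.symm
    _ = e ≫ e ≫ t := by rw [← Category.assoc, he]
    _ = e ≫ rest e := by rw [ht.1]
    _ = e := by rw [comp_rest, he, rest_comp_self]

theorem isInverseCategory_of_isPartialIso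
    (h : ∀ {X Y : A} (s : X ⟶ Y), IsPartialIso s) : IsInverseCategory A := by
  have key : ∀ {X Y : A} (s : X ⟶ Y) (t : Y ⟶ X), s ≫ t ≫ s = s → t ≫ s ≫ t = t →
      rest s = s ≫ t := by
    intro X Y s t h1 h2
    have hid : rest (s ≫ t) = s ≫ t := rest_eq_of_idem h _ (by
      rw [Category.assoc, h2])
    calc rest s = rest ((s ≫ t) ≫ s) := by rw [Category.assoc, h1]
      _ = (s ≫ t) ≫ rest s := by rw [← hid, rest_rest_comp, hid]
      _ = rest (s ≫ t) ≫ rest s := by rw [hid]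
      _ = s ≫ t := by rw [rest_comp_comp, hid]
  refine ⟨?_, fun s t => key s t⟩
  intro X Y s
  obtain ⟨t, ht⟩ := h s
  have e1 : s ≫ t ≫ s = s := by rw [← Category.assoc, ht.1, rest_comp_self]
  have e2 : t ≫ s ≫ t = t := by rw [← Category.assoc, ht.2, rest_comp_self]
  refine ⟨t, ⟨e1, e2⟩, ?_⟩
  rintro t' ⟨h1, h2⟩
  have a1 : s ≫ t' = s ≫ t := by rw [← key s t' h1 h2, ht.1]
  have a2 : t' ≫ s = t ≫ s := by
    have b1 : rest (t' ≫ s) = t' ≫ s := rest_eq_of_idem h _ (by rw [Category.assoc, h1])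
    have b2 : rest (t ≫ s) = t ≫ s := rest_eq_of_idem h _ (by rw [Category.assoc, e1])
    calc t' ≫ s = (t' ≫ s) ≫ t ≫ s := by rw [Category.assoc, e1]
      _ = (t ≫ s) ≫ t' ≫ s := by rw [← b1, ← b2, rest_comm]
      _ = t ≫ s := by rw [Category.assoc, h1]
  calc t' = t' ≫ s ≫ t' := h2.symm
    _ = t' ≫ s ≫ t := by rw [a1]
    _ = t ≫ s ≫ t := by rw [← Category.assoc, a2, Category.assoc]
    _ = t := e2

theorem isPartialIso_of_isInverseCategory (h : IsInverseCategory A) (s : X ⟶ Y) :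
    IsPartialIso s := by
  obtain ⟨t, ⟨h1, h2⟩, -⟩ := h.existsUnique_star s
  exact ⟨t, (h.rest_eq s t h1 h2).symm, (h.rest_eq t s h2 h1).symm⟩

end Idempotents

section Glueings

variable {C : Type u} [Category.{v} C] [RestrictionCategory C]

/-- An `I`-object local atlas on `X`. -/
structure LocalAtlas (X : C) (I : Type w) where
  φ : I → I → (X ⟶ X)
  rest_φ : ∀ i j, rest (φ i j) = φ i j
  symm : ∀ i j, φ i j = φ j i
  trans : ∀ i j k, φ i j ≫ φ j k ≤ φ i k

/-- The map `p : A ⟶ X` is a local homeomorphism, exhibited as the join of the partial isomorphisms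
`q i`, with partial inverses `s i`, and the matrix of maps `φ i j` is the one which it induces,
with entries `q j` after `s i`. -/
structure IsGlueing {X A : C} {I : Type w} (φ : I → I → (X ⟶ X)) (p : A ⟶ X)
    (q : I → (A ⟶ X)) (s : I → (X ⟶ A)) : Prop where
  total : IsTotal p
  isPartialInverse : ∀ i, IsPartialInverse (q i) (s i)
  isLUB : IsLUB (Set.range q) p
  induces : ∀ i j, s i ≫ q j = φ i j

/-- A category with hom-sets in `Type v` has local glueings when every local atlas, indexed by a set
in `Type v`, is induced by a local homeomorphism. -/
def HasLocalGlueings (C : Type u) [Category.{v} C] [RestrictionCategory C] : Prop :=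
  ∀ (X : C) (I : Type v) (φ : LocalAtlas X I),
    ∃ (A : C) (p : A ⟶ X) (q : I → (A ⟶ X)) (s : I → (X ⟶ A)), IsGlueing φ.φ p q s

end Glueings

section Partite

variable {C : Type u} [Category.{v} C] [RestrictionCategory C]

/-- The source and target spans of a partite internal category with objects of objects `obj i`.
Pullbacks are those of the category `C`. -/
structure PartiteGraph {I : Type w} (obj : I → C) where
  arr : I → I → C
  σ : ∀ i j, arr i j ⟶ obj i
  τ : ∀ i j, arr i j ⟶ obj j
  σ_total : ∀ i j, IsTotal (σ i j)
  τ_total : ∀ i j, IsTotal (τ i j)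
  hasPullback : ∀ i j {X : C} (f : X ⟶ obj i), IsTotal f → HasPullback (σ i j) f

instance isTotal_σ {I : Type w} {obj : I → C} (G : PartiteGraph obj) (i j : I) :
    IsTotal (G.σ i j) := G.σ_total i j

instance isTotal_τ {I : Type w} {obj : I → C} (G : PartiteGraph obj) (i j : I) :
    IsTotal (G.τ i j) := G.τ_total i j

instance hasPullback_σ {I : Type w} {obj : I → C} (G : PartiteGraph obj) (i j : I) {X : C}
    (f : X ⟶ obj i) [h : IsTotal f] : HasPullback (G.σ i j) f := G.hasPullback i j f h

/-- The structure of an `I`-partite internal category on given objects of objects `obj i`.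
The object of composable pairs `pullback (σ j k) (τ i j)` has first projection to `arr j k` and
second projection to `arr i j`. The maps `η` and `μ` are automatically total. -/
structure PartiteStr {I : Type w} (obj : I → C) where
  graph : PartiteGraph obj
  η : ∀ i, obj i ⟶ graph.arr i i
  η_σ : ∀ i, η i ≫ graph.σ i i = 𝟙 (obj i)
  η_τ : ∀ i, η i ≫ graph.τ i i = 𝟙 (obj i)
  μ : ∀ i j k, pullback (graph.σ j k) (graph.τ i j) ⟶ graph.arr i k
  μ_σ : ∀ i j k, μ i j k ≫ graph.σ i k = pullback.snd _ _ ≫ graph.σ i j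
  μ_τ : ∀ i j k, μ i j k ≫ graph.τ i k = pullback.fst _ _ ≫ graph.τ j k
  unit_right : ∀ i j,
    pullback.lift (𝟙 (graph.arr i j)) (graph.σ i j ≫ η i)
      (by rw [Category.id_comp, Category.assoc, η_τ, Category.comp_id]) ≫ μ i i j = 𝟙 _
  unit_left : ∀ i j,
    pullback.lift (graph.τ i j ≫ η j) (𝟙 (graph.arr i j))
      (by rw [Category.id_comp, Category.assoc, η_σ, Category.comp_id]) ≫ μ i j j = 𝟙 _
  assoc : ∀ i j k l,
    -- the object of composable triples, with its projections
    let R := pullback (graph.σ k l)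
      (pullback.fst (graph.σ j k) (graph.τ i j) ≫ graph.τ j k)
    let z : R ⟶ graph.arr k l := pullback.fst _ _
    let yx : R ⟶ pullback (graph.σ j k) (graph.τ i j) := pullback.snd _ _
    pullback.lift z (yx ≫ μ i j k)
        (by rw [Category.assoc, μ_τ]; exact pullback.condition) ≫ μ i k l =
      pullback.lift
        (pullback.lift z (yx ≫ pullback.fst _ _)
          (by rw [Category.assoc]; exact pullback.condition) ≫ μ j k l)
        (yx ≫ pullback.snd _ _)
        (by rw [Category.assoc, μ_σ, pullback.lift_snd_assoc, Category.assoc,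
          Category.assoc, pullback.condition]) ≫ μ i j l

/-- A partite internal category, with set of components `I`. -/
structure PartiteCategory (C : Type u) [Category.{v} C] [RestrictionCategory C] where
  I : Type w
  obj : I → C
  str : PartiteStr obj

namespace PartiteCategory

variable (A : PartiteCategory.{w} C)

/-- Objects of arrows. -/
abbrev arr (i j : A.I) : C := A.str.graph.arr i j
/-- Source maps. -/
abbrev σ (i j : A.I) : A.arr i j ⟶ A.obj i := A.str.graph.σ i j
/-- Target maps. -/
abbrev τ (i j : A.I) : A.arr i j ⟶ A.obj j := A.str.graph.τ i j
/-- Identities. -/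
abbrev η (i : A.I) : A.obj i ⟶ A.arr i i := A.str.η i
/-- Composition. -/
abbrev μ (i j k : A.I) : pullback (A.σ j k) (A.τ i j) ⟶ A.arr i k := A.str.μ i j k

theorem η_σ (i : A.I) : A.η i ≫ A.σ i i = 𝟙 (A.obj i) := A.str.η_σ i
theorem η_τ (i : A.I) : A.η i ≫ A.τ i i = 𝟙 (A.obj i) := A.str.η_τ i

instance isTotal_η (i : A.I) : IsTotal (A.η i) :=
  have : IsTotal (A.η i ≫ A.σ i i) := by rw [η_σ]; infer_instance
  isTotal_of_comp _ (A.σ i i)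

/-- Composition of generalised arrows: `y` after `x`. -/
noncomputable def mul {A : PartiteCategory.{w} C} {i j k : A.I} {T : C} (y : T ⟶ A.arr j k)
    (x : T ⟶ A.arr i j) (h : y ≫ A.σ j k = x ≫ A.τ i j) : T ⟶ A.arr i k :=
  pullback.lift y x h ≫ A.μ i j k

variable {A} {i j k l : A.I} {T T' : C}

theorem mul_congr {y y' : T ⟶ A.arr j k} {x x' : T ⟶ A.arr i j} (h : y ≫ A.σ j k = x ≫ A.τ i j)
    (hy : y = y') (hx : x = x') : mul y x h = mul y' x' (by rw [← hy, ← hx, h]) := by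
  subst hy hx; rfl

theorem mul_σ (y : T ⟶ A.arr j k) (x : T ⟶ A.arr i j) (h : y ≫ A.σ j k = x ≫ A.τ i j) :
    mul y x h ≫ A.σ i k = x ≫ A.σ i j := by
  rw [mul, Category.assoc, A.str.μ_σ, pullback.lift_snd_assoc]

theorem mul_τ (y : T ⟶ A.arr j k) (x : T ⟶ A.arr i j) (h : y ≫ A.σ j k = x ≫ A.τ i j) :
    mul y x h ≫ A.τ i k = y ≫ A.τ j k := by
  rw [mul, Category.assoc, A.str.μ_τ, pullback.lift_fst_assoc]

theorem comp_mul (f : T' ⟶ T) (y : T ⟶ A.arr j k) (x : T ⟶ A.arr i j)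
    (h : y ≫ A.σ j k = x ≫ A.τ i j) :
    f ≫ mul y x h = mul (f ≫ y) (f ≫ x) (by rw [Category.assoc, h, Category.assoc]) := by
  rw [mul, mul, ← Category.assoc]
  congr 1
  apply pullback.hom_ext
  · rw [Category.assoc, pullback.lift_fst, pullback.lift_fst]
  · rw [Category.assoc, pullback.lift_snd, pullback.lift_snd]

theorem mul_unit (x : T ⟶ A.arr i j) :
    mul x (x ≫ A.σ i j ≫ A.η i) (by simp only [Category.assoc, η_τ, Category.comp_id]) = x := by
  have h := A.str.unit_right i j
  calc _ = x ≫ mul (𝟙 _) (A.σ i j ≫ A.η i)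
        (by rw [Category.id_comp, Category.assoc, η_τ, Category.comp_id]) := by
        rw [comp_mul]; exact mul_congr _ (Category.comp_id _).symm rfl
    _ = x := by rw [mul, h, Category.comp_id]

theorem unit_mul (x : T ⟶ A.arr i j) :
    mul (x ≫ A.τ i j ≫ A.η j) x (by simp only [Category.assoc, η_σ, Category.comp_id]) = x := by
  have h := A.str.unit_left i j
  calc _ = x ≫ mul (A.τ i j ≫ A.η j) (𝟙 _)
        (by rw [Category.id_comp, Category.assoc, η_σ, Category.comp_id]) := by
        rw [comp_mul]; exact mul_congr _ rfl (Category.comp_id _).symm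
    _ = x := by rw [mul, h, Category.comp_id]

theorem mul_assoc (z : T ⟶ A.arr k l) (y : T ⟶ A.arr j k) (x : T ⟶ A.arr i j)
    (h : y ≫ A.σ j k = x ≫ A.τ i j) (h' : z ≫ A.σ k l = y ≫ A.τ j k) :
    mul z (mul y x h) (by rw [mul_τ, h']) = mul (mul z y h') x (by rw [mul_σ, h]) := by
  have key := A.str.assoc i j k l
  let f : T ⟶ pullback (A.σ k l) (pullback.fst (A.σ j k) (A.τ i j) ≫ A.τ j k) :=
    pullback.lift z (pullback.lift y x h) (by rw [pullback.lift_fst_assoc, h'])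
  have e := congrArg (fun t => f ≫ t) key
  have f1 : f ≫ pullback.fst _ _ = z := pullback.lift_fst _ _ _
  have f2 : f ≫ pullback.snd _ _ = pullback.lift y x h := pullback.lift_snd _ _ _
  refine Eq.trans ?_ (e.trans ?_)
  · refine Eq.trans ?_ (comp_mul f _ _ _).symm
    refine mul_congr _ f1.symm ?_
    rw [← Category.assoc, f2, mul]
  · refine (comp_mul f _ _ _).trans ?_
    refine mul_congr _ ?_ ?_
    · refine (comp_mul f _ _ _).trans ?_
      refine mul_congr _ f1 ?_
      rw [← Category.assoc, f2, pullback.lift_fst]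
    · rw [← Category.assoc, f2, pullback.lift_snd]

theorem rest_mul (y : T ⟶ A.arr j k) (x : T ⟶ A.arr i j) (h : y ≫ A.σ j k = x ≫ A.τ i j) :
    rest (mul y x h) = rest x := by
  rw [← rest_comp_total (mul y x h) (A.σ i k), mul_σ, rest_comp_total]

end PartiteCategory

open PartiteCategory

/-- A partite cofunctor from `A` to `B`. The object `pullback (A.σ i j) (obj i)` has first
projection to `A.arr i j` and second projection to `B.obj (idx i)`. The maps `arr i j` are
automatically total, by compatibility with source. -/
structure Cofunctor (A B : PartiteCategory.{w} C) where
  idx : A.I → B.I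
  obj : ∀ i, B.obj (idx i) ⟶ A.obj i
  [obj_total : ∀ i, IsTotal (obj i)]
  arr : ∀ i j, pullback (A.σ i j) (obj i) ⟶ B.arr (idx i) (idx j)
  source : ∀ i j, arr i j ≫ B.σ (idx i) (idx j) = pullback.snd _ _
  target : ∀ i j, arr i j ≫ B.τ (idx i) (idx j) ≫ obj j = pullback.fst _ _ ≫ A.τ i j
  unit : ∀ i,
    pullback.lift (obj i ≫ A.η i) (𝟙 (B.obj (idx i)))
      (by rw [Category.id_comp, Category.assoc, A.η_σ, Category.comp_id]) ≫ arr i i =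
        B.η (idx i)
  comp : ∀ i j k,
    -- the object of triples of composable `A`-arrows and a point over the source
    let R := pullback (A.σ j k) (pullback.fst (A.σ i j) (obj i) ≫ A.τ i j)
    let y : R ⟶ A.arr j k := pullback.fst _ _
    let xb : R ⟶ pullback (A.σ i j) (obj i) := pullback.snd _ _
    pullback.lift
        (pullback.lift y (xb ≫ pullback.fst _ _)
          (by rw [Category.assoc]; exact pullback.condition) ≫ A.μ i j k)
        (xb ≫ pullback.snd _ _)
        (by rw [Category.assoc, A.str.μ_σ, pullback.lift_snd_assoc, Category.assoc,
          Category.assoc, pullback.condition]) ≫ arr i k =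
      pullback.lift
        (pullback.lift y (xb ≫ arr i j ≫ B.τ (idx i) (idx j))
          (by rw [Category.assoc, Category.assoc, target]; exact pullback.condition) ≫ arr j k)
        (xb ≫ arr i j)
        (by rw [Category.assoc, source, pullback.lift_snd, Category.assoc]) ≫
          B.μ (idx i) (idx j) (idx k)

attribute [instance] Cofunctor.obj_total

namespace Cofunctor

variable {A B D : PartiteCategory.{w} C}

/-- The action of a cofunctor on a generalised arrow `x` and a generalised point `b` over its
source. -/
noncomputable def act (F : Cofunctor A B) {i j : A.I} {T : C} (x : T ⟶ A.arr i j)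
    (b : T ⟶ B.obj (F.idx i)) (h : x ≫ A.σ i j = b ≫ F.obj i) :
    T ⟶ B.arr (F.idx i) (F.idx j) :=
  pullback.lift x b h ≫ F.arr i j

variable (F : Cofunctor A B) {i j k : A.I} {T T' : C}

theorem act_congr {x x' : T ⟶ A.arr i j} {b b' : T ⟶ B.obj (F.idx i)}
    (h : x ≫ A.σ i j = b ≫ F.obj i) (hx : x = x') (hb : b = b') :
    F.act x b h = F.act x' b' (by rw [← hx, ← hb, h]) := by
  subst hx hb; rfl

theorem act_σ (x : T ⟶ A.arr i j) (b : T ⟶ B.obj (F.idx i)) (h : x ≫ A.σ i j = b ≫ F.obj i) :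
    F.act x b h ≫ B.σ (F.idx i) (F.idx j) = b := by
  rw [act, Category.assoc, F.source, pullback.lift_snd]

theorem act_τ (x : T ⟶ A.arr i j) (b : T ⟶ B.obj (F.idx i)) (h : x ≫ A.σ i j = b ≫ F.obj i) :
    F.act x b h ≫ B.τ (F.idx i) (F.idx j) ≫ F.obj j = x ≫ A.τ i j := by
  rw [act, Category.assoc, F.target, pullback.lift_fst_assoc]

theorem comp_act (f : T' ⟶ T) (x : T ⟶ A.arr i j) (b : T ⟶ B.obj (F.idx i))
    (h : x ≫ A.σ i j = b ≫ F.obj i) :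
    f ≫ F.act x b h = F.act (f ≫ x) (f ≫ b) (by rw [Category.assoc, h, Category.assoc]) := by
  rw [act, act, ← Category.assoc]
  congr 1
  apply pullback.hom_ext
  · rw [Category.assoc, pullback.lift_fst, pullback.lift_fst]
  · rw [Category.assoc, pullback.lift_snd, pullback.lift_snd]

theorem act_unit (b : T ⟶ B.obj (F.idx i)) :
    F.act (b ≫ F.obj i ≫ A.η i) b
      (by simp only [Category.assoc, A.η_σ, Category.comp_id]) = b ≫ B.η (F.idx i) := by
  rw [← F.unit i]
  refine Eq.trans ?_ (F.comp_act b (F.obj i ≫ A.η i) (𝟙 _) (by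
    rw [Category.id_comp, Category.assoc, A.η_σ, Category.comp_id])).symm
  exact F.act_congr _ rfl (Category.comp_id _).symm

theorem act_mul (y : T ⟶ A.arr j k) (x : T ⟶ A.arr i j) (b : T ⟶ B.obj (F.idx i))
    (h : y ≫ A.σ j k = x ≫ A.τ i j) (hb : x ≫ A.σ i j = b ≫ F.obj i) :
    F.act (mul y x h) b (by rw [mul_σ, hb]) =
      mul (F.act y (F.act x b hb ≫ B.τ _ _) (by rw [Category.assoc, act_τ, h]))
        (F.act x b hb) (by rw [act_σ]) := by
  have key := F.comp i j k
  let f : T ⟶ pullback (A.σ j k) (pullback.fst (A.σ i j) (F.obj i) ≫ A.τ i j) :=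
    pullback.lift y (pullback.lift x b hb) (by rw [pullback.lift_fst_assoc, h])
  have e := congrArg (fun t => f ≫ t) key
  have f1 : f ≫ pullback.fst _ _ = y := pullback.lift_fst _ _ _
  have f2 : f ≫ pullback.snd _ _ = pullback.lift x b hb := pullback.lift_snd _ _ _
  refine Eq.trans ?_ (e.trans ?_)
  · refine Eq.trans ?_ (F.comp_act f _ _ _).symm
    refine F.act_congr _ ?_ ?_
    · refine Eq.trans ?_ (comp_mul f _ _ _).symm
      refine mul_congr _ f1.symm ?_
      rw [← Category.assoc, f2, pullback.lift_fst]
    · rw [← Category.assoc, f2, pullback.lift_snd]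
  · refine (comp_mul f _ _ _).trans ?_
    refine mul_congr _ ?_ ?_
    · refine (F.comp_act f _ _ _).trans ?_
      refine F.act_congr _ f1 ?_
      rw [← Category.assoc, f2, act, Category.assoc]
    · rw [← Category.assoc, f2, act]

/-- Two cofunctors with the same action on components are equal when they have the same action on
objects and on generalised arrows. -/
theorem ext_of_act {idx : A.I → B.I} {obj obj' : ∀ i, B.obj (idx i) ⟶ A.obj i}
    {t : ∀ i, IsTotal (obj i)} {t' : ∀ i, IsTotal (obj' i)}
    {arr : ∀ i j, pullback (A.σ i j) (obj i) ⟶ B.arr (idx i) (idx j)}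
    {arr' : ∀ i j, pullback (A.σ i j) (obj' i) ⟶ B.arr (idx i) (idx j)}
    {s : _} {s' : _} {g : _} {g' : _} {n : _} {n' : _} {c : _} {c' : _}
    (ho : ∀ i, obj i = obj' i)
    (ha : ∀ i j (T : C) (x : T ⟶ A.arr i j) (b : T ⟶ B.obj (idx i))
      (h : x ≫ A.σ i j = b ≫ obj i) (h' : x ≫ A.σ i j = b ≫ obj' i),
      pullback.lift x b h ≫ arr i j = pullback.lift x b h' ≫ arr' i j) :
    (⟨idx, obj, arr, s, g, n, c⟩ : Cofunctor A B) = ⟨idx, obj', arr', s', g', n', c'⟩ := by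
  obtain rfl : obj = obj' := funext ho
  obtain rfl : arr = arr' := by
    funext i j
    have := ha i j _ (pullback.fst _ _) (pullback.snd _ _) pullback.condition pullback.condition
    have e : pullback.lift (pullback.fst (A.σ i j) (obj i)) (pullback.snd (A.σ i j) (obj i))
        pullback.condition = 𝟙 _ := by
      apply pullback.hom_ext
      · rw [pullback.lift_fst, Category.id_comp]
      · rw [pullback.lift_snd, Category.id_comp]
    rwa [e, Category.id_comp, Category.id_comp] at this
  rfl

/-- The identity cofunctor. -/
noncomputable def id (A : PartiteCategory.{w} C) : Cofunctor A A where
  idx i := i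
  obj i := 𝟙 (A.obj i)
  arr _ _ := pullback.fst _ _
  source i j := by rw [pullback.condition, Category.comp_id]
  target i j := by rw [Category.comp_id]
  unit i := by rw [pullback.lift_fst, Category.id_comp]
  comp i j k := by
    intro R y xb
    rw [pullback.lift_fst]
    congr 1
    apply pullback.hom_ext
    · simp only [pullback.lift_fst]
    · simp only [pullback.lift_snd]

theorem id_act (x : T ⟶ A.arr i j) (b : T ⟶ A.obj i) (h : x ≫ A.σ i j = b ≫ 𝟙 (A.obj i)) :
    (Cofunctor.id A).act x b h = x :=
  pullback.lift_fst (f := A.σ i j) (g := 𝟙 (A.obj i)) x b h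

/-- The action on arrows of a composite of cofunctors. -/
noncomputable def vcompArr (F : Cofunctor A B) (G : Cofunctor B D) (i j : A.I) :
    pullback (A.σ i j) (G.obj (F.idx i) ≫ F.obj i) ⟶
      D.arr (G.idx (F.idx i)) (G.idx (F.idx j)) :=
  pullback.lift
    (pullback.lift (pullback.fst _ _) (pullback.snd _ _ ≫ G.obj (F.idx i))
      (by rw [Category.assoc]; exact pullback.condition) ≫ F.arr i j)
    (pullback.snd _ _)
    (by rw [Category.assoc, F.source, pullback.lift_snd]) ≫ G.arr (F.idx i) (F.idx j)

theorem lift_vcompArr (F : Cofunctor A B) (G : Cofunctor B D) (x : T ⟶ A.arr i j)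
    (b : T ⟶ D.obj (G.idx (F.idx i))) (h : x ≫ A.σ i j = b ≫ G.obj (F.idx i) ≫ F.obj i) :
    pullback.lift x b h ≫ vcompArr F G i j =
      G.act (F.act x (b ≫ G.obj (F.idx i)) (by rw [Category.assoc, h])) b (F.act_σ _ _ _) := by
  refine (G.comp_act _ _ _ (F.act_σ _ _ _)).trans ?_
  refine G.act_congr _ ?_ ?_
  · refine (F.comp_act _ _ _ _).trans (F.act_congr _ ?_ ?_)
    · rw [pullback.lift_fst]
    · rw [pullback.lift_snd_assoc]
  · rw [pullback.lift_snd]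

/-- The composite of cofunctors `F` from `A` to `B` and `G` from `B` to `D`. -/
noncomputable def vcomp (F : Cofunctor A B) (G : Cofunctor B D) : Cofunctor A D where
  idx i := G.idx (F.idx i)
  obj i := G.obj (F.idx i) ≫ F.obj i
  arr i j := vcompArr F G i j
  source i j := G.act_σ _ _ _
  target i j := by
    have h := G.act_τ (F.act (pullback.fst (A.σ i j) (G.obj (F.idx i) ≫ F.obj i))
      (pullback.snd _ _ ≫ G.obj (F.idx i))
        (by rw [Category.assoc]; exact pullback.condition)) (pullback.snd _ _) (F.act_σ _ _ _)
    have h' := congrArg (fun t => t ≫ F.obj j) h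
    simp only [Category.assoc] at h'
    refine h'.trans ?_
    exact F.act_τ _ _ _
  unit i := by
    have e2 := G.act_unit (𝟙 (D.obj (G.idx (F.idx i))))
    refine (lift_vcompArr F G _ _ _).trans (Eq.trans ?_ (e2.trans (Category.id_comp _)))
    refine G.act_congr _ ?_ rfl
    refine Eq.trans ?_ ((F.act_unit (𝟙 _ ≫ G.obj (F.idx i))).trans (Category.assoc _ _ _))
    refine F.act_congr _ ?_ rfl
    rw [Category.id_comp, Category.assoc]
  comp i j k := by
    intro R y xb
    have hx : (xb ≫ pullback.fst _ _) ≫ A.σ i j =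
        (xb ≫ pullback.snd _ _) ≫ G.obj (F.idx i) ≫ F.obj i := by
      rw [Category.assoc, pullback.condition, Category.assoc]
    have hy : y ≫ A.σ j k = (xb ≫ pullback.fst _ _) ≫ A.τ i j := by
      rw [Category.assoc]; exact pullback.condition
    have hxb : xb ≫ vcompArr F G i j =
        G.act (F.act (xb ≫ pullback.fst _ _) ((xb ≫ pullback.snd _ _) ≫ G.obj (F.idx i))
          (hx.trans (Category.assoc _ _ _).symm)) (xb ≫ pullback.snd _ _) (F.act_σ _ _ _) := by
      rw [← lift_vcompArr F G _ _ hx]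
      congr 1
      apply pullback.hom_ext
      · rw [pullback.lift_fst]
      · rw [pullback.lift_snd]
    refine (lift_vcompArr F G _ _ _).trans ?_
    refine (G.act_congr _ (F.act_mul y (xb ≫ pullback.fst _ _)
      ((xb ≫ pullback.snd _ _) ≫ G.obj (F.idx i)) hy (hx.trans (Category.assoc _ _ _).symm)) rfl).trans ?_
    refine (G.act_mul _ _ _ _ (F.act_σ _ _ _)).trans ?_
    refine mul_congr _ ?_ hxb.symm
    refine Eq.trans ?_ (lift_vcompArr F G _ _ _).symm
    have e : xb ≫ vcompArr F G i j ≫ D.τ _ _ =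
        G.act (F.act (xb ≫ pullback.fst _ _) ((xb ≫ pullback.snd _ _) ≫ G.obj (F.idx i))
          (hx.trans (Category.assoc _ _ _).symm)) (xb ≫ pullback.snd _ _) (F.act_σ _ _ _) ≫ D.τ _ _ := by
      rw [← hxb, Category.assoc]
    refine G.act_congr _ (F.act_congr _ rfl ?_) e.symm
    rw [e]
    exact ((Category.assoc _ _ _).trans (G.act_τ _ _ _)).symm

end Cofunctor

/-- The category of partite internal categories and partite cofunctors. -/
noncomputable instance partiteCategoryCat : Category (PartiteCategory.{w} C) where
  Hom A B := Cofunctor A B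
  id A := Cofunctor.id A
  comp F G := Cofunctor.vcomp F G
  id_comp {A B} F := by
    refine Cofunctor.ext_of_act (fun i => Category.comp_id _) ?_
    intro i j T x b h h'
    refine (Cofunctor.lift_vcompArr (Cofunctor.id A) F x b h).trans ?_
    exact F.act_congr _ (Cofunctor.id_act _ _ _) rfl
  comp_id {A B} F := by
    refine Cofunctor.ext_of_act (fun i => Category.id_comp _) ?_
    intro i j T x b h h'
    refine (Cofunctor.lift_vcompArr F (Cofunctor.id B) x b h).trans ?_
    refine (Cofunctor.id_act _ _ _).trans ?_
    exact F.act_congr _ rfl (Category.comp_id _)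
  assoc {A B D E} F G H := by
    refine Cofunctor.ext_of_act (fun i => (Category.assoc _ _ _).symm) ?_
    intro i j T x b h h'
    refine (Cofunctor.lift_vcompArr (Cofunctor.vcomp F G) H x b h).trans ?_
    refine Eq.trans ?_ (Cofunctor.lift_vcompArr F (Cofunctor.vcomp G H) x b h').symm
    refine Eq.trans ?_ (Cofunctor.lift_vcompArr G H _ _ (F.act_σ _ _ _)).symm
    refine H.act_congr _ ?_ rfl
    refine (Cofunctor.lift_vcompArr F G _ _ _).trans ?_
    exact G.act_congr _ (F.act_congr _ rfl (Category.assoc _ _ _)) rfl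

namespace PartiteCategory

/-- A partite internal category is a partite internal groupoid when it admits inverse maps
(which are unique when they exist). -/
def IsGroupoid (A : PartiteCategory.{w} C) : Prop :=
  ∃ ι : ∀ i j, A.arr i j ⟶ A.arr j i,
    (∀ i j, IsTotal (ι i j)) ∧
    (∀ i j, ι j i ≫ ι i j = 𝟙 _) ∧
    ∃ hστ : ∀ i j, ι i j ≫ A.σ j i = A.τ i j,
      ∀ i j, pullback.lift (ι i j) (𝟙 (A.arr i j)) (by rw [hστ, Category.id_comp]) ≫ A.μ i j i =
        A.σ i j ≫ A.η i

end PartiteCategory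

end Partite

section Over

variable (C : Type u) [Category.{v} C] [RestrictionCategory C]

/-- A restriction category equipped with a restriction functor to `C`. -/
structure RCatOver where
  cat : Type w
  [category : Category.{v} cat]
  [restriction : RestrictionCategory cat]
  P : cat ⥤ C
  map_rest : ∀ {X Y : cat} (f : X ⟶ Y), P.map (rest f) = rest (P.map f)

attribute [instance] RCatOver.category RCatOver.restriction

variable {C}

namespace RCatOver

/-- A map of restriction categories over `C`: a restriction functor together with a total natural
transformation filling the triangle. -/
structure Hom (P Q : RCatOver.{w} C) where
  functor : P.cat ⥤ Q.cat
  map_rest : ∀ {X Y : P.cat} (f : X ⟶ Y), functor.map (rest f) = rest (functor.map f)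
  α : functor ⋙ Q.P ⟶ P.P
  α_total : ∀ X, IsTotal (α.app X)

theorem Hom.ext_of_map {P Q : RCatOver.{w} C} {obj : P.cat → Q.cat}
    {map map' : ∀ {X Y : P.cat}, (X ⟶ Y) → (obj X ⟶ obj Y)} {i i' : _} {c c' : _} {r r' : _}
    {α : (⟨obj, map, i, c⟩ : P.cat ⥤ Q.cat) ⋙ Q.P ⟶ P.P}
    {α' : (⟨obj, map', i', c'⟩ : P.cat ⥤ Q.cat) ⋙ Q.P ⟶ P.P} {t t' : _}
    (hm : ∀ {X Y : P.cat} (f : X ⟶ Y), map f = map' f)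
    (hα : ∀ X : P.cat, α.app X = α'.app X) :
    (⟨⟨obj, map, i, c⟩, r, α, t⟩ : Hom P Q) = ⟨⟨obj, map', i', c'⟩, r', α', t'⟩ := by
  obtain rfl : @map = @map' := by
    funext X Y f; exact hm f
  obtain rfl : α = α' := by
    ext X; exact hα X
  rfl

instance : Category (RCatOver.{w} C) where
  Hom P Q := Hom P Q
  id P := ⟨𝟭 P.cat, fun _ => rfl, 𝟙 P.P, fun X => isTotal_id⟩
  comp {P Q R} F G :=
    { functor := F.functor ⋙ G.functor
      map_rest := fun f => by
        rw [Functor.comp_map, F.map_rest, G.map_rest, Functor.comp_map]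
      α := { app := fun X => G.α.app (F.functor.obj X) ≫ F.α.app X
             naturality := fun X Y f => by
               have h1 := G.α.naturality (F.functor.map f)
               have h2 := F.α.naturality f
               dsimp at h1 h2 ⊢
               rw [← Category.assoc, h1, Category.assoc, h2, Category.assoc] }
      α_total := fun X =>
        have := G.α_total (F.functor.obj X)
        have := F.α_total X
        isTotal_comp _ _ }
  id_comp _ := Hom.ext_of_map (fun _ => rfl) (fun _ => Category.comp_id _)
  comp_id _ := Hom.ext_of_map (fun _ => rfl) (fun _ => Category.id_comp _)
  assoc _ _ _ := Hom.ext_of_map (fun _ => rfl) (fun _ => (Category.assoc _ _ _).symm)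

/-- The restriction functor is hyperconnected: it induces isomorphisms on the semilattices of
restriction idempotents. -/
def IsHyperconnected (P : RCatOver.{w} C) : Prop :=
  ∀ X : P.cat, Function.Bijective
    (fun e : RestrictionIdempotent X =>
      (⟨P.P.map e.1, by rw [← P.map_rest, e.2]⟩ : RestrictionIdempotent (P.P.obj X)))

end RCatOver

variable (C)

/-- Inverse categories over `C`: the full subcategory of restriction categories over `C` on those
whose total category is an inverse category. -/
abbrev ICatOver := ObjectProperty.FullSubcategory
  (fun P : RCatOver.{w} C => IsInverseCategory P.cat)

/-- Join inverse categories hyperconnected over `C`, as a property of inverse categories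
over `C`. -/
def isJoinHyperconnected : ObjectProperty (ICatOver.{w} C) := fun P =>
  IsJoinInverseCategory P.obj.cat ∧ P.obj.IsHyperconnected

/-- The category of partite internal groupoids and partite cofunctors. -/
abbrev PartiteGroupoid := ObjectProperty.FullSubcategory
  (fun A : PartiteCategory.{w} C => A.IsGroupoid)

/-- Étale partite internal groupoids: those whose source maps are local homeomorphisms. -/
def isEtaleGroupoid : ObjectProperty (PartiteGroupoid.{w} C) := fun A =>
  ∀ i j, IsLocalHomeo (A.obj.σ i j)

end Over

section Externalisation

open PartiteCategory

variable {C : Type u} [Category.{v} C] [RestrictionCategory C]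

/-- The pullback of a partial section `s` of `p` along `f`. -/
noncomputable def pullSection {X Y Z : C} (p : Z ⟶ X) (f : Y ⟶ X) [HasPullback p f] (s : X ⟶ Z)
    (hs : IsPartialSection p s) : Y ⟶ pullback p f :=
  pullback.lift (f ≫ s) (rest (f ≫ s))
    (by rw [Category.assoc, show s ≫ p = rest s from hs, comp_rest])

variable (A : PartiteCategory.{w} C)

/-- The objects of the externalisation of `A` are the components of `A`. -/
structure PhiCat where
  idx : A.I

variable {A}

/-- The maps of the externalisation are the partial sections of the source maps. -/
abbrev PhiHom (i j : PhiCat A) : Type v :=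
  {s : A.obj i.idx ⟶ A.arr i.idx j.idx // IsPartialSection (A.σ i.idx j.idx) s}

theorem PhiHom.section_eq {i j : PhiCat A} (s : PhiHom i j) : s.1 ≫ A.σ i.idx j.idx = rest s.1 :=
  s.2

theorem PhiHom.mul_aux {i j k : PhiCat A} (s : PhiHom i j) (t : PhiHom j k) :
    ((s.1 ≫ A.τ i.idx j.idx) ≫ t.1) ≫ A.σ j.idx k.idx =
      (rest ((s.1 ≫ A.τ i.idx j.idx) ≫ t.1) ≫ s.1) ≫ A.τ i.idx j.idx := by
  rw [Category.assoc, t.section_eq, comp_rest, Category.assoc, Category.assoc]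

theorem PhiHom.compVal_eq {i j k : PhiCat A} (s : PhiHom i j) (t : PhiHom j k) :
    s.1 ≫ pullSection (A.σ j.idx k.idx) (A.τ i.idx j.idx) t.1 t.2 ≫ A.μ i.idx j.idx k.idx =
      mul ((s.1 ≫ A.τ i.idx j.idx) ≫ t.1)
        (rest ((s.1 ≫ A.τ i.idx j.idx) ≫ t.1) ≫ s.1) (s.mul_aux t) := by
  rw [mul, ← Category.assoc]
  congr 1
  apply pullback.hom_ext
  · rw [pullSection, Category.assoc, pullback.lift_fst, pullback.lift_fst, Category.assoc]
  · rw [pullSection, Category.assoc, pullback.lift_snd, pullback.lift_snd, comp_rest,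
      Category.assoc]

theorem PhiHom.rest_mul_aux {i j k : PhiCat A} (s : PhiHom i j) (t : PhiHom j k) :
    rest (mul ((s.1 ≫ A.τ i.idx j.idx) ≫ t.1)
        (rest ((s.1 ≫ A.τ i.idx j.idx) ≫ t.1) ≫ s.1) (s.mul_aux t)) =
      rest ((s.1 ≫ A.τ i.idx j.idx) ≫ t.1) := by
  have h := rest_comp_comp (s.1 ≫ A.τ i.idx j.idx) t.1
  rw [rest_comp_total s.1] at h
  rw [rest_mul, rest_rest_comp, h]

/-- Composition in the externalisation: the composite of `s` and `t` is `s`, followed by the pullback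
of `t` along the target map, followed by the composition map. -/
noncomputable def PhiHom.comp {i j k : PhiCat A} (s : PhiHom i j) (t : PhiHom j k) :
    PhiHom i k :=
  ⟨s.1 ≫ pullSection (A.σ j.idx k.idx) (A.τ i.idx j.idx) t.1 t.2 ≫ A.μ i.idx j.idx k.idx, by
    change (_ ≫ _ ≫ _) ≫ _ = rest _
    rw [compVal_eq, mul_σ, rest_mul_aux, Category.assoc, s.section_eq, ← rest_rest_comp]
    have h := rest_mul_aux s t
    rw [rest_mul] at h
    exact h⟩

theorem PhiHom.comp_val {i j k : PhiCat A} (s : PhiHom i j) (t : PhiHom j k) :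
    (PhiHom.comp s t).1 = mul ((s.1 ≫ A.τ i.idx j.idx) ≫ t.1)
        (rest ((s.1 ≫ A.τ i.idx j.idx) ≫ t.1) ≫ s.1) (s.mul_aux t) := compVal_eq s t

theorem PhiHom.rest_comp_val {i j k : PhiCat A} (s : PhiHom i j) (t : PhiHom j k) :
    rest (PhiHom.comp s t).1 = rest ((s.1 ≫ A.τ i.idx j.idx) ≫ t.1) := by
  rw [comp_val, rest_mul_aux]

theorem PhiHom.comp_val_τ {i j k : PhiCat A} (s : PhiHom i j) (t : PhiHom j k) :
    (PhiHom.comp s t).1 ≫ A.τ i.idx k.idx =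
      (s.1 ≫ A.τ i.idx j.idx) ≫ t.1 ≫ A.τ j.idx k.idx := by
  rw [comp_val, mul_τ, Category.assoc]

/-- The identities of the externalisation are the identity maps of `A`. -/
def PhiHom.id (i : PhiCat A) : PhiHom i i :=
  ⟨A.η i.idx, by
    change _ = rest _
    rw [A.η_σ, (isTotal_η A i.idx).rest_eq]⟩

/-- The restriction of `s` in the externalisation. -/
def PhiHom.restr {i j : PhiCat A} (s : PhiHom i j) : PhiHom i i :=
  ⟨rest s.1 ≫ A.η i.idx, by
    change _ = rest _
    rw [Category.assoc, A.η_σ, Category.comp_id, rest_comp_total, rest_rest]⟩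

theorem PhiHom.restr_comp_val {i j k : PhiCat A} (t : PhiHom i j) (s : PhiHom i k) :
    (PhiHom.comp t.restr s).1 = rest t.1 ≫ s.1 := by
  have e : (rest t.1 ≫ A.η i.idx) ≫ A.τ i.idx i.idx = rest t.1 := by
    rw [Category.assoc, A.η_τ, Category.comp_id]
  rw [comp_val]
  refine Eq.trans (mul_congr _ ?_ ?_) (mul_unit (rest t.1 ≫ s.1))
  · change ((rest t.1 ≫ A.η _) ≫ _) ≫ _ = _
    rw [e]
  · change rest (((rest t.1 ≫ A.η _) ≫ _) ≫ _) ≫ rest t.1 ≫ A.η _ = _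
    rw [e, rest_rest_comp]
    simp only [Category.assoc]
    rw [← Category.assoc s.1, s.section_eq, ← Category.assoc (rest s.1), rest_comm s.1 t.1,
      Category.assoc, ← Category.assoc (rest t.1), rest_idem]

theorem PhiHom.comp_restr_val {i j k : PhiCat A} (s : PhiHom i j) (t : PhiHom j k) :
    (PhiHom.comp s t.restr).1 = rest ((s.1 ≫ A.τ i.idx j.idx) ≫ t.1) ≫ s.1 := by
  rw [comp_val]
  have e : (s.1 ≫ A.τ i.idx j.idx) ≫ rest t.1 ≫ A.η j.idx =
      rest ((s.1 ≫ A.τ i.idx j.idx) ≫ t.1) ≫ s.1 ≫ A.τ i.idx j.idx ≫ A.η j.idx := by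
    rw [← Category.assoc, comp_rest]; simp only [Category.assoc]
  refine Eq.trans (mul_congr _ ?_ ?_)
    (unit_mul (rest ((s.1 ≫ A.τ i.idx j.idx) ≫ t.1) ≫ s.1))
  · refine e.trans ?_
    simp only [Category.assoc]
  · change rest ((s.1 ≫ _) ≫ rest t.1 ≫ A.η _) ≫ s.1 = _
    rw [← Category.assoc (s.1 ≫ _) (rest t.1), rest_comp_total _ (A.η _), rest_comp_rest]

noncomputable instance : Category.{v} (PhiCat A) where
  Hom i j := PhiHom i j
  id i := PhiHom.id i
  comp s t := PhiHom.comp s t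
  id_comp {i j} s := by
    have e : PhiHom.id i = PhiHom.restr (PhiHom.id i) := Subtype.ext (by
      change A.η _ = rest (A.η _) ≫ A.η _
      rw [rest_comp_self])
    refine Subtype.ext ?_
    rw [e, PhiHom.restr_comp_val]
    change rest (A.η _) ≫ _ = _
    rw [(isTotal_η A i.idx).rest_eq, Category.id_comp]
  comp_id {i j} s := by
    have e : PhiHom.id j = PhiHom.restr (PhiHom.id j) := Subtype.ext (by
      change A.η _ = rest (A.η _) ≫ A.η _
      rw [rest_comp_self])
    refine Subtype.ext ?_
    rw [e, PhiHom.comp_restr_val]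
    change rest (_ ≫ A.η _) ≫ _ = _
    rw [rest_comp_total _ (A.η _), rest_comp_total, rest_comp_self]
  assoc {i j k l} s t u := by
    refine Subtype.ext ?_
    refine (PhiHom.comp_val _ _).trans (Eq.trans ?_ (PhiHom.comp_val _ _).symm)
    -- the total composite target
    have a1 : ((PhiHom.comp s t).1 ≫ A.τ i.idx k.idx) ≫ u.1 =
        (s.1 ≫ A.τ i.idx j.idx) ≫ (t.1 ≫ A.τ j.idx k.idx) ≫ u.1 := by
      rw [PhiHom.comp_val_τ, Category.assoc]
    have a2 : rest ((s.1 ≫ A.τ i.idx j.idx) ≫ (PhiHom.comp t u).1) =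
        rest ((s.1 ≫ A.τ i.idx j.idx) ≫ (t.1 ≫ A.τ j.idx k.idx) ≫ u.1) := by
      rw [← rest_comp_rest, PhiHom.rest_comp_val, rest_comp_rest]
    have b1 : (s.1 ≫ A.τ i.idx j.idx) ≫ rest ((t.1 ≫ A.τ j.idx k.idx) ≫ u.1) =
        rest ((s.1 ≫ A.τ i.idx j.idx) ≫ (t.1 ≫ A.τ j.idx k.idx) ≫ u.1) ≫
          (s.1 ≫ A.τ i.idx j.idx) := comp_rest _ _
    have c1 : rest ((s.1 ≫ A.τ i.idx j.idx) ≫ (t.1 ≫ A.τ j.idx k.idx) ≫ u.1) ≫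
        rest ((s.1 ≫ A.τ i.idx j.idx) ≫ t.1) =
          rest ((s.1 ≫ A.τ i.idx j.idx) ≫ (t.1 ≫ A.τ j.idx k.idx) ≫ u.1) := by
      have := rest_comp_comp ((s.1 ≫ A.τ i.idx j.idx) ≫ t.1) (A.τ j.idx k.idx ≫ u.1)
      simpa only [Category.assoc] using this
    generalize hE : rest ((s.1 ≫ A.τ i.idx j.idx) ≫ (t.1 ≫ A.τ j.idx k.idx) ≫ u.1) = E
      at a2 b1 c1
    have hz : ((s.1 ≫ A.τ i.idx j.idx) ≫ (t.1 ≫ A.τ j.idx k.idx) ≫ u.1) ≫ A.σ k.idx l.idx =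
        (E ≫ (s.1 ≫ A.τ i.idx j.idx) ≫ t.1) ≫ A.τ j.idx k.idx := by
      simp only [Category.assoc]
      rw [u.section_eq]
      rw [← Category.assoc t.1, ← Category.assoc s.1, ← Category.assoc (s.1 ≫ _),
        comp_rest, ← hE]
      simp only [Category.assoc]
    have hy : (E ≫ (s.1 ≫ A.τ i.idx j.idx) ≫ t.1) ≫ A.σ j.idx k.idx =
        (E ≫ s.1) ≫ A.τ i.idx j.idx := by
      simp only [Category.assoc]
      rw [t.section_eq, ← Category.assoc s.1, comp_rest, ← Category.assoc E, c1]
    have key := mul_assoc _ _ _ hy hz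
    refine Eq.trans (mul_congr _ a1 ?_) (key.trans (mul_congr _ ?_ ?_).symm)
    · rw [a1, hE, PhiHom.comp_val, comp_mul]
      refine mul_congr _ rfl ?_
      rw [← Category.assoc, c1]
    · rw [PhiHom.comp_val, comp_mul]
      refine mul_congr _ rfl ?_
      rw [← Category.assoc (s.1 ≫ _), b1]
      simp only [Category.assoc]
    · rw [a2]

theorem phi_comp_eq {i j k : PhiCat A} (s : i ⟶ j) (t : j ⟶ k) : s ≫ t = PhiHom.comp s t := rfl

noncomputable instance : RestrictionCategory (PhiCat A) where
  rest s := PhiHom.restr s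
  rest_comp_self s := Subtype.ext (by
    rw [phi_comp_eq, PhiHom.restr_comp_val, rest_comp_self])
  rest_comm s t := Subtype.ext (by
    rw [phi_comp_eq, phi_comp_eq, PhiHom.restr_comp_val, PhiHom.restr_comp_val]
    change rest s.1 ≫ rest t.1 ≫ A.η _ = rest t.1 ≫ rest s.1 ≫ A.η _
    rw [← Category.assoc, rest_comm, Category.assoc])
  rest_rest_comp s t := Subtype.ext (by
    rw [phi_comp_eq, phi_comp_eq, PhiHom.restr_comp_val]
    change rest (PhiHom.comp (PhiHom.restr s) t).1 ≫ A.η _ = rest s.1 ≫ rest t.1 ≫ A.η _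
    rw [PhiHom.restr_comp_val, rest_rest_comp, Category.assoc])
  comp_rest s t := Subtype.ext (by
    rw [phi_comp_eq, phi_comp_eq, phi_comp_eq, PhiHom.comp_restr_val, PhiHom.restr_comp_val,
      PhiHom.rest_comp_val])

theorem phi_rest_eq {i j : PhiCat A} (s : i ⟶ j) : rest s = PhiHom.restr s := rfl

variable (A)

/-- The projection of the externalisation to `C`. -/
noncomputable def phiProj : PhiCat A ⥤ C where
  obj i := A.obj i.idx
  map {i j} s := s.1 ≫ A.τ i.idx j.idx
  map_id i := A.η_τ i.idx
  map_comp s t := by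
    rw [phi_comp_eq, PhiHom.comp_val_τ]

theorem phiProj_map_rest {i j : PhiCat A} (s : i ⟶ j) :
    (phiProj A).map (rest s) = rest ((phiProj A).map s) := by
  change (rest s.1 ≫ A.η _) ≫ A.τ _ _ = rest (s.1 ≫ A.τ _ _)
  rw [Category.assoc, A.η_τ, Category.comp_id, rest_comp_total]

/-- The externalisation of a partite internal category. -/
noncomputable def phiObj : RCatOver.{w} C where
  cat := PhiCat A
  P := phiProj A
  map_rest := phiProj_map_rest A

variable {A} {B D : PartiteCategory.{w} C}

theorem phiMap_aux (F : Cofunctor A B) {i j : PhiCat A} (s : PhiHom i j) :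
    (F.obj i.idx ≫ s.1) ≫ A.σ i.idx j.idx = rest (F.obj i.idx ≫ s.1) ≫ F.obj i.idx := by
  rw [Category.assoc, s.section_eq, comp_rest]

/-- The action on maps of the externalisation of a cofunctor `F`: the pullback of the partial section
`s` along the action of `F` on objects, followed by the action of `F` on arrows. -/
noncomputable def phiMapHom (F : Cofunctor A B) {i j : PhiCat A} (s : PhiHom i j) :
    PhiHom (⟨F.idx i.idx⟩ : PhiCat B) ⟨F.idx j.idx⟩ :=
  ⟨pullSection (A.σ i.idx j.idx) (F.obj i.idx) s.1 s.2 ≫ F.arr i.idx j.idx, by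
    have h := F.act_σ (F.obj i.idx ≫ s.1) (rest (F.obj i.idx ≫ s.1)) (phiMap_aux F s)
    have h' := rest_comp_total
      (F.act (F.obj i.idx ≫ s.1) (rest (F.obj i.idx ≫ s.1)) (phiMap_aux F s))
      (B.σ (F.idx i.idx) (F.idx j.idx))
    rw [h, rest_rest] at h'
    exact h.trans h'⟩

theorem phiMapHom_val (F : Cofunctor A B) {i j : PhiCat A} (s : PhiHom i j) :
    (phiMapHom F s).1 =
      F.act (F.obj i.idx ≫ s.1) (rest (F.obj i.idx ≫ s.1)) (phiMap_aux F s) := rfl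

theorem rest_phiMapHom_val (F : Cofunctor A B) {i j : PhiCat A} (s : PhiHom i j) :
    rest (phiMapHom F s).1 = rest (F.obj i.idx ≫ s.1) := by
  rw [← (phiMapHom F s).section_eq, phiMapHom_val, Cofunctor.act_σ]

theorem phiMapHom_τ (F : Cofunctor A B) {i j : PhiCat A} (s : PhiHom i j) :
    ((phiMapHom F s).1 ≫ B.τ (F.idx i.idx) (F.idx j.idx)) ≫ F.obj j.idx =
      F.obj i.idx ≫ s.1 ≫ A.τ i.idx j.idx := by
  rw [Category.assoc, phiMapHom_val, Cofunctor.act_τ, Category.assoc]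

theorem phiMapHom_comp (F : Cofunctor A B) {i j k : PhiCat A} (s : PhiHom i j) (t : PhiHom j k) :
    phiMapHom F (PhiHom.comp s t) = PhiHom.comp (phiMapHom F s) (phiMapHom F t) := by
  refine Subtype.ext ?_
  have hτ := phiMapHom_τ F s
  have hrT := rest_phiMapHom_val F t
  have hrS := rest_phiMapHom_val F s
  obtain ⟨u, hu⟩ : ∃ u, u = F.obj i.idx ≫ (s.1 ≫ A.τ i.idx j.idx) ≫ t.1 := ⟨_, rfl⟩
  have e1 : F.obj i.idx ≫ rest ((s.1 ≫ A.τ i.idx j.idx) ≫ t.1) = rest u ≫ F.obj i.idx := by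
    rw [comp_rest, hu]
  have e2 : rest (F.obj i.idx ≫ (PhiHom.comp s t).1) = rest u := by
    rw [← rest_comp_rest, PhiHom.rest_comp_val, rest_comp_rest, hu]
  have e3 : F.obj i.idx ≫ (PhiHom.comp s t).1 =
      mul u (rest u ≫ F.obj i.idx ≫ s.1) (by
        have := s.mul_aux t
        rw [hu, Category.assoc, this, ← Category.assoc, ← Category.assoc, e1, hu]
        simp only [Category.assoc]) := by
    rw [PhiHom.comp_val, comp_mul]
    refine mul_congr _ hu.symm ?_
    rw [← Category.assoc, e1, Category.assoc]
  have e4 : rest u ≫ rest (F.obj i.idx ≫ s.1) = rest u := by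
    have := rest_comp_comp (F.obj i.idx ≫ s.1) (A.τ i.idx j.idx ≫ t.1)
    rw [hu]
    simpa only [Category.assoc] using this
  have hx : (rest u ≫ F.obj i.idx ≫ s.1) ≫ A.σ i.idx j.idx = rest u ≫ F.obj i.idx := by
    have := phiMap_aux F s
    rw [Category.assoc, this, ← Category.assoc, e4]
  have e5 : rest u ≫ (phiMapHom F s).1 = F.act (rest u ≫ F.obj i.idx ≫ s.1) (rest u) hx := by
    rw [phiMapHom_val, Cofunctor.comp_act]
    exact F.act_congr _ rfl e4
  have e6 : ((phiMapHom F s).1 ≫ B.τ (F.idx i.idx) (F.idx j.idx)) ≫ F.obj j.idx ≫ t.1 = u := by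
    rw [← Category.assoc, hτ, hu, Category.assoc]
  have e7 : ((phiMapHom F s).1 ≫ B.τ (F.idx i.idx) (F.idx j.idx)) ≫ rest (F.obj j.idx ≫ t.1) =
      rest u ≫ (phiMapHom F s).1 ≫ B.τ (F.idx i.idx) (F.idx j.idx) := by
    rw [comp_rest, e6]
  have e8 : rest (((phiMapHom F s).1 ≫ B.τ (F.idx i.idx) (F.idx j.idx)) ≫ (phiMapHom F t).1) =
      rest u := by
    rw [← rest_comp_rest, hrT, rest_comp_rest, e6]
  rw [PhiHom.comp_val, phiMapHom_val]
  refine (F.act_congr _ e3 e2).trans ?_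
  refine (F.act_mul _ _ _ _ hx).trans ?_
  refine mul_congr _ ?_ ?_
  · rw [phiMapHom_val F t, Cofunctor.comp_act]
    refine F.act_congr _ e6.symm ?_
    rw [e7, ← e5, Category.assoc]
  · rw [← e5]
    refine Eq.symm (congrArg (fun x => x ≫ (phiMapHom F s).1) e8)

theorem phiMapHom_id (F : Cofunctor A B) (i : PhiCat A) :
    phiMapHom F (PhiHom.id i) = PhiHom.id (⟨F.idx i.idx⟩ : PhiCat B) := by
  refine Subtype.ext ?_
  rw [phiMapHom_val]
  refine Eq.trans ?_ ((F.act_unit (𝟙 _)).trans (Category.id_comp _))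
  refine F.act_congr _ (Category.id_comp _).symm ?_
  exact IsTotal.rest_eq (f := F.obj i.idx ≫ A.η i.idx)

theorem phiMapHom_restr (F : Cofunctor A B) {i j : PhiCat A} (s : PhiHom i j) :
    phiMapHom F s.restr = (phiMapHom F s).restr := by
  refine Subtype.ext ?_
  have e : rest (phiMapHom F s).1 ≫ B.η (F.idx i.idx) =
      rest (F.obj i.idx ≫ s.1) ≫ B.η (F.idx i.idx) := by rw [rest_phiMapHom_val]
  refine Eq.trans ?_ e.symm
  rw [phiMapHom_val]
  refine Eq.trans ?_ (F.act_unit (rest (F.obj i.idx ≫ s.1)))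
  refine F.act_congr _ ?_ ?_
  · change F.obj _ ≫ rest s.1 ≫ A.η _ = _
    rw [← Category.assoc, comp_rest, Category.assoc]
  · change rest (F.obj _ ≫ rest s.1 ≫ A.η _) = _
    rw [← Category.assoc, rest_comp_total _ (A.η _), rest_comp_rest]

/-- The externalisation of a cofunctor, as a map of restriction categories over `C`. -/
noncomputable def phiMap (F : Cofunctor A B) : RCatOver.Hom (phiObj A) (phiObj B) where
  functor :=
    { obj := fun i => (⟨F.idx i.idx⟩ : PhiCat B)
      map := fun s => phiMapHom F s
      map_id := fun i => phiMapHom_id F i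
      map_comp := fun s t => phiMapHom_comp F s t }
  map_rest s := phiMapHom_restr F s
  α :=
    { app := fun i => F.obj i.idx
      naturality := fun _ _ s => phiMapHom_τ F s }
  α_total i := F.obj_total i.idx

theorem phiMapHom_idCofunctor {i j : PhiCat A} (s : PhiHom i j) :
    phiMapHom (Cofunctor.id A) s = s := by
  refine Subtype.ext ?_
  exact (Cofunctor.id_act _ _ _).trans (Category.id_comp _)

theorem phiMapHom_vcomp (F : Cofunctor A B) (G : Cofunctor B D) {i j : PhiCat A}
    (s : PhiHom i j) : phiMapHom (Cofunctor.vcomp F G) s = phiMapHom G (phiMapHom F s) := by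
  refine Subtype.ext ?_
  refine (Cofunctor.lift_vcompArr F G _ _ (phiMap_aux (Cofunctor.vcomp F G) s)).trans ?_
  have e1 : rest ((Cofunctor.vcomp F G).obj i.idx ≫ s.1) ≫ G.obj (F.idx i.idx) =
      G.obj (F.idx i.idx) ≫ rest (F.obj i.idx ≫ s.1) := by
    rw [comp_rest]
    exact congrArg (fun x => rest x ≫ G.obj (F.idx i.idx)) (Category.assoc _ _ _)
  rw [phiMapHom_val G]
  refine G.act_congr _ ?_ ?_
  · rw [phiMapHom_val F, Cofunctor.comp_act]
    exact F.act_congr _ (Category.assoc _ _ _) e1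
  · change rest ((G.obj _ ≫ F.obj _) ≫ s.1) = _
    rw [← rest_comp_rest (G.obj _), rest_phiMapHom_val, rest_comp_rest, Category.assoc]

variable (C)

/-- Externalisation, from partite internal categories to restriction categories over `C`. -/
noncomputable def Phi : PartiteCategory.{w} C ⥤ RCatOver.{w} C where
  obj A := phiObj A
  map F := phiMap F
  map_id _ := RCatOver.Hom.ext_of_map (c' := fun _ _ => rfl)
    (fun s => phiMapHom_idCofunctor s) (fun _ => rfl)
  map_comp F G := RCatOver.Hom.ext_of_map (fun s => phiMapHom_vcomp F G s) (fun _ => rfl)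

end Externalisation

section Groupoids

open PartiteCategory

variable {C : Type u} [Category.{v} C] [RestrictionCategory C]

theorem isPartialInverse_map {P Q : RCatOver.{w} C} (F : RCatOver.Hom P Q) {X Y : P.cat}
    {s : X ⟶ Y} {t : Y ⟶ X} (h : IsPartialInverse s t) :
    IsPartialInverse (F.functor.map s) (F.functor.map t) := by
  constructor
  · rw [← Functor.map_comp, h.1, F.map_rest]
  · rw [← Functor.map_comp, h.2, F.map_rest]

theorem isPartialIso_proj (P : RCatOver.{w} C) {X Y : P.cat} {s : X ⟶ Y} (h : IsPartialIso s) :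
    IsPartialIso (P.P.map s) := by
  obtain ⟨t, h⟩ := h
  exact ⟨P.P.map t, by rw [← Functor.map_comp, h.1, P.map_rest],
    by rw [← Functor.map_comp, h.2, P.map_rest]⟩

/-- Partial bisections: the partial sections `s` of the source map for which the composite of `s`
with the target map is a partial isomorphism. -/
def partialBisections (A : PartiteCategory.{w} C) : MorphismProperty (PhiCat A) :=
  fun i j s => IsPartialIso (s.1 ≫ A.τ i.idx j.idx)

instance (A : PartiteCategory.{w} C) : (partialBisections A).IsMultiplicative where
  id_mem i := by
    change IsPartialIso (A.η i.idx ≫ A.τ i.idx i.idx)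
    rw [A.η_τ]
    exact isPartialIso_id
  comp_mem s t hs ht := by
    have h := isPartialIso_comp hs ht
    have e := (phiProj A).map_comp s t
    change IsPartialIso ((phiProj A).map (s ≫ t))
    rw [e]
    exact h

theorem partialBisections_rest {A : PartiteCategory.{w} C} {i j : PhiCat A} (s : i ⟶ j) :
    partialBisections A (rest s) := by
  have h := phiProj_map_rest A s
  change IsPartialIso ((phiProj A).map (rest s))
  rw [h]
  exact isPartialIso_rest _

/-- The subcategory of the externalisation with all objects and the partial bisections as maps. -/
abbrev PhiGCat (A : PartiteCategory.{w} C) := WideSubcategory (partialBisections A)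

noncomputable instance (A : PartiteCategory.{w} C) : RestrictionCategory (PhiGCat A) where
  rest s := ⟨rest s.1, partialBisections_rest s.1⟩
  rest_comp_self s := WideSubcategory.hom_ext _ (rest_comp_self s.1)
  rest_comm s t := WideSubcategory.hom_ext _ (rest_comm s.1 t.1)
  rest_rest_comp s t := WideSubcategory.hom_ext _ (rest_rest_comp s.1 t.1)
  comp_rest s t := WideSubcategory.hom_ext _ (comp_rest s.1 t.1)

/-- The partial bisections of `A`, as a restriction category over `C`. -/
noncomputable def phiGOver (A : PartiteCategory.{w} C) : RCatOver.{w} C where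
  cat := PhiGCat A
  P := wideSubcategoryInclusion _ ⋙ phiProj A
  map_rest s := phiProj_map_rest A s.1

/-- In a partite internal groupoid, partial bisections have partial inverses in the
externalisation, which are again partial bisections. -/
theorem exists_isPartialInverse {A : PartiteCategory.{w} C} (hA : A.IsGroupoid) {i j : PhiCat A}
    (f : i ⟶ j) (hf : partialBisections A f) :
    ∃ g : j ⟶ i, partialBisections A g ∧ IsPartialInverse f g := by
  obtain ⟨ι, hι, hinv, hστ, hl⟩ := hA
  obtain ⟨h', hh⟩ := hf
  have := hι i.idx j.idx
  have hτσ : ι i.idx j.idx ≫ A.τ j.idx i.idx = A.σ i.idx j.idx := by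
    rw [← hστ j.idx i.idx, ← Category.assoc, hinv, Category.id_comp]
  have hl' : mul (ι i.idx j.idx) (𝟙 (A.arr i.idx j.idx)) (by rw [hστ, Category.id_comp]) =
      A.σ i.idx j.idx ≫ A.η i.idx := hl i.idx j.idx
  have hr' : mul (𝟙 (A.arr i.idx j.idx)) (ι i.idx j.idx) (by rw [hτσ, Category.id_comp]) =
      A.τ i.idx j.idx ≫ A.η j.idx := by
    have e : ι i.idx j.idx ≫ mul (ι j.idx i.idx) (𝟙 (A.arr j.idx i.idx))
        (by rw [hστ, Category.id_comp]) = ι i.idx j.idx ≫ A.σ j.idx i.idx ≫ A.η j.idx :=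
      congrArg (fun x => ι i.idx j.idx ≫ x) (hl j.idx i.idx)
    have e' : ι i.idx j.idx ≫ A.σ j.idx i.idx ≫ A.η j.idx = A.τ i.idx j.idx ≫ A.η j.idx := by
      rw [← Category.assoc, hστ]
    refine Eq.trans ?_ (e.trans e')
    rw [comp_mul]
    exact mul_congr _ (hinv _ _).symm (Category.comp_id _).symm
  have fs : f.1 ≫ A.σ i.idx j.idx = rest f.1 := PhiHom.section_eq f
  have h1 : (f.1 ≫ A.τ i.idx j.idx) ≫ h' = rest f.1 := by
    rw [hh.1, rest_comp_total]
  have h2 : h' ≫ f.1 ≫ A.τ i.idx j.idx = rest h' := hh.2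
  have h3 : rest (h' ≫ f.1) = rest h' := by
    rw [← rest_comp_total (h' ≫ f.1) (A.τ i.idx j.idx), Category.assoc, h2, rest_rest]
  have h4 : h' ≫ rest f.1 = h' := by
    rw [comp_rest, h3, rest_comp_self]
  have gs : (h' ≫ f.1 ≫ ι i.idx j.idx) ≫ A.σ j.idx i.idx = rest h' := by
    rw [Category.assoc, Category.assoc, hστ, h2]
  have gr : rest (h' ≫ f.1 ≫ ι i.idx j.idx) = rest h' := by
    rw [← Category.assoc, rest_comp_total, h3]
  have gτ : (h' ≫ f.1 ≫ ι i.idx j.idx) ≫ A.τ j.idx i.idx = h' := by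
    rw [Category.assoc, Category.assoc, hτσ, fs, h4]
  let g : PhiHom j i := ⟨h' ≫ f.1 ≫ ι i.idx j.idx, by
    change _ = rest _
    rw [gs, gr]⟩
  have gval : g.1 = h' ≫ f.1 ≫ ι i.idx j.idx := rfl
  refine ⟨g, ⟨f.1 ≫ A.τ i.idx j.idx, ?_⟩, ?_, ?_⟩
  · rw [gval, gτ]
    exact isPartialInverse_symm hh
  · refine Subtype.ext ?_
    refine (PhiHom.comp_val f g).trans ?_
    have e1 : (f.1 ≫ A.τ i.idx j.idx) ≫ g.1 = f.1 ≫ ι i.idx j.idx := by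
      rw [gval, ← Category.assoc, h1, ← Category.assoc, rest_comp_self]
    have e2 : rest ((f.1 ≫ A.τ i.idx j.idx) ≫ g.1) ≫ f.1 = f.1 ≫ 𝟙 _ := by
      rw [e1, rest_comp_total, rest_comp_self, Category.comp_id]
    refine (mul_congr _ e1 e2).trans ?_
    have e3 := congrArg (fun x => f.1 ≫ x) hl'
    refine Eq.trans ?_ (e3.trans ?_)
    · exact (comp_mul _ _ _ _).symm
    · change _ = rest f.1 ≫ A.η _
      rw [← fs, Category.assoc]
  · refine Subtype.ext ?_
    refine (PhiHom.comp_val g f).trans ?_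
    have e1 : (g.1 ≫ A.τ j.idx i.idx) ≫ f.1 = (h' ≫ f.1) ≫ 𝟙 _ := by
      rw [gval, gτ, Category.comp_id]
    have e2 : rest ((g.1 ≫ A.τ j.idx i.idx) ≫ f.1) ≫ g.1 = (h' ≫ f.1) ≫ ι i.idx j.idx := by
      rw [e1, Category.comp_id, h3, gval, ← Category.assoc, rest_comp_self, Category.assoc]
    refine (mul_congr _ e1 e2).trans ?_
    have e3 := congrArg (fun x => (h' ≫ f.1) ≫ x) hr'
    refine Eq.trans ?_ (e3.trans ?_)
    · exact (comp_mul _ _ _ _).symm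
    · change _ = rest g.1 ≫ A.η _
      rw [gval, gr, ← h2]
      simp only [Category.assoc]

theorem isInverseCategory_phiG {A : PartiteCategory.{w} C} (hA : A.IsGroupoid) :
    IsInverseCategory (PhiGCat A) :=
  isInverseCategory_of_isPartialIso (fun s => by
    obtain ⟨g, hg, h1, h2⟩ := exists_isPartialInverse hA s.1 s.2
    exact ⟨⟨g, hg⟩, WideSubcategory.hom_ext _ h1, WideSubcategory.hom_ext _ h2⟩)

theorem partialBisections_map {A B : PartiteCategory.{w} C} (hA : A.IsGroupoid) (F : A ⟶ B)
    {i j : PhiCat A} (s : i ⟶ j) (hs : partialBisections A s) :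
    partialBisections B (((Phi C).map F).functor.map s) := by
  obtain ⟨g, -, hg⟩ := exists_isPartialInverse hA s hs
  exact isPartialIso_proj (phiObj B) ⟨_, isPartialInverse_map ((Phi C).map F) hg⟩

/-- The action of a cofunctor on partial bisections. -/
noncomputable def phiGMap {A B : PartiteCategory.{w} C} (hA : A.IsGroupoid) (F : A ⟶ B) :
    RCatOver.Hom (phiGOver A) (phiGOver B) where
  functor :=
    { obj := fun i => (⟨((Phi C).map F).functor.obj i.obj⟩ : PhiGCat B)
      map := fun s => ⟨((Phi C).map F).functor.map s.1, partialBisections_map hA F s.1 s.2⟩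
      map_id := fun i => WideSubcategory.hom_ext _ (((Phi C).map F).functor.map_id i.obj)
      map_comp := fun s t =>
        WideSubcategory.hom_ext _ (((Phi C).map F).functor.map_comp s.1 t.1) }
  map_rest s := WideSubcategory.hom_ext _ (((Phi C).map F).map_rest s.1)
  α :=
    { app := fun i => ((Phi C).map F).α.app i.obj
      naturality := fun _ _ s => ((Phi C).map F).α.naturality s.1 }
  α_total i := ((Phi C).map F).α_total i.obj

variable (C)

/-- The functor taking a partite internal groupoid to its inverse category of partial bisections,
over `C`. -/
noncomputable def PhiG : PartiteGroupoid.{w} C ⥤ ICatOver.{w} C where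
  obj A := ⟨phiGOver A.obj, isInverseCategory_phiG A.property⟩
  map {A B} F := ObjectProperty.homMk
    (show phiGOver A.obj ⟶ phiGOver B.obj from phiGMap A.property F.hom)
  map_id _ := ObjectProperty.hom_ext _ (RCatOver.Hom.ext_of_map (c' := fun _ _ => rfl)
    (fun s => WideSubcategory.hom_ext _ (phiMapHom_idCofunctor s.1)) (fun _ => rfl))
  map_comp F G := ObjectProperty.hom_ext _ (RCatOver.Hom.ext_of_map
    (fun s => WideSubcategory.hom_ext _ (phiMapHom_vcomp F.hom G.hom s.1)) (fun _ => rfl))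

end Groupoids

section Internalisation

open PartiteCategory

variable {C : Type u} [Category.{v} C] [RestrictionCategory C]

theorem IsGlueing.isPartialSection {X A : C} {I : Type w} {φ : I → I → (X ⟶ X)} {p : A ⟶ X}
    {q : I → (A ⟶ X)} {s : I → (X ⟶ A)} (h : IsGlueing φ p q s) (i : I) :
    IsPartialSection p (s i) := by
  have h1 := h.isPartialInverse i
  have h2 : q i = rest (q i) ≫ p := h.isLUB.1 ⟨i, rfl⟩
  have h3 : s i ≫ rest (q i) = s i := by
    rw [← h1.1, ← Category.assoc, h1.2, rest_comp_self]
  change s i ≫ p = rest (s i)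
  rw [← h1.2, h2, ← Category.assoc, h3]

variable (P : RCatOver.{w} C)

/-- The restriction idempotents `P e`, where `e` is a restriction idempotent below the domains of
definition of `f` and `g` on which `f` and `g` agree. -/
def valEqSet {i j : P.cat} (f g : i ⟶ j) : Set (P.P.obj i ⟶ P.P.obj i) :=
  {x | ∃ e : i ⟶ i, rest e = e ∧ e ≤ rest f ≫ rest g ∧ e ≫ f = e ≫ g ∧ P.P.map e = x}

theorem pairwiseCompatible_valEqSet {i j : P.cat} (f g : i ⟶ j) :
    PairwiseCompatible (valEqSet P f g) := by
  rintro _ ⟨e, he, -, -, rfl⟩ _ ⟨d, hd, -, -, rfl⟩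
  have he' : rest (P.P.map e) = P.P.map e := by rw [← P.map_rest, he]
  have hd' : rest (P.P.map d) = P.P.map d := by rw [← P.map_rest, hd]
  change rest (P.P.map d) ≫ P.P.map e = rest (P.P.map e) ≫ P.P.map d
  have := rest_comm (P.P.map d) (P.P.map e)
  rw [he', hd'] at this
  rw [he', hd', this]

variable [JoinRestrictionCategory C]

/-- The equality of `f` and `g`, valued in the restriction idempotents on `P i`. -/
noncomputable def valEq {i j : P.cat} (f g : i ⟶ j) : P.P.obj i ⟶ P.P.obj i :=
  (JoinRestrictionCategory.exists_join _ (pairwiseCompatible_valEqSet P f g)).choose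

theorem isLUB_valEq {i j : P.cat} (f g : i ⟶ j) : IsLUB (valEqSet P f g) (valEq P f g) :=
  (JoinRestrictionCategory.exists_join _ (pairwiseCompatible_valEqSet P f g)).choose_spec

/-- An internalisation of `P`: a partite internal category, with components the objects of the
total category of `P` and objects of objects `P i`, in which the source map `σ i j` is a
glueing of the local atlas formed by the `P`-valued equalities of maps `f : i ⟶ j`, with associated
partial sections `s f`, and whose remaining structure is determined by the stated equations. -/
structure Internalisation where
  str : PartiteStr P.P.obj
  q : ∀ {i j : P.cat}, (i ⟶ j) → (str.graph.arr i j ⟶ P.P.obj i)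
  s : ∀ {i j : P.cat}, (i ⟶ j) → (P.P.obj i ⟶ str.graph.arr i j)
  isGlueing : ∀ i j : P.cat, IsGlueing (fun f g : i ⟶ j => valEq P f g) (str.graph.σ i j)
    (fun f => q f) (fun f => s f)
  s_τ : ∀ {i j : P.cat} (f : i ⟶ j), s f ≫ str.graph.τ i j = P.P.map f
  η_eq : ∀ i : P.cat, str.η i = s (𝟙 i)
  s_μ : ∀ {i j k : P.cat} (f : i ⟶ j) (g : j ⟶ k),
    s f ≫ pullSection (str.graph.σ j k) (str.graph.τ i j) (s g)
      ((isGlueing j k).isPartialSection g) ≫ str.μ i j k = s (f ≫ g)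

namespace Internalisation

variable {P} (J : Internalisation P)

/-- The partite internal category underlying an internalisation. -/
abbrev toPartite : PartiteCategory.{w} C := ⟨P.cat, P.P.obj, J.str⟩

theorem valEq_of_mem {i j : P.cat} (f g : i ⟶ j) (e : i ⟶ i) (he : rest e = e)
    (hle : e = rest f ≫ rest g) (hfg : e ≫ f = e ≫ g) : valEq P f g = P.P.map e := by
  refine (isLUB_valEq P f g).unique (IsGreatest.isLUB ⟨⟨e, he, hle.le, hfg, rfl⟩, ?_⟩)
  rintro _ ⟨d, hd, hdle, -, rfl⟩
  rw [← hle] at hdle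
  have h : d = rest d ≫ e := hdle
  change P.P.map d = rest (P.P.map d) ≫ P.P.map e
  rw [← P.map_rest, ← Functor.map_comp, ← h]

theorem rest_s {i j : P.cat} (f : i ⟶ j) : rest (J.s f) = rest (P.P.map f) := by
  have h := (J.isGlueing i j).isPartialInverse f
  have h' := (J.isGlueing i j).induces f f
  rw [← h.2]
  refine h'.trans ?_
  rw [valEq_of_mem f f (rest f) (rest_rest f) (rest_idem f).symm rfl, P.map_rest]

theorem s_rest {i j : P.cat} (f : i ⟶ j) : J.s (rest f) = rest (J.s f) ≫ J.str.η i := by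
  have e1 : J.s (𝟙 i) ≫ J.q (rest f) = P.P.map (rest f) := by
    refine ((J.isGlueing i i).induces (𝟙 i) (rest f)).trans ?_
    refine valEq_of_mem _ _ _ (rest_rest f) ?_ ?_
    · rw [rest_id, rest_rest, Category.id_comp]
    · rw [Category.comp_id, rest_idem]
  have hq := (J.isGlueing i i).isPartialInverse (rest f)
  have e2 : J.q (rest f) ≫ J.s (rest f) = rest (J.q (rest f)) := hq.1
  have hr : rest (J.s (rest f)) = P.P.map (rest f) := by
    rw [J.rest_s, ← P.map_rest, rest_rest]
  have e3 : rest (J.s f) = P.P.map (rest f) := by rw [J.rest_s, P.map_rest]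
  rw [J.η_eq, e3]
  calc J.s (rest f) = P.P.map (rest f) ≫ J.s (rest f) := by rw [← hr, rest_comp_self]
    _ = J.s (𝟙 i) ≫ rest (J.q (rest f)) := by rw [← e1, Category.assoc, e2]
    _ = P.P.map (rest f) ≫ J.s (𝟙 i) := by
      rw [comp_rest, e1, P.map_rest, rest_rest]

/-- The map of the externalisation given by the partial section `s f`. -/
def sHom {i j : P.cat} (f : i ⟶ j) :
    (⟨i⟩ : PhiCat J.toPartite) ⟶ (⟨j⟩ : PhiCat J.toPartite) :=
  (⟨J.s f, (J.isGlueing i j).isPartialSection f⟩ :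
    PhiHom (⟨i⟩ : PhiCat J.toPartite) (⟨j⟩ : PhiCat J.toPartite))

theorem partialBisections_sHom (hP : IsInverseCategory P.cat) {i j : P.cat} (f : i ⟶ j) :
    partialBisections J.toPartite (J.sHom f) := by
  change IsPartialIso (J.s f ≫ J.str.graph.τ i j)
  rw [J.s_τ]
  exact isPartialIso_proj P (isPartialIso_of_isInverseCategory hP f)

/-- The unit map at an inverse category `P` over `C`, for an internalisation which is a groupoid:
it is the identity on objects, it sends a map `f` to the partial section `s f`, and its triangle
commutes strictly. -/
noncomputable def unit {P : ICatOver.{w} C} (J : Internalisation P.obj)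
    (hJ : J.toPartite.IsGroupoid) : P ⟶ (PhiG C).obj ⟨J.toPartite, hJ⟩ :=
  ObjectProperty.homMk (show P.obj ⟶ phiGOver J.toPartite from
    { functor :=
        { obj := fun i => (⟨⟨i⟩⟩ : PhiGCat J.toPartite)
          map := fun f => ⟨J.sHom f, J.partialBisections_sHom P.property f⟩
          map_id := fun i => WideSubcategory.hom_ext _ (Subtype.ext (J.η_eq i).symm)
          map_comp := fun f g => WideSubcategory.hom_ext _ (Subtype.ext (J.s_μ f g).symm) }
      map_rest := fun f => WideSubcategory.hom_ext _ (Subtype.ext (J.s_rest f))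
      α :=
        { app := fun i => 𝟙 (P.obj.P.obj i)
          naturality := fun _ _ f =>
            (Category.comp_id _).trans ((J.s_τ f).trans (Category.id_comp _).symm) }
      α_total := fun _ => isTotal_id })

end Internalisation

end Internalisation

end RestrictionTheory

open RestrictionTheory

/-! A glueing `p` behaves like an étale space over its base. On the domain of `x ≫ q i`, a
generalised element `x` is the value of the section `s i` at the point `x ≫ p`, and these domains
cover that of `x`. So equations between maps can be checked chart by chart. Maps can be built as
joins of local values, once these agree on overlaps. The tools are `IsGlueing.rest_comp_eq`,
`IsGlueing.ext_elem` and `IsGlueing.exists_desc`. They rest on `isLUB_iff`, which reduces joins of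
maps to joins of their domains.

For `P` over `C`, the target, multiplication and inversion of the internalisation are prescribed on
sections by `P f`, `f ≫ g` and the partial inverse of `f`. These prescriptions respect the equality
loci `valEq P f g`: equality is transitive, is preserved by composition, and passes to partial
inverses. Local glueings also supply the pullbacks that are needed, since a pullback of a glueing is
a glueing of the pulled-back atlas.

The adjunction and the behaviour of the counit come from one principle about a `SectionCover`, that
is, enough partial sections closed under composition. A cofunctor is determined by its values on the
cover, and every functorial assignment of values that agree where the sections agree extends to a
cofunctor. Covering an internalisation by the sections `s f` gives the universal property of the
unit. Covering an étale groupoid by all its partial bisections shows that `PhiG` is full and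
faithful on maps out of it. A preimage of the unit at its image then inverts the counit. Conversely,
internalisations are étale, and étaleness is invariant under isomorphism.

Categories of partial bisections always have joins and are hyperconnected over `C`, because joins of
bicompatible bisections can be formed in `C`; this is necessary for an invertible unit. It is also
sufficient. A bisection of the internalisation is the join of its restrictions to the loci where it
coincides with some `s f`. Hyperconnectedness lifts these restrictions to `P`, and their join is
taken there. -/

namespace RestrictionTheory

open RestrictionCategory

/-! ### The restriction order and partial inverses. -/

section Order

variable {C : Type u} [Category.{v} C] [RestrictionCategory C] {X Y Z W : C}

theorem rest_comp_le (f : X ⟶ Y) (g : X ⟶ Z) : rest f ≫ g ≤ g := by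
  rw [le_def, rest_rest_comp, Category.assoc, rest_comp_self]

theorem precomp_le (h : X ⟶ Y) {f g : Y ⟶ Z} (hfg : f ≤ g) : h ≫ f ≤ h ≫ g := by
  rw [le_def] at *
  calc h ≫ f = (h ≫ rest f) ≫ g := by rw [Category.assoc, ← hfg]
    _ = rest (h ≫ f) ≫ h ≫ g := by rw [comp_rest, Category.assoc]

theorem postcomp_le {f g : X ⟶ Y} (hfg : f ≤ g) (h : Y ⟶ Z) : f ≫ h ≤ g ≫ h := by
  rw [le_def] at hfg
  have e : f ≫ h = rest f ≫ g ≫ h := by rw [← Category.assoc, ← hfg]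
  rw [e]
  exact rest_comp_le _ _

theorem rest_le_rest {f g : X ⟶ Y} (hfg : f ≤ g) : rest f ≤ rest g := by
  rw [le_def] at *
  rw [rest_rest, ← rest_rest_comp, ← hfg]

theorem rest_eq_of_le_rest {e : X ⟶ X} {f : X ⟶ Y} (h : e ≤ rest f) : rest e = e := by
  rw [le_def] at h
  rw [h, rest_rest_comp, rest_rest]

theorem rest_le_id (f : X ⟶ Y) : rest f ≤ 𝟙 X := by
  rw [le_def, rest_rest, Category.comp_id]

theorem rest_comp_eq_of_le {f g : X ⟶ Y} (hfg : f ≤ g) : rest f ≫ g = f := hfg.symm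

theorem rest_le_iff {f : X ⟶ Y} {g : X ⟶ Z} : rest f ≤ rest g ↔ rest f ≫ rest g = rest f := by
  rw [le_def, rest_rest, eq_comm]

theorem rest_comp_of_rest_le {f : X ⟶ Y} {g : X ⟶ Z} (h : rest f ≤ rest g) :
    rest g ≫ f = f := by
  rw [rest_le_iff] at h
  rw [← rest_comp_self f, ← Category.assoc, rest_comm, h]

theorem rest_comp_le_rest (f : X ⟶ Y) (g : Y ⟶ Z) : rest (f ≫ g) ≤ rest f :=
  rest_le_iff.2 (rest_comp_comp f g)

theorem compatible_of_le {f g h : X ⟶ Y} (hf : f ≤ h) (hg : g ≤ h) : Compatible f g := by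
  rw [le_def] at hf hg
  have e1 : rest g ≫ f = rest g ≫ rest f ≫ h := by rw [← hf]
  have e2 : rest f ≫ g = rest f ≫ rest g ≫ h := by rw [← hg]
  rw [Compatible, e1, e2, ← Category.assoc, rest_comm, Category.assoc]

theorem pairwiseCompatible_of_le {S : Set (X ⟶ Y)} {h : X ⟶ Y} (H : ∀ s ∈ S, s ≤ h) :
    PairwiseCompatible S := fun s hs t ht => compatible_of_le (H s hs) (H t ht)

theorem eq_of_le_of_rest_le {f g : X ⟶ Y} (h : f ≤ g) (hr : rest g ≤ rest f) : f = g := by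
  rw [← rest_comp_of_rest_le hr]
  exact h

/-- The map `t ≫ s ≫ t'` is `t` when the idempotent `s ≫ t'` is absorbed, and a restriction of `t'`
when `t ≫ s` is contracted. Hence `t ≤ t'`, and the situation is symmetric. -/
theorem IsPartialInverse.unique {s : X ⟶ Y} {t t' : Y ⟶ X} (h : IsPartialInverse s t)
    (h' : IsPartialInverse s t') : t = t' := by
  have a : t ≫ s ≫ t' = t := by rw [h'.1, ← h.1, ← Category.assoc, h.2, rest_comp_self]
  have b : t ≫ s ≫ t' = rest t ≫ t' := by rw [← Category.assoc, h.2]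
  have a' : t' ≫ s ≫ t = t' := by rw [h.1, ← h'.1, ← Category.assoc, h'.2, rest_comp_self]
  have b' : t' ≫ s ≫ t = rest t' ≫ t := by rw [← Category.assoc, h'.2]
  have l1 : t ≤ t' := by rw [le_def, ← b, a]
  have l2 : t' ≤ t := by rw [le_def, ← b', a']
  exact le_antisymm l1 l2

theorem IsPartialInverse.comp_rest {s : X ⟶ Y} {t : Y ⟶ X} (h : IsPartialInverse s t) :
    s ≫ RestrictionCategory.rest t = s := by
  rw [← h.2, ← Category.assoc, h.1, rest_comp_self]

/-- Partial inversion is monotone. -/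
theorem IsPartialInverse.mono {s s' : X ⟶ Y} {t t' : Y ⟶ X} (h : IsPartialInverse s t)
    (h' : IsPartialInverse s' t') (hs : s ≤ s') : t ≤ t' := by
  rw [le_def]
  -- The values of `t` lie in the domain of `s`, where `s'` coincides with `s`.
  have e : t ≫ s' = RestrictionCategory.rest t := by
    calc t ≫ s' = (t ≫ RestrictionCategory.rest s) ≫ s' := by
          rw [(isPartialInverse_symm h).comp_rest]
      _ = RestrictionCategory.rest t := by
          rw [Category.assoc, ← (le_def _ _).1 hs, h.2]
  calc t = t ≫ RestrictionCategory.rest s' := by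
        have := rest_le_iff.1 (rest_le_rest hs)
        rw [← (isPartialInverse_symm h).comp_rest, Category.assoc, this]
    _ = RestrictionCategory.rest t ≫ t' := by rw [← h'.1, ← Category.assoc, e]

end Order

/-! ### Joins of maps and joins of their domains. -/

section Joins

variable {C : Type u} [Category.{v} C] [RestrictionCategory C] [JoinRestrictionCategory C]
  {X Y Z T : C}

/-- An upper bound is determined by its domain, so only domains can distinguish the join from a
larger bound. This turns most verifications about joins into statements on restriction idempotents.
-/
theorem isLUB_iff {S : Set (X ⟶ Y)} {f : X ⟶ Y} :
    IsLUB S f ↔ (∀ s ∈ S, s ≤ f) ∧ IsLUB (rest '' S) (rest f) := by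
  have key : ∀ k : X ⟶ Y, IsLUB S k → IsLUB (rest '' S) (rest k) := by
    intro k hk
    have hub : ∀ r ∈ (rest '' S : Set (X ⟶ X)), r ≤ rest k := by
      rintro _ ⟨s, hs, rfl⟩
      exact rest_le_rest (hk.1 hs)
    obtain ⟨e, he⟩ := JoinRestrictionCategory.exists_join _ (pairwiseCompatible_of_le hub)
    have hek : e ≤ rest k := he.2 hub
    have hre := rest_eq_of_le_rest hek
    -- Cutting `k` down to the join `e` of the domains leaves an upper bound, so `k` was already
    -- supported on `e`.
    have hb : k ≤ e ≫ k := hk.2 (fun s hs => by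
      have h1 : rest s ≤ e := he.1 ⟨s, hs, rfl⟩
      have h2 : rest s ≫ e = rest s := by
        have := (le_def _ _).1 h1; rw [rest_rest] at this; exact this.symm
      rw [le_def, ← Category.assoc, h2]
      exact hk.1 hs)
    have : rest k ≤ e := by
      rw [← hre]
      exact (rest_le_rest hb).trans (rest_comp_le_rest _ _)
    rwa [le_antisymm this hek]
  refine ⟨fun h => ⟨fun s hs => h.1 hs, key f h⟩, fun ⟨h1, h2⟩ => ?_⟩
  obtain ⟨k, hk⟩ := JoinRestrictionCategory.exists_join _ (pairwiseCompatible_of_le h1)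
  have hkf : k ≤ f := hk.2 h1
  have e : rest k = rest f := (key k hk).unique h2
  rwa [← eq_of_le_of_rest_le hkf e.ge]

theorem isLUB_range_iff {ι : Type*} {s : ι → (X ⟶ Y)} {f : X ⟶ Y} :
    IsLUB (Set.range s) f ↔
      (∀ k, s k ≤ f) ∧ IsLUB (Set.range fun k => rest (s k)) (rest f) := by
  rw [isLUB_iff, Set.forall_mem_range, ← Set.range_comp]
  rfl

theorem isLUB_precomp (g : T ⟶ X) {S : Set (X ⟶ Y)} {f : X ⟶ Y} (h : IsLUB S f) :
    IsLUB ((fun s => g ≫ s) '' S) (g ≫ f) :=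
  JoinRestrictionCategory.precomp_join g S (pairwiseCompatible_of_le fun _ hs => h.1 hs) f h

theorem isLUB_precomp_range {ι : Type*} (g : T ⟶ X) {s : ι → (X ⟶ Y)} {f : X ⟶ Y}
    (h : IsLUB (Set.range s) f) : IsLUB (Set.range fun k => g ≫ s k) (g ≫ f) := by
  have := isLUB_precomp g h
  rwa [← Set.range_comp] at this

/-- The axiom covers precomposition only. The domain of `s ≫ g` is that of `s` cut down by `rest (f
≫ g)`, so on domains postcomposition by `g` becomes precomposition by an idempotent, and `isLUB_iff`
applies. -/
theorem isLUB_postcomp {S : Set (X ⟶ Y)} {f : X ⟶ Y} (h : IsLUB S f) (g : Y ⟶ Z) :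
    IsLUB ((fun s => s ≫ g) '' S) (f ≫ g) := by
  rw [isLUB_iff]
  constructor
  · rintro _ ⟨s, hs, rfl⟩
    exact postcomp_le (h.1 hs) g
  · have h1 := isLUB_precomp (rest (f ≫ g)) (isLUB_iff.1 h).2
    rw [rest_comp_comp] at h1
    convert h1 using 1
    rw [Set.image_image, Set.image_image]
    refine Set.image_congr fun s hs => ?_
    have e : s ≫ g = rest s ≫ f ≫ g := by
      rw [← Category.assoc, ← (le_def _ _).1 (h.1 hs)]
    rw [e, rest_rest_comp, rest_comm]

theorem isLUB_postcomp_range {ι : Type*} {s : ι → (X ⟶ Y)} {f : X ⟶ Y}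
    (h : IsLUB (Set.range s) f) (g : Y ⟶ Z) : IsLUB (Set.range fun k => s k ≫ g) (f ≫ g) := by
  have := isLUB_postcomp h g
  rwa [← Set.range_comp] at this

/-- Maps which agree on the domains of a family whose join is defined wherever they are,
are equal. -/
theorem ext_of_isLUB {ι : Type*} {s : ι → (X ⟶ Y)} {f : X ⟶ Y} (hs : IsLUB (Set.range s) f)
    {h h' : X ⟶ Z} (hh : rest h ≤ rest f) (hh' : rest h' ≤ rest f)
    (H : ∀ k, rest (s k) ≫ h = rest (s k) ≫ h') : h = h' := by
  -- Both `h` and `h'` are joins of their restrictions to the domains of the family.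
  have a := isLUB_postcomp_range (isLUB_range_iff.1 hs).2 h
  have a' := isLUB_postcomp_range (isLUB_range_iff.1 hs).2 h'
  rw [rest_comp_of_rest_le hh] at a
  rw [rest_comp_of_rest_le hh'] at a'
  simp only [H] at a
  exact a.unique a'

theorem exists_isLUB_range {ι : Type*} (m : ι → (X ⟶ Y)) (H : ∀ k l, Compatible (m k) (m l)) :
    ∃ f, IsLUB (Set.range m) f :=
  JoinRestrictionCategory.exists_join _ (by rintro _ ⟨k, rfl⟩ _ ⟨l, rfl⟩; exact H k l)

/-- The join of a family of partial isomorphisms whose partial inverses are also compatible is a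
partial isomorphism. -/
theorem isPartialInverse_of_isLUB {S : Set (X ⟶ Y)} {f : X ⟶ Y} (hf : IsLUB S f)
    {S' : Set (Y ⟶ X)} {g : Y ⟶ X} (hg : IsLUB S' g)
    (h : ∀ s ∈ S, ∃ t ∈ S', IsPartialInverse s t)
    (h' : ∀ t ∈ S', ∃ s ∈ S, IsPartialInverse s t) : IsPartialInverse f g := by
  have key : ∀ {X Y : C} {S : Set (X ⟶ Y)} {f : X ⟶ Y}, IsLUB S f →
      ∀ {S' : Set (Y ⟶ X)} {g : Y ⟶ X}, IsLUB S' g →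
      (∀ s ∈ S, ∃ t ∈ S', IsPartialInverse s t) → f ≫ g = rest f := by
    intro X Y S f hf S' g hg h
    have hf' : IsLUB (Set.range (Subtype.val : S → (X ⟶ Y))) f := by
      rwa [Subtype.range_coe_subtype]
    refine ext_of_isLUB hf' (rest_comp_le_rest _ _) (by rw [rest_rest]) ?_
    rintro ⟨s, hs⟩
    obtain ⟨t, ht, hst⟩ := h s hs
    have e1 := rest_comp_eq_of_le (hf.1 hs)
    have e2 := rest_comp_eq_of_le (hg.1 ht)
    have e3 := rest_le_iff.1 (rest_le_rest (hf.1 hs))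
    -- On the domain of `s`, the map `f` is `s`, whose values lie in the domain of `t`, where `g` is
    -- `t`.
    calc rest s ≫ f ≫ g = (s ≫ rest t) ≫ g := by rw [← Category.assoc, e1, hst.comp_rest]
      _ = rest s ≫ rest f := by rw [Category.assoc, e2, hst.1, e3]
  refine ⟨key hf hg h, key hg hf fun t ht => ?_⟩
  obtain ⟨s, hs, hst⟩ := h' t ht
  exact ⟨s, hs, isPartialInverse_symm hst⟩

end Joins

end RestrictionTheory

/-! ### Local calculus of glueings, and their pullbacks along total maps. -/

namespace RestrictionTheory

open RestrictionCategory

namespace IsGlueing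

variable {C : Type u} [Category.{v} C] [RestrictionCategory C]
  {X A Y Z T : C} {I : Type w} {φ : I → I → (X ⟶ X)} {p : A ⟶ X} {q : I → (A ⟶ X)}
  {s : I → (X ⟶ A)} (h : IsGlueing φ p q s)

include h

theorem q_le (i : I) : q i ≤ p := h.isLUB.1 ⟨i, rfl⟩

theorem s_comp_p (i : I) : s i ≫ p = rest (s i) := h.isPartialSection i

theorem rest_s (i : I) : rest (s i) = φ i i := by
  rw [← (h.isPartialInverse i).2, h.induces]

theorem rest_φ (i j : I) : rest (φ i j) = φ i j := by
  have := precomp_le (s i) (h.q_le j)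
  rw [h.s_comp_p, h.induces] at this
  exact rest_eq_of_le_rest this

/-- The locus `φ i j` is where `s i` takes values in the domain of `q j`. There `q j ≫ s j` acts as
the identity, so `s i` is `s j` evaluated at `φ i j`. -/
theorem φ_comp_s (i j : I) : φ i j ≫ s i = φ i j ≫ s j := by
  calc φ i j ≫ s i = rest (s i ≫ q j) ≫ s i := by rw [h.induces, h.rest_φ]
    _ = s i ≫ rest (q j) := by rw [comp_rest]
    _ = φ i j ≫ s j := by rw [← (h.isPartialInverse j).1, ← Category.assoc, h.induces]

/-- On the domain of `q i` the map `p` is `q i`, and `q i ≫ s i` is the identity. This local normal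
form of a generalised element drives every chartwise computation below. -/
theorem rest_comp_eq (x : T ⟶ A) (i : I) :
    rest (x ≫ q i) ≫ x = (rest (x ≫ q i) ≫ x ≫ p) ≫ s i := by
  have e : rest (q i) ≫ p = q i := rest_comp_eq_of_le (h.q_le i)
  rw [← Category.assoc (rest _) x p, ← comp_rest, Category.assoc x, e, Category.assoc,
    (h.isPartialInverse i).1]

theorem comp_q_eq (x : T ⟶ A) (i : I) : x ≫ q i = rest (x ≫ q i) ≫ x ≫ p := by
  have e : rest (q i) ≫ p = q i := rest_comp_eq_of_le (h.q_le i)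
  rw [← Category.assoc (rest _) x p, ← comp_rest, Category.assoc x, e]

variable [JoinRestrictionCategory C]

theorem isLUB_comp (x : T ⟶ A) : IsLUB (Set.range fun i => x ≫ q i) (x ≫ p) :=
  isLUB_precomp_range x h.isLUB

/-- The maps `q i` join to the total map `p`, so the domains of the `x ≫ q i` cover the domain of
`x`. -/
theorem ext_elem (x : T ⟶ A) {m m' : T ⟶ Z} (hm : rest m ≤ rest x) (hm' : rest m' ≤ rest x)
    (H : ∀ i, rest (x ≫ q i) ≫ m = rest (x ≫ q i) ≫ m') : m = m' := by
  have := h.total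
  rw [← rest_comp_total x p] at hm hm'
  exact ext_of_isLUB (h.isLUB_comp x) hm hm' H

theorem ext_elem_total (x : T ⟶ A) [hx : IsTotal x] {m m' : T ⟶ Z}
    (H : ∀ i, rest (x ≫ q i) ≫ m = rest (x ≫ q i) ≫ m') : m = m' :=
  h.ext_elem x (by rw [hx.rest_eq]; exact rest_le_id _) (by rw [hx.rest_eq]; exact rest_le_id _) H

theorem hom_ext {m m' : A ⟶ Z} (H : ∀ i, s i ≫ m = s i ≫ m') : m = m' := by
  refine h.ext_elem_total (𝟙 A) fun i => ?_
  rw [Category.id_comp, ← (h.isPartialInverse i).1, Category.assoc, H, Category.assoc]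

/-- Maps out of a glueing are determined by compatible families of maps. -/
theorem exists_desc (m : I → (X ⟶ Z)) (hr : ∀ i, rest (m i) = rest (s i))
    (hm : ∀ i j, φ i j ≫ m i = φ i j ≫ m j) :
    ∃ d : A ⟶ Z, IsTotal d ∧ ∀ i, s i ≫ d = m i := by
  have hqr : ∀ i, rest (q i ≫ m i) = rest (q i) := fun i => by
    rw [← rest_comp_rest, hr, (h.isPartialInverse i).comp_rest]
  have aux : ∀ i j, rest (q j) ≫ q i = rest (q i) ≫ q j := fun i j =>
    compatible_of_le (h.q_le i) (h.q_le j)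
  obtain ⟨d, hd⟩ := exists_isLUB_range (fun i => q i ≫ m i) (fun i j => by
    -- Where `q i` and `q j` are both defined they agree, being below `p`, and their common value
    -- lies in `φ i j`. There `hm` applies.
    have e1 : (rest (q j) ≫ q i) ≫ φ i j = rest (q j) ≫ q i := by
      rw [← h.induces, Category.assoc, ← Category.assoc (q i), (h.isPartialInverse i).1, aux i j,
        ← Category.assoc, rest_comm, Category.assoc, rest_comp_self]
    rw [Compatible, hqr, hqr]
    calc rest (q j) ≫ q i ≫ m i = ((rest (q j) ≫ q i) ≫ φ i j) ≫ m i := by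
          rw [e1, Category.assoc]
      _ = ((rest (q j) ≫ q i) ≫ φ i j) ≫ m j := by
          rw [Category.assoc, hm, Category.assoc _ _ (m j)]
      _ = rest (q i) ≫ q j ≫ m j := by rw [e1, aux, Category.assoc])
  refine ⟨d, ⟨?_⟩, fun i => ?_⟩
  -- The local values have the same domains as the `q i`, so they cover all of `A`.
  · have h1 := (isLUB_range_iff.1 hd).2
    simp only [hqr] at h1
    have h2 := (isLUB_range_iff.1 h.isLUB).2
    rw [h.total.rest_eq] at h2
    exact h1.unique h2
  · have e : rest (q i ≫ m i) ≫ d = q i ≫ m i := rest_comp_eq_of_le (hd.1 ⟨i, rfl⟩)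
    rw [hqr] at e
    calc s i ≫ d = s i ≫ rest (q i) ≫ d := by
          rw [← Category.assoc, (isPartialInverse_symm (h.isPartialInverse i)).comp_rest]
      _ = rest (s i) ≫ m i := by rw [e, ← Category.assoc, (h.isPartialInverse i).2]
      _ = m i := by rw [← hr, rest_comp_self]

end IsGlueing

/-- The pullback is a glueing of the atlas pulled back along `f`. Its projection to `A` is the map
descended from the family `f ≫ s i`. -/
theorem HasLocalGlueings.hasPullback {C : Type u} [Category.{v} C] [RestrictionCategory C]
    [JoinRestrictionCategory C] (hC : HasLocalGlueings C) {X A Y : C} {I : Type v}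
    (φ : LocalAtlas X I) {p : A ⟶ X} {q : I → (A ⟶ X)} {s : I → (X ⟶ A)}
    (h : IsGlueing φ.φ p q s) (f : Y ⟶ X) [IsTotal f] : HasPullback p f := by
  have hp := h.total
  have hf : ∀ i j, rest (f ≫ φ.φ i j) ≫ f = f ≫ φ.φ i j := fun i j => by
    rw [← comp_rest, φ.rest_φ]
  let ψ : LocalAtlas Y I :=
    { φ := fun i j => rest (f ≫ φ.φ i j)
      rest_φ := fun i j => rest_rest _
      symm := fun i j => by rw [φ.symm]
      trans := fun i j k => by
        rw [← rest_rest_comp, ← Category.assoc, hf, Category.assoc]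
        exact rest_le_rest (precomp_le f (φ.trans i j k)) }
  obtain ⟨B, p', q', s', h'⟩ := hC Y I ψ
  have hψ : ∀ i j, ψ.φ i j = rest (f ≫ φ.φ i j) := fun _ _ => rfl
  have hp' := h'.total
  obtain ⟨f', hf't, hf'⟩ := h'.exists_desc (fun i => f ≫ s i)
    (fun i => by rw [← rest_comp_rest, h.rest_s, h'.rest_s])
    (fun i j => by
      simp only [hψ]
      simp only [← Category.assoc, hf]
      simp only [Category.assoc, h.φ_comp_s i j])
  have comm : f' ≫ p = p' ≫ f := h'.hom_ext fun i => by
    rw [← Category.assoc, hf', Category.assoc, h.s_comp_p, h.rest_s, ← Category.assoc,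
      h'.s_comp_p, h'.rest_s, hψ, hf]
  -- The charts of `B` are the pullbacks of those of `A`.
  have hq : ∀ i, f' ≫ q i = q' i ≫ f := fun i => h'.hom_ext fun j => by
    rw [← Category.assoc, hf', Category.assoc, h.induces, ← Category.assoc, h'.induces, hψ, hf]
  have hψs : ∀ i j, rest (f ≫ φ.φ i j) ≫ s' i = rest (f ≫ φ.φ i j) ≫ s' j :=
    fun i j => h'.φ_comp_s i j
  -- By `hq`, the domain of `n ≫ q' k` depends only on `n ≫ f'`. On this domain `n` is recovered
  -- from `n ≫ p'` through `s' k`.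
  have uniq : ∀ {T : C} (n n' : T ⟶ B), n ≫ f' = n' ≫ f' → n ≫ p' = n' ≫ p' → n = n' := by
    intro T n n' e1 e2
    have e3 : ∀ k, rest (n ≫ q' k) = rest (n' ≫ q' k) := fun k => by
      rw [← rest_comp_total (n ≫ q' k) f, Category.assoc, ← hq, ← Category.assoc, e1,
        Category.assoc, hq, ← Category.assoc, rest_comp_total]
    refine h'.ext_elem n le_rfl ?_ fun k => ?_
    · rw [← rest_comp_total n f', e1, rest_comp_total]
    · rw [h'.rest_comp_eq, e2, e3, ← h'.rest_comp_eq]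
  have lift : ∀ {T : C} (a : T ⟶ A) (y : T ⟶ Y), a ≫ p = y ≫ f →
      ∃ m : T ⟶ B, m ≫ f' = a ∧ m ≫ p' = y := by
    intro T a y hay
    have hra : rest a = rest y := by
      rw [← rest_comp_total a p, hay, rest_comp_total]
    have ha : ∀ k, rest (a ≫ q k) ≫ a = rest (a ≫ q k) ≫ y ≫ f ≫ s k := fun k => by
      rw [h.rest_comp_eq, hay]; simp only [Category.assoc]
    -- Where `a` lies in the charts `k` and `l`, the point `y` lies in the overlap of the
    -- pulled-back atlas. The case `k = l` gives the domains of the local lifts, and the general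
    -- case gives their compatibility.
    have key : ∀ k l, (rest (a ≫ q l) ≫ rest (a ≫ q k)) ≫ y ≫ rest (f ≫ φ.φ k l) =
        (rest (a ≫ q l) ≫ rest (a ≫ q k)) ≫ y := fun k l => by
      have e : (rest (a ≫ q l) ≫ rest (a ≫ q k)) ≫ y ≫ f ≫ φ.φ k l =
          rest (a ≫ q k) ≫ a ≫ q l := by
        have h2 := congrArg (fun t => t ≫ q l) (ha k)
        simp only [Category.assoc, h.induces] at h2
        rw [Category.assoc, ← h2, ← Category.assoc, rest_comm, Category.assoc, rest_comp_self]
      have e' : rest ((rest (a ≫ q l) ≫ rest (a ≫ q k)) ≫ y ≫ f ≫ φ.φ k l) =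
          rest (a ≫ q l) ≫ rest (a ≫ q k) := by
        rw [e, rest_rest_comp, rest_comm]
      rw [← Category.assoc _ y, comp_rest, Category.assoc _ y, e', ← Category.assoc,
        ← rest_rest_comp, rest_idem]
    have hr : ∀ k, rest (rest (a ≫ q k) ≫ y ≫ s' k) = rest (a ≫ q k) := fun k => by
      have := key k k
      rw [rest_idem] at this
      rw [← Category.assoc, ← rest_comp_rest (_ ≫ y), h'.rest_s, hψ, Category.assoc, this,
        rest_rest_comp, ← hra, rest_comp_comp]
    -- Where `a` lies in chart `k`, the lift has to be the value of `s' k` at `y`.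
    obtain ⟨m, hm⟩ := exists_isLUB_range (fun k => rest (a ≫ q k) ≫ y ≫ s' k) (fun k l => by
      have e := congrArg (fun t => t ≫ s' k) (key k l)
      have e' := congrArg (fun t => t ≫ s' l) (key k l)
      simp only [Category.assoc, hψs k l] at e e'
      rw [Compatible, hr, hr, ← e, e', ← Category.assoc, rest_comm, Category.assoc])
    have hmk : ∀ k, rest (a ≫ q k) ≫ m = rest (a ≫ q k) ≫ y ≫ s' k := fun k => by
      have : _ ≫ m = _ := rest_comp_eq_of_le (hm.1 ⟨k, rfl⟩)
      rwa [hr] at this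
    have hrm : rest m = rest a := by
      have h1 := (isLUB_range_iff.1 hm).2
      simp only [hr] at h1
      have h2 := (isLUB_range_iff.1 (h.isLUB_comp a)).2
      rw [rest_comp_total] at h2
      exact h1.unique h2
    refine ⟨m, h.ext_elem a ?_ le_rfl fun k => ?_, h.ext_elem a ?_ hra.ge fun k => ?_⟩
    · rw [rest_comp_total, hrm]
    · rw [← Category.assoc, hmk, ha, Category.assoc, Category.assoc, hf']
    · rw [rest_comp_total, hrm]
    · have := key k k
      rw [rest_idem] at this
      rw [← Category.assoc, hmk, Category.assoc, Category.assoc, h'.s_comp_p, h'.rest_s, hψ, this]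
  have H : IsPullback f' p' p f :=
    IsPullback.of_isLimit' ⟨comm⟩ (PullbackCone.IsLimit.mk comm
      (fun c => (lift c.fst c.snd c.condition).choose)
      (fun c => (lift c.fst c.snd c.condition).choose_spec.1)
      (fun c => (lift c.fst c.snd c.condition).choose_spec.2)
      (fun c m h1 h2 => uniq _ _
        (h1.trans (lift c.fst c.snd c.condition).choose_spec.1.symm)
        (h2.trans (lift c.fst c.snd c.condition).choose_spec.2.symm)))
  exact H.hasPullback

end RestrictionTheory

/-! ### Section covers, and the construction of cofunctors from their values on a cover. -/

namespace RestrictionTheory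

open RestrictionCategory PartiteCategory

section Sections

variable {C : Type u} [Category.{v} C] [RestrictionCategory C] {A B : PartiteCategory.{w} C}
  {T : C}

/-- Multiplying elements that lie on sections amounts to composing the sections. The restriction
built into `PhiHom.comp` is absorbed, because composability forces `x` and `y` to have the same
domain. -/
theorem mul_section {i j k : PhiCat A} (s : PhiHom i j) (t : PhiHom j k)
    (u : T ⟶ A.obj i.idx) {x : T ⟶ A.arr i.idx j.idx} {y : T ⟶ A.arr j.idx k.idx}
    (h : y ≫ A.σ j.idx k.idx = x ≫ A.τ i.idx j.idx) (hx : x = u ≫ s.1)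
    (hy : y = (x ≫ A.τ i.idx j.idx) ≫ t.1) : mul y x h = u ≫ (PhiHom.comp s t).1 := by
  have hyu : y = u ≫ (s.1 ≫ A.τ i.idx j.idx) ≫ t.1 := by
    rw [hy, hx]; simp only [Category.assoc]
  have hr : rest y = rest x := by
    rw [← rest_comp_total y (A.σ j.idx k.idx), h, rest_comp_total]
  rw [PhiHom.comp_val, comp_mul]
  refine mul_congr _ hyu ?_
  rw [← Category.assoc, comp_rest, ← hyu, Category.assoc, ← hx, hr, rest_comp_self]

/-- A cofunctor acts on an element of a section through its value on that section. This is the link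
between generalised elements and the functor induced on sections. -/
theorem act_section (F : Cofunctor A B) {i j : PhiCat A} (s : PhiHom i j)
    (b : T ⟶ B.obj (F.idx i.idx)) {x : T ⟶ A.arr i.idx j.idx}
    (h : x ≫ A.σ i.idx j.idx = b ≫ F.obj i.idx) (hx : x = (b ≫ F.obj i.idx) ≫ s.1) :
    F.act x b h = b ≫ (phiMapHom F s).1 := by
  have hr : rest x = rest b := by
    rw [← rest_comp_total x (A.σ i.idx j.idx), h, rest_comp_total]
  rw [phiMapHom_val, Cofunctor.comp_act]
  refine F.act_congr _ (by rw [hx, Category.assoc]) ?_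
  rw [comp_rest, ← Category.assoc, ← hx, hr, rest_comp_self]

theorem Cofunctor.rest_act (F : Cofunctor A B) {i j : A.I} (x : T ⟶ A.arr i j)
    (b : T ⟶ B.obj (F.idx i)) (h : x ≫ A.σ i j = b ≫ F.obj i) : rest (F.act x b h) = rest x := by
  rw [← rest_comp_total (F.act x b h) (B.σ _ _), F.act_σ, ← rest_comp_total b (F.obj i), ← h,
    rest_comp_total]

end Sections

/-- A family of partial sections of the source maps of a partite internal category, closed under
identities and composition, which exhibits these source maps as local homeomorphisms. -/
structure SectionCover {C : Type u} [Category.{v} C] [RestrictionCategory C]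
    (A : PartiteCategory.{w} C) where
  H : A.I → A.I → Type v
  q : ∀ {i j}, H i j → (A.arr i j ⟶ A.obj i)
  s : ∀ {i j}, H i j → (A.obj i ⟶ A.arr i j)
  isGlueing : ∀ i j, IsGlueing (fun f g : H i j => s f ≫ q g) (A.σ i j)
    (fun f => q f) (fun f => s f)
  one : ∀ i, H i i
  s_one : ∀ i, s (one i) = A.η i
  comp : ∀ {i j k}, H i j → H j k → H i k
  s_comp : ∀ {i j k} (f : H i j) (g : H j k),
    s f ≫ pullSection (A.σ j k) (A.τ i j) (s g) ((isGlueing j k).isPartialSection g) ≫ A.μ i j k =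
      s (comp f g)

namespace SectionCover

variable {C : Type u} [Category.{v} C] [RestrictionCategory C] {A B : PartiteCategory.{w} C}
  (S : SectionCover A) {T : C}

/-- The map of the externalisation given by a member of the cover. -/
def hom {i j : A.I} (f : S.H i j) : PhiHom (⟨i⟩ : PhiCat A) ⟨j⟩ :=
  ⟨S.s f, (S.isGlueing i j).isPartialSection f⟩

theorem hom_comp {i j k : A.I} (f : S.H i j) (g : S.H j k) :
    S.hom (S.comp f g) = PhiHom.comp (S.hom f) (S.hom g) :=
  Subtype.ext (S.s_comp f g).symm

/-- The data from which a cofunctor out of a partite internal category with a section cover can be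
built. -/
structure CofunctorData (B : PartiteCategory.{w} C) where
  idx : A.I → B.I
  obj : ∀ i, B.obj (idx i) ⟶ A.obj i
  obj_total : ∀ i, IsTotal (obj i)
  t : ∀ {i j}, S.H i j → PhiHom (⟨idx i⟩ : PhiCat B) ⟨idx j⟩
  nat : ∀ {i j} (f : S.H i j),
    ((t f).1 ≫ B.τ (idx i) (idx j)) ≫ obj j = obj i ≫ S.s f ≫ A.τ i j
  t_one : ∀ i, (t (S.one i)).1 = B.η (idx i)
  t_comp : ∀ {i j k} (f : S.H i j) (g : S.H j k), t (S.comp f g) = PhiHom.comp (t f) (t g)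
  -- The idempotent `S.s f ≫ S.q g` is the locus where the two sections coincide; their images must
  -- coincide over it.
  agree : ∀ {i j} (f g : S.H i j),
    rest (obj i ≫ S.s f ≫ S.q g) ≫ (t f).1 = rest (obj i ≫ S.s f ≫ S.q g) ≫ (t g).1

attribute [instance] CofunctorData.obj_total

namespace CofunctorData

variable {S} (D : S.CofunctorData B)

/-- By `nat` and totality, the domain of `t f` is the pullback of the domain of `s f`. Where `x`
lies in the chart of `f` it factors through `s f`, so the local value `b ≫ t f` is defined on that
whole region. -/
theorem rest_q_comp {i j : A.I} (f : S.H i j) {x : T ⟶ A.arr i j} {b : T ⟶ B.obj (D.idx i)}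
    (h : x ≫ A.σ i j = b ≫ D.obj i) :
    rest (rest (x ≫ S.q f) ≫ b ≫ (D.t f).1) = rest (x ≫ S.q f) := by
  have e : rest (x ≫ S.q f) ≫ x = _ := (S.isGlueing i j).rest_comp_eq x f
  rw [Category.assoc, h] at e
  have e1 : rest (b ≫ (D.t f).1) = rest ((b ≫ D.obj i) ≫ S.s f) := by
    rw [← rest_comp_total (b ≫ _) (B.τ (D.idx i) (D.idx j)), ← rest_comp_total _ (D.obj j),
      ← rest_comp_total (_ ≫ S.s f) (A.τ i j)]
    have := D.nat f
    simp only [Category.assoc] at this ⊢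
    rw [this]
  rw [rest_rest_comp, e1, ← rest_rest_comp, ← e, rest_rest_comp, rest_comp_comp]

variable [JoinRestrictionCategory C]

/-- The action is the join of its forced values: an arrow on the section `f` is sent to `t f` at the
given point. On overlaps the values match by `agree`. -/
theorem exists_arr (i j : A.I) : ∃ m : pullback (A.σ i j) (D.obj i) ⟶ B.arr (D.idx i) (D.idx j),
    ∀ f : S.H i j, rest (pullback.fst (A.σ i j) (D.obj i) ≫ S.q f) ≫ m =
      rest (pullback.fst (A.σ i j) (D.obj i) ≫ S.q f) ≫
        pullback.snd (A.σ i j) (D.obj i) ≫ (D.t f).1 := by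
  have hc : pullback.fst (A.σ i j) (D.obj i) ≫ A.σ i j = _ := pullback.condition
  -- Seen from the chart of `f`, the overlap with the chart of `g` is the pullback of the locus `s f
  -- ≫ q g`, which is the form that `agree` needs.
  have aux : ∀ f g : S.H i j, rest (pullback.fst (A.σ i j) (D.obj i) ≫ S.q f) ≫
      rest (pullback.fst (A.σ i j) (D.obj i) ≫ S.q g) =
      rest (pullback.fst (A.σ i j) (D.obj i) ≫ S.q f) ≫
        rest (pullback.snd (A.σ i j) (D.obj i) ≫ D.obj i ≫ S.s f ≫ S.q g) := fun f g => by
    have e := congrArg (fun z => rest (z ≫ S.q g))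
      ((S.isGlueing i j).rest_comp_eq (pullback.fst (A.σ i j) (D.obj i)) f)
    rw [hc] at e
    simp only [Category.assoc] at e
    rw [rest_rest_comp, rest_rest_comp] at e
    exact e
  obtain ⟨m, hm⟩ := exists_isLUB_range (fun f : S.H i j =>
    rest (pullback.fst (A.σ i j) (D.obj i) ≫ S.q f) ≫
        pullback.snd (A.σ i j) (D.obj i) ≫ (D.t f).1) (fun f g => by
      have e := congrArg (fun z => pullback.snd (A.σ i j) (D.obj i) ≫ z) (D.agree f g)
      dsimp only at e
      simp only [← Category.assoc, comp_rest] at e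
      simp only [Category.assoc] at e
      rw [Compatible, D.rest_q_comp f hc, D.rest_q_comp g hc, ← Category.assoc, rest_comm, aux,
        Category.assoc, e, ← Category.assoc, ← aux, Category.assoc])
  refine ⟨m, fun f => ?_⟩
  have := rest_comp_eq_of_le (hm.1 ⟨f, rfl⟩)
  dsimp only at this
  rwa [D.rest_q_comp f hc] at this

/-- The action on arrows of the cofunctor built from the data. -/
noncomputable def arr (i j : A.I) :
    pullback (A.σ i j) (D.obj i) ⟶ B.arr (D.idx i) (D.idx j) := (D.exists_arr i j).choose

theorem rest_comp_arr {i j : A.I} (f : S.H i j) :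
    rest (pullback.fst (A.σ i j) (D.obj i) ≫ S.q f) ≫ D.arr i j =
      rest (pullback.fst (A.σ i j) (D.obj i) ≫ S.q f) ≫
        pullback.snd (A.σ i j) (D.obj i) ≫ (D.t f).1 := (D.exists_arr i j).choose_spec f

/-- An element lying on the section `f` is in the chart of `f` wherever it is defined, so no
restriction is left in the formula for the action. -/
theorem lift_arr {i j : A.I} (f : S.H i j) {x : T ⟶ A.arr i j} {b : T ⟶ B.obj (D.idx i)}
    (h : x ≫ A.σ i j = b ≫ D.obj i) (hx : x = (b ≫ D.obj i) ≫ S.s f) :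
    pullback.lift x b h ≫ D.arr i j = b ≫ (D.t f).1 := by
  have hr : rest (x ≫ S.q f) = rest x := by
    rw [hx, Category.assoc, ((S.isGlueing i j).isPartialInverse f |> isPartialInverse_symm).1,
      rest_comp_rest]
  have hb : rest x = rest b := by
    rw [← rest_comp_total x (A.σ i j), h, rest_comp_total]
  have hl : rest (pullback.lift x b h) = rest x := by
    rw [← rest_comp_total (pullback.lift x b h) (pullback.fst _ _), pullback.lift_fst]
  have e := congrArg (fun z => pullback.lift x b h ≫ z) (D.rest_comp_arr f)
  dsimp only at e
  rw [← Category.assoc, ← Category.assoc (pullback.lift x b h), comp_rest, ← Category.assoc _ _ (S.q f),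
    pullback.lift_fst, hr, ← hl, rest_comp_self, pullback.lift_snd_assoc] at e
  exact e

theorem comp_lift_arr {T' : C} (f : T' ⟶ T) {i j : A.I} {x : T ⟶ A.arr i j}
    {b : T ⟶ B.obj (D.idx i)} (h : x ≫ A.σ i j = b ≫ D.obj i) :
    f ≫ pullback.lift x b h ≫ D.arr i j =
      pullback.lift (f ≫ x) (f ≫ b) (by rw [Category.assoc, h, Category.assoc]) ≫ D.arr i j := by
  rw [← Category.assoc]
  congr 1
  apply pullback.hom_ext
  · rw [Category.assoc, pullback.lift_fst, pullback.lift_fst]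
  · rw [Category.assoc, pullback.lift_snd, pullback.lift_snd]

theorem arr_σ (i j : A.I) : D.arr i j ≫ B.σ (D.idx i) (D.idx j) = pullback.snd _ _ := by
  refine (S.isGlueing i j).ext_elem_total (pullback.fst _ _) fun f => ?_
  have hr := D.rest_q_comp f (pullback.condition (f := A.σ i j) (g := D.obj i))
  rw [← Category.assoc, D.rest_comp_arr, Category.assoc, Category.assoc,
    (D.t f).section_eq, ← Category.assoc, comp_rest, Category.assoc, hr, ← Category.assoc,
    rest_idem]

theorem arr_τ (i j : A.I) : D.arr i j ≫ B.τ (D.idx i) (D.idx j) ≫ D.obj j =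
    pullback.fst _ _ ≫ A.τ i j := by
  refine (S.isGlueing i j).ext_elem_total (pullback.fst _ _) fun f => ?_
  have e : _ ≫ pullback.fst (A.σ i j) (D.obj i) = _ :=
    (S.isGlueing i j).rest_comp_eq (pullback.fst (A.σ i j) (D.obj i)) f
  rw [pullback.condition] at e
  have hn := D.nat f
  rw [Category.assoc] at hn
  rw [← Category.assoc, D.rest_comp_arr, ← Category.assoc _ _ (A.τ i j), e]
  simp only [Category.assoc, hn]

/-- On the region `E` the arrows lie on sections `f` and `g`. Their product lies on `comp f g`, and
both sides become the value of `t (comp f g)` by `t_comp`. -/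
theorem lift_arr_mul {i j k : A.I} (f : S.H i j) (g : S.H j k) (E : T ⟶ T)
    {x : T ⟶ A.arr i j} {y : T ⟶ A.arr j k} {b : T ⟶ B.obj (D.idx i)}
    (hyx : y ≫ A.σ j k = x ≫ A.τ i j) (hb : x ≫ A.σ i j = b ≫ D.obj i)
    (ht : y ≫ A.σ j k = ((pullback.lift x b hb ≫ D.arr i j) ≫ B.τ _ _) ≫ D.obj j)
    (hx : E ≫ x = ((E ≫ b) ≫ D.obj i) ≫ S.s f)
    (hy : E ≫ y = ((E ≫ x) ≫ A.τ i j) ≫ S.s g) :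
    E ≫ pullback.lift (mul y x hyx) b (by rw [mul_σ, hb]) ≫ D.arr i k =
      E ≫ mul (pullback.lift y ((pullback.lift x b hb ≫ D.arr i j) ≫ B.τ _ _) ht ≫ D.arr j k)
        (pullback.lift x b hb ≫ D.arr i j) (by
          rw [Category.assoc, D.arr_σ, pullback.lift_snd]) := by
  have hEb : (E ≫ x) ≫ A.σ i j = (E ≫ b) ≫ D.obj i := by
    rw [Category.assoc, hb, Category.assoc]
  have hEt : (E ≫ y) ≫ A.σ j k =
      (E ≫ (pullback.lift x b hb ≫ D.arr i j) ≫ B.τ _ _) ≫ D.obj j := by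
    rw [Category.assoc, ht]; simp only [Category.assoc]
  have e1 : E ≫ pullback.lift x b hb ≫ D.arr i j = (E ≫ b) ≫ (D.t f).1 := by
    rw [D.comp_lift_arr, D.lift_arr f hEb hx]
  have e2 : E ≫ mul y x hyx = ((E ≫ b) ≫ D.obj i) ≫ S.s (S.comp f g) := by
    rw [comp_mul, mul_section (S.hom f) (S.hom g) ((E ≫ b) ≫ D.obj i) _ hx hy, ← S.hom_comp]
    rfl
  have e3 : E ≫ pullback.lift y ((pullback.lift x b hb ≫ D.arr i j) ≫ B.τ _ _) ht ≫ D.arr j k =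
      (((E ≫ b) ≫ (D.t f).1) ≫ B.τ _ _) ≫ (D.t g).1 := by
    have e4 : E ≫ (pullback.lift x b hb ≫ D.arr i j) ≫ B.τ _ _ =
        ((E ≫ b) ≫ (D.t f).1) ≫ B.τ _ _ := by rw [← e1]; simp only [Category.assoc]
    rw [D.comp_lift_arr, D.lift_arr g hEt, e4]
    rw [hy, hx, e4, Category.assoc _ _ (D.obj j), Category.assoc _ _ (_ ≫ D.obj j),
      ← Category.assoc (D.t f).1, D.nat f]
    simp only [Category.assoc]
  rw [D.comp_lift_arr, D.lift_arr (S.comp f g) _ e2, comp_mul,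
    mul_section (D.t f) (D.t g) (E ≫ b) _ e1 (by rw [e3, e1]), D.t_comp]

/-- The cofunctor built from the data. -/
noncomputable def cofunctor : Cofunctor A B where
  idx := D.idx
  obj := D.obj
  arr := D.arr
  source := D.arr_σ
  target := D.arr_τ
  unit i := by
    rw [D.lift_arr (S.one i), D.t_one, Category.id_comp]
    rw [Category.id_comp, S.s_one]
  comp i j k := by
    intro R y xb
    have hyx : y ≫ A.σ j k = (xb ≫ pullback.fst _ _) ≫ A.τ i j := by
      rw [Category.assoc]; exact pullback.condition
    have hxb : (xb ≫ pullback.fst _ _) ≫ A.σ i j = (xb ≫ pullback.snd _ _) ≫ D.obj i := by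
      rw [Category.assoc, pullback.condition, Category.assoc]
    -- The multiplicativity law is checked where `y` and the first arrow lie in given charts;
    -- `lift_arr_mul` applies with `E` the product of the two domains.
    refine (S.isGlueing j k).ext_elem_total y fun g => ?_
    refine (S.isGlueing i j).ext_elem_total (xb ≫ pullback.fst _ _) fun f => ?_
    have ef : rest ((xb ≫ pullback.fst _ _) ≫ S.q f) ≫ xb ≫ pullback.fst _ _ = _ :=
      (S.isGlueing i j).rest_comp_eq (xb ≫ pullback.fst _ _) f
    have eg : rest (y ≫ S.q g) ≫ y = _ := (S.isGlueing j k).rest_comp_eq y g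
    rw [hxb] at ef
    rw [hyx] at eg
    have key := D.lift_arr_mul f g
      (rest ((xb ≫ pullback.fst _ _) ≫ S.q f) ≫ rest (y ≫ S.q g)) hyx hxb
      (by rw [Category.assoc, Category.assoc, D.arr_τ, pullback.lift_fst_assoc, hyx])
      (by rw [rest_comm, Category.assoc, ef]; simp only [Category.assoc])
      (by rw [Category.assoc, eg]; simp only [Category.assoc])
    have el : pullback.lift (xb ≫ pullback.fst _ _) (xb ≫ pullback.snd _ _) hxb = xb := by
      apply pullback.hom_ext
      · rw [pullback.lift_fst]
      · rw [pullback.lift_snd]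
    simp only [el, Category.assoc] at key ⊢
    exact key

/-- The extension takes the prescribed value on each section of the cover, since `lift_arr`
evaluates it there and `nat` matches the domains. This yields the surjectivity statements on
hom-sets. -/
theorem phiMapHom_cofunctor {i j : A.I} (f : S.H i j) :
    phiMapHom D.cofunctor (S.hom f) = D.t f := by
  refine Subtype.ext ?_
  rw [phiMapHom_val]
  refine (D.lift_arr f (phiMap_aux D.cofunctor (S.hom f)) ?_).trans ?_
  · have : rest (D.obj i ≫ S.s f) ≫ D.obj i ≫ S.s f = D.obj i ≫ S.s f := rest_comp_self _
    rw [← Category.assoc] at this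
    exact this.symm
  · have e : rest (D.obj i ≫ S.s f) = rest (D.t f).1 := by
      rw [← rest_comp_total (_ ≫ S.s f) (A.τ i j), Category.assoc, ← D.nat,
        rest_comp_total, rest_comp_total]
    change rest (D.obj i ≫ S.s f) ≫ _ = _
    rw [e, rest_comp_self]

end CofunctorData

variable [JoinRestrictionCategory C]

/-- A cofunctor is determined by its action on objects and on the members of a section cover. -/
theorem cofunctor_ext {idx : A.I → B.I} {obj obj' : ∀ i, B.obj (idx i) ⟶ A.obj i}
    {t : ∀ i, IsTotal (obj i)} {t' : ∀ i, IsTotal (obj' i)}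
    {arr : ∀ i j, pullback (A.σ i j) (obj i) ⟶ B.arr (idx i) (idx j)}
    {arr' : ∀ i j, pullback (A.σ i j) (obj' i) ⟶ B.arr (idx i) (idx j)}
    {s : _} {s' : _} {g : _} {g' : _} {n : _} {n' : _} {c : _} {c' : _}
    (ho : ∀ i, obj i = obj' i)
    (hs : ∀ i j (f : S.H i j),
      (phiMapHom (⟨idx, obj, arr, s, g, n, c⟩ : Cofunctor A B) (S.hom f)).1 =
        (phiMapHom (⟨idx, obj', arr', s', g', n', c'⟩ : Cofunctor A B) (S.hom f)).1) :
    (⟨idx, obj, arr, s, g, n, c⟩ : Cofunctor A B) = ⟨idx, obj', arr', s', g', n', c'⟩ := by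
  obtain rfl : obj = obj' := funext ho
  refine Cofunctor.ext_of_act ho fun i j T x b h h' => ?_
  let F : Cofunctor A B := ⟨idx, obj, arr, s, g, n, c⟩
  let F' : Cofunctor A B := ⟨idx, obj, arr', s', g', n', c'⟩
  change F.act x b h = F'.act x b h'
  -- Where `x` lies in the chart of `f`, each action is the value of its cofunctor on the section of
  -- `f`.
  refine (S.isGlueing i j).ext_elem x (F.rest_act x b h).le (F'.rest_act x b h').le fun f => ?_
  have e := (S.isGlueing i j).rest_comp_eq x f
  have e' : rest (x ≫ S.q f) ≫ x =
      ((rest (x ≫ S.q f) ≫ b) ≫ obj i) ≫ S.s f := by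
    rw [h] at e
    rw [e]; simp only [Category.assoc]
  rw [F.comp_act, F'.comp_act]
  refine (act_section F (S.hom f) _ _ e').trans (Eq.trans ?_
    (act_section F' (S.hom f) _ _ e').symm)
  exact congrArg (fun z => (rest (x ≫ S.q f) ≫ b) ≫ z) (hs i j f)

end SectionCover

end RestrictionTheory

/-! ### Equality loci, and the construction of an internalisation. -/

namespace RestrictionTheory

open RestrictionCategory PartiteCategory

theorem comp_pullback_lift {C : Type u} [Category.{v} C] {X Y Z T T' : C} {f : X ⟶ Z} {g : Y ⟶ Z}
    [HasPullback f g] (k : T' ⟶ T) (x : T ⟶ X) (y : T ⟶ Y) (h : x ≫ f = y ≫ g) :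
    k ≫ pullback.lift x y h =
      pullback.lift (k ≫ x) (k ≫ y) (by rw [Category.assoc, h, Category.assoc]) := by
  apply pullback.hom_ext
  · rw [Category.assoc, pullback.lift_fst, pullback.lift_fst]
  · rw [Category.assoc, pullback.lift_snd, pullback.lift_snd]

theorem rest_comp_of_idem {C : Type u} [Category.{v} C] [RestrictionCategory C] {X Y : C}
    {e : X ⟶ X} (he : rest e = e) (g : X ⟶ Y) : rest (e ≫ g) = e ≫ rest g := by
  have := rest_rest_comp e g
  rwa [he] at this

/-- The equation `n ≫ rest f = n` expresses that `n` is supported where `f` is defined. This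
survives shrinking `n`, so several chart conditions can be imposed in turn. -/
theorem absorb_of_absorb {C : Type u} [Category.{v} C] [RestrictionCategory C] {X Y Z T : C}
    {n : T ⟶ X} {f : X ⟶ Y} (h : n ≫ rest f = n) (g : X ⟶ Z) :
    (n ≫ rest g) ≫ rest f = n ≫ rest g := by
  rw [Category.assoc, rest_comm, ← Category.assoc, h]

section ValEq

variable {C : Type u} [Category.{v} C] [RestrictionCategory C] {P : RCatOver.{w} C}
  {i j k : P.cat}

/-- Being below the domain of `g` comes for free: `e ≫ f` has domain `e`, and it equals `e ≫ g`. -/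
theorem mem_valEqSet {f g : i ⟶ j} {e : i ⟶ i} (he : rest e = e) (hf : e ≫ rest f = e)
    (hfg : e ≫ f = e ≫ g) : P.P.map e ∈ valEqSet P f g := by
  have hg : e ≫ rest g = e := by
    rw [← rest_comp_of_idem he g, ← hfg, rest_comp_of_idem he, hf]
  exact ⟨e, he, by rw [le_def, he, ← Category.assoc, hf, hg], hfg, rfl⟩

theorem exists_of_mem_valEqSet {f g : i ⟶ j} {x : P.P.obj i ⟶ P.P.obj i}
    (hx : x ∈ valEqSet P f g) : ∃ e : i ⟶ i, rest e = e ∧ e ≫ rest f = e ∧ e ≫ rest g = e ∧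
      e ≫ f = e ≫ g ∧ P.P.map e = x := by
  obtain ⟨e, he, hle, hfg, rfl⟩ := hx
  rw [le_def, he] at hle
  refine ⟨e, he, ?_, ?_, hfg, rfl⟩
  · rw [hle, Category.assoc, Category.assoc, rest_comm g f, ← Category.assoc (rest f), rest_idem]
  · rw [hle, Category.assoc, Category.assoc, rest_idem]

theorem valEqSet_symm (f g : i ⟶ j) : valEqSet P f g = valEqSet P g f := by
  have key : ∀ f g : i ⟶ j, valEqSet P f g ⊆ valEqSet P g f := by
    intro f g x hx
    obtain ⟨e, he, -, hg, hfg, rfl⟩ := exists_of_mem_valEqSet hx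
    exact mem_valEqSet he hg hfg.symm
  exact (key f g).antisymm (key g f)

variable [JoinRestrictionCategory C]

theorem valEq_le_id (f g : i ⟶ j) : valEq P f g ≤ 𝟙 _ := by
  refine (isLUB_valEq P f g).2 ?_
  rintro _ ⟨e, he, -, -, rfl⟩
  rw [← he, P.map_rest]
  exact rest_le_id _

theorem rest_valEq (f g : i ⟶ j) : rest (valEq P f g) = valEq P f g := by
  have := valEq_le_id f g
  rw [← rest_id] at this
  exact rest_eq_of_le_rest this

theorem valEq_symm (f g : i ⟶ j) : valEq P f g = valEq P g f := by
  have := isLUB_valEq P f g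
  rw [valEqSet_symm] at this
  exact this.unique (isLUB_valEq P g f)

theorem map_le_valEq {f g : i ⟶ j} {e : i ⟶ i} (he : rest e = e) (hf : e ≫ rest f = e)
    (hfg : e ≫ f = e ≫ g) : P.P.map e ≤ valEq P f g :=
  (isLUB_valEq P f g).1 (mem_valEqSet he hf hfg)

theorem valEq_self (f : i ⟶ j) : valEq P f f = rest (P.P.map f) := by
  rw [Internalisation.valEq_of_mem f f (rest f) (rest_rest f) (rest_idem f).symm rfl, P.map_rest]

/-- Precomposites with the equality of `f` and `g` can be compared on the idempotents on which
`f` and `g` agree. -/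
theorem valEq_comp_ext {Z : C} {f g : i ⟶ j} {m m' : P.P.obj i ⟶ Z}
    (H : ∀ e : i ⟶ i, rest e = e → e ≫ rest f = e → e ≫ rest g = e → e ≫ f = e ≫ g →
      P.P.map e ≫ m = P.P.map e ≫ m') : valEq P f g ≫ m = valEq P f g ≫ m' := by
  have h1 := isLUB_postcomp (isLUB_valEq P f g) m
  have h2 := isLUB_postcomp (isLUB_valEq P f g) m'
  have e : (fun s => s ≫ m) '' valEqSet P f g = (fun s => s ≫ m') '' valEqSet P f g := by
    refine Set.image_congr fun x hx => ?_
    obtain ⟨e, he, hf, hg, hfg, rfl⟩ := exists_of_mem_valEqSet hx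
    exact H e he hf hg hfg
  rw [e] at h1
  exact h1.unique h2

theorem valEq_comp_le {f g : i ⟶ j} {m m' : P.P.obj i ⟶ P.P.obj i}
    (H : ∀ e : i ⟶ i, rest e = e → e ≫ rest f = e → e ≫ rest g = e → e ≫ f = e ≫ g →
      P.P.map e ≫ m ≤ m') : valEq P f g ≫ m ≤ m' := by
  refine (isLUB_postcomp (isLUB_valEq P f g) m).2 ?_
  rintro _ ⟨x, hx, rfl⟩
  obtain ⟨e, he, hf, hg, hfg, rfl⟩ := exists_of_mem_valEqSet hx
  exact H e he hf hg hfg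

theorem valEq_comp_map (f g : i ⟶ j) :
    valEq P f g ≫ P.P.map f = valEq P f g ≫ P.P.map g :=
  valEq_comp_ext fun e _ _ _ hfg => by rw [← Functor.map_comp, hfg, Functor.map_comp]

/-- If `f` and `g` agree on `e`, and `g` and `h` on `d`, then `f` and `h` agree on `e ≫ d`.
Composition with joins on either side reduces the claim to this. -/
theorem valEq_trans (f g h : i ⟶ j) : valEq P f g ≫ valEq P g h ≤ valEq P f h := by
  refine valEq_comp_le fun e he hf hg hfg => ?_
  refine (isLUB_precomp (P.P.map e) (isLUB_valEq P g h)).2 ?_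
  rintro _ ⟨x, hx, rfl⟩
  obtain ⟨d, hd, hd1, hd2, hgh, rfl⟩ := exists_of_mem_valEqSet hx
  have hc : e ≫ d = d ≫ e := by rw [← he, ← hd, rest_comm]
  dsimp only
  rw [← Functor.map_comp]
  refine map_le_valEq ?_ ?_ ?_
  · rw [rest_comp_of_idem he, hd]
  · rw [hc, Category.assoc, hf]
  · rw [hc, Category.assoc, hfg, ← Category.assoc, ← hc, Category.assoc, hgh, Category.assoc]

/-- If `f` and `f'` agree on `e`, and `g` and `g'` on `d`, the composites agree on `e ≫ rest (f ≫
d)`, because `rest (f ≫ d) ≫ f = f ≫ d`. This is what makes multiplication well defined. -/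
theorem valEq_comp_le_valEq (f f' : i ⟶ j) (g g' : j ⟶ k) :
    valEq P f f' ≫ rest (P.P.map f ≫ valEq P g g') ≤ valEq P (f ≫ g) (f' ≫ g') := by
  refine valEq_comp_le fun e he hf _ hff => ?_
  refine (isLUB_precomp (P.P.map e)
    (isLUB_iff.1 (isLUB_precomp (P.P.map f) (isLUB_valEq P g g'))).2).2 ?_
  rintro _ ⟨_, ⟨_, ⟨x, hx, rfl⟩, rfl⟩, rfl⟩
  obtain ⟨d, hd, hd1, -, hgg, rfl⟩ := exists_of_mem_valEqSet hx
  dsimp only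
  rw [← Functor.map_comp, ← P.map_rest, ← Functor.map_comp]
  have hfd : rest (f ≫ d) ≫ f = f ≫ d := by rw [← comp_rest, hd]
  have hc : e ≫ rest (f ≫ d) = rest (f ≫ d) ≫ e := by
    have := rest_comm e (f ≫ d)
    rwa [he] at this
  refine map_le_valEq ?_ ?_ ?_
  · rw [rest_comp_of_idem he, rest_rest]
  · rw [Category.assoc]
    congr 1
    rw [← rest_rest_comp, ← Category.assoc, hfd, Category.assoc, ← rest_comp_rest,
      rest_comp_of_idem hd, hd1]
  · calc (e ≫ rest (f ≫ d)) ≫ f ≫ g = e ≫ (rest (f ≫ d) ≫ f) ≫ g := by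
          simp only [Category.assoc]
      _ = e ≫ (rest (f ≫ d) ≫ f) ≫ g' := by
          rw [hfd, Category.assoc, hgg, Category.assoc]
      _ = (e ≫ rest (f ≫ d)) ≫ f ≫ g' := by simp only [Category.assoc]
      _ = (e ≫ rest (f ≫ d)) ≫ f' ≫ g' := by
          rw [hc, Category.assoc, ← Category.assoc e, hff]; simp only [Category.assoc]

variable (P) in
/-- The local atlas formed by the equalities of the maps `i ⟶ j`. -/
noncomputable def valEqAtlas (i j : P.cat) : LocalAtlas (P.P.obj i) (i ⟶ j) where
  φ f g := valEq P f g
  rest_φ := rest_valEq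
  symm := valEq_symm
  trans := valEq_trans

end ValEq

/-- The source and target maps of an internalisation. -/
structure PreInternalisation {C : Type u} [Category.{v} C] [RestrictionCategory C]
    [JoinRestrictionCategory C] (P : RCatOver.{w} C) where
  graph : PartiteGraph P.P.obj
  q : ∀ {i j : P.cat}, (i ⟶ j) → (graph.arr i j ⟶ P.P.obj i)
  s : ∀ {i j : P.cat}, (i ⟶ j) → (P.P.obj i ⟶ graph.arr i j)
  isGlueing : ∀ i j : P.cat, IsGlueing (fun f g : i ⟶ j => valEq P f g) (graph.σ i j)
    (fun f => q f) (fun f => s f)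
  s_τ : ∀ {i j : P.cat} (f : i ⟶ j), s f ≫ graph.τ i j = P.P.map f

namespace PreInternalisation

variable {C : Type u} [Category.{v} C] [RestrictionCategory C]
  [JoinRestrictionCategory C] {P : RCatOver.{w} C}

/-- The sources are glueings of the equality atlases. The targets descend from the maps `P f`, which
coincide on equality loci by `valEq_comp_map`. -/
theorem nonempty (hC : HasLocalGlueings C) (P : RCatOver.{w} C) :
    Nonempty (PreInternalisation P) := by
  choose arr p q s h using fun i j : P.cat => hC (P.P.obj i) (i ⟶ j) (valEqAtlas P i j)
  have hτ : ∀ i j, ∃ d : arr i j ⟶ P.P.obj j, IsTotal d ∧ ∀ f, s i j f ≫ d = P.P.map f :=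
    fun i j => (h i j).exists_desc (fun f => P.P.map f)
      (fun f => by rw [(h i j).rest_s]; exact (valEq_self f).symm)
      (fun f g => valEq_comp_map f g)
  choose τ τt hτ using hτ
  exact ⟨{
    graph :=
      { arr := arr
        σ := p
        τ := τ
        σ_total := fun i j => (h i j).total
        τ_total := τt
        hasPullback := fun i j X f hf => hC.hasPullback (valEqAtlas P i j) (h i j) f }
    q := fun {i j} f => q i j f
    s := fun {i j} f => s i j f
    isGlueing := h
    s_τ := fun f => hτ _ _ f }⟩

variable (G : PreInternalisation P) {T : C} {i j k l : P.cat}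

theorem rest_s (f : i ⟶ j) : rest (G.s f) = rest (P.P.map f) := by
  rw [(G.isGlueing i j).rest_s f, valEq_self]

theorem s_comp_q (f g : i ⟶ j) : G.s f ≫ G.q g = valEq P f g := (G.isGlueing i j).induces f g

/-- This is `valEq_comp_le_valEq` at a generalised point. The point `a` lies where `f` and `f'`
agree, its image `b` lies where `g` and `g'` agree, and `hr` says that `f` is defined at `a`. -/
theorem comp_s_eq {f f' : i ⟶ j} {g g' : j ⟶ k} {a : T ⟶ P.P.obj i} {b : T ⟶ P.P.obj j}
    (hf : a ≫ valEq P f f' = a) (hab : a ≫ P.P.map f = b) (hg : b ≫ valEq P g g' = b)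
    (hr : rest b = rest a) : a ≫ G.s (f ≫ g) = a ≫ G.s (f' ≫ g') := by
  have hW := valEq_comp_le_valEq (P := P) f f' g g'
  have hWr : rest (valEq P f f' ≫ rest (P.P.map f ≫ valEq P g g')) =
      valEq P f f' ≫ rest (P.P.map f ≫ valEq P g g') :=
    rest_eq_of_le_rest (hW.trans (rest_valEq _ _).ge)
  rw [le_def, hWr] at hW
  have ha : a ≫ valEq P f f' ≫ rest (P.P.map f ≫ valEq P g g') = a := by
    rw [← Category.assoc, hf, comp_rest, ← Category.assoc, hab, hg, hr, rest_comp_self]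
  have hV : a ≫ valEq P (f ≫ g) (f' ≫ g') = a := by
    conv_lhs => rw [← ha]
    rw [Category.assoc, ← hW, ha]
  rw [← hV, Category.assoc, (G.isGlueing i k).φ_comp_s (f ≫ g) (f' ≫ g'), Category.assoc]

/-- On the restriction of a composable pair to the domain of definition of local representatives,
these represent the pair. -/
theorem comp_eq_of_absorb {x : T ⟶ G.graph.arr i j} {n : T ⟶ T} {f : i ⟶ j}
    (hn : n ≫ rest (x ≫ G.q f) = n) :
    n ≫ x = (n ≫ x ≫ G.graph.σ i j) ≫ G.s f ∧
      (n ≫ x ≫ G.graph.σ i j) ≫ P.P.map f = n ≫ x ≫ G.graph.τ i j ∧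
      n ≫ x ≫ G.q f = n ≫ x ≫ G.graph.σ i j := by
  have e : rest (x ≫ G.q f) ≫ x = _ := (G.isGlueing i j).rest_comp_eq x f
  have e' : x ≫ G.q f = _ := (G.isGlueing i j).comp_q_eq x f
  have e1 : n ≫ x = (n ≫ x ≫ G.graph.σ i j) ≫ G.s f := by
    have := congrArg (fun z => n ≫ z) e
    simp only [← Category.assoc, hn] at this
    simpa only [Category.assoc] using this
  refine ⟨e1, ?_, ?_⟩
  · rw [← G.s_τ, ← Category.assoc, ← e1, Category.assoc]
  · rw [e', ← Category.assoc, hn]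

/-- The local value of a product has the right target. Since targets are total, this also computes
its domain. -/
theorem rest_comp_s {x : T ⟶ G.graph.arr i j} {y : T ⟶ G.graph.arr j k}
    (h : y ≫ G.graph.σ j k = x ≫ G.graph.τ i j) {n : T ⟶ T} {f : i ⟶ j} {g : j ⟶ k}
    (hf : n ≫ rest (x ≫ G.q f) = n) (hg : n ≫ rest (y ≫ G.q g) = n) :
    ((n ≫ x ≫ G.graph.σ i j) ≫ G.s (f ≫ g)) ≫ G.graph.τ i k = n ≫ y ≫ G.graph.τ j k := by
  obtain ⟨-, x2, -⟩ := G.comp_eq_of_absorb hf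
  obtain ⟨-, y2, -⟩ := G.comp_eq_of_absorb hg
  rw [Category.assoc, G.s_τ, Functor.map_comp, ← Category.assoc, x2, ← h, y2]

/-- Where `x` lies on `s f` and `y` on `s g`, the product must lie on `s (f ≫ g)` over the source of
`x`. Compatibility of these values is `comp_s_eq`; totality of `y` makes their domains exactly the
regions in question. -/
theorem exists_mul (x : T ⟶ G.graph.arr i j) (y : T ⟶ G.graph.arr j k) [IsTotal y]
    (h : y ≫ G.graph.σ j k = x ≫ G.graph.τ i j) :
    ∃ m : T ⟶ G.graph.arr i k, ∀ (f : i ⟶ j) (g : j ⟶ k),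
      (rest (x ≫ G.q f) ≫ rest (y ≫ G.q g)) ≫ m =
        (rest (x ≫ G.q f) ≫ rest (y ≫ G.q g)) ≫ (x ≫ G.graph.σ i j) ≫ G.s (f ≫ g) := by
  let E : (i ⟶ j) × (j ⟶ k) → (T ⟶ T) := fun c => rest (x ≫ G.q c.1) ≫ rest (y ≫ G.q c.2)
  have hE : ∀ c, rest (E c) = E c := fun c => by
    change rest (_ ≫ _) = _
    rw [rest_rest_comp, rest_rest]
  have hE1 : ∀ c, E c ≫ rest (x ≫ G.q c.1) = E c := fun c =>
    absorb_of_absorb (rest_idem _) _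
  have hE2 : ∀ c, E c ≫ rest (y ≫ G.q c.2) = E c := fun c => by
    change (_ ≫ _) ≫ _ = _
    rw [Category.assoc, rest_idem]
  let m : (i ⟶ j) × (j ⟶ k) → (T ⟶ G.graph.arr i k) :=
    fun c => (E c ≫ x ≫ G.graph.σ i j) ≫ G.s (c.1 ≫ c.2)
  have hm : ∀ c, rest (m c) = E c := fun c => by
    change rest ((E c ≫ x ≫ G.graph.σ i j) ≫ G.s (c.1 ≫ c.2)) = _
    rw [← rest_comp_total _ (G.graph.τ i k), G.rest_comp_s h (hE1 c) (hE2 c), ← Category.assoc,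
      rest_comp_total, rest_comp_of_idem (hE c), IsTotal.rest_eq (f := y), Category.comp_id]
  obtain ⟨d, hd⟩ := exists_isLUB_range m (fun c c' => by
    have hcomm : E c' ≫ E c = E c ≫ E c' := by rw [← hE c, ← hE c', rest_comm]
    have a1 : (E c ≫ E c') ≫ rest (x ≫ G.q c.1) = E c ≫ E c' := by
      rw [← hcomm, Category.assoc, hE1]
    have a2 : (E c ≫ E c') ≫ rest (y ≫ G.q c.2) = E c ≫ E c' := by
      rw [← hcomm, Category.assoc, hE2]
    have a3 : (E c ≫ E c') ≫ rest (x ≫ G.q c'.1) = E c ≫ E c' := by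
      rw [Category.assoc, hE1]
    have a4 : (E c ≫ E c') ≫ rest (y ≫ G.q c'.2) = E c ≫ E c' := by
      rw [Category.assoc, hE2]
    obtain ⟨x1, x2, -⟩ := G.comp_eq_of_absorb a1
    obtain ⟨y1, -, -⟩ := G.comp_eq_of_absorb a2
    obtain ⟨-, -, x3⟩ := G.comp_eq_of_absorb a3
    obtain ⟨-, -, y3⟩ := G.comp_eq_of_absorb a4
    rw [Compatible, hm, hm]
    change E c' ≫ (E c ≫ x ≫ G.graph.σ i j) ≫ G.s (c.1 ≫ c.2) =
      E c ≫ (E c' ≫ x ≫ G.graph.σ i j) ≫ G.s (c'.1 ≫ c'.2)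
    -- On the common region, `x` lies on both first sections and `y` on both second ones, so source
    -- and intermediate point lie in the corresponding equality loci.
    have key := G.comp_s_eq (f := c.1) (f' := c'.1) (g := c.2) (g' := c'.2)
      (a := (E c ≫ E c') ≫ x ≫ G.graph.σ i j) (b := (E c ≫ E c') ≫ x ≫ G.graph.τ i j)
      (by rw [← G.s_comp_q, ← Category.assoc, ← x1, Category.assoc, x3]) x2
      (by rw [← G.s_comp_q, ← Category.assoc, ← h, ← y1, Category.assoc, y3])
      (by rw [← Category.assoc, rest_comp_total, ← Category.assoc _ x (G.graph.σ i j),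
        rest_comp_total _ (G.graph.σ i j)])
    rw [← Category.assoc (E c'), ← Category.assoc (E c'), hcomm, key]
    simp only [Category.assoc])
  refine ⟨d, fun f g => ?_⟩
  have h1 := rest_comp_eq_of_le (hd.1 ⟨(f, g), rfl⟩)
  rw [hm] at h1
  rw [h1]
  simp only [m, E, Category.assoc]

/-- The composition map of an internalisation. -/
noncomputable def μ (i j k : P.cat) :
    pullback (G.graph.σ j k) (G.graph.τ i j) ⟶ G.graph.arr i k :=
  (G.exists_mul (pullback.snd (G.graph.σ j k) (G.graph.τ i j)) (pullback.fst _ _)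
    pullback.condition).choose

theorem comp_μ {n : T ⟶ pullback (G.graph.σ j k) (G.graph.τ i j)} {f : i ⟶ j} {g : j ⟶ k}
    (hf : n ≫ rest (pullback.snd (G.graph.σ j k) (G.graph.τ i j) ≫ G.q f) = n)
    (hg : n ≫ rest (pullback.fst (G.graph.σ j k) (G.graph.τ i j) ≫ G.q g) = n) :
    n ≫ G.μ i j k = n ≫ (pullback.snd (G.graph.σ j k) (G.graph.τ i j) ≫ G.graph.σ i j) ≫
      G.s (f ≫ g) := by
  have e : (rest (pullback.snd (G.graph.σ j k) (G.graph.τ i j) ≫ G.q f) ≫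
      rest (pullback.fst (G.graph.σ j k) (G.graph.τ i j) ≫ G.q g)) ≫ G.μ i j k = _ :=
    (G.exists_mul (pullback.snd (G.graph.σ j k) (G.graph.τ i j)) (pullback.fst _ _)
      pullback.condition).choose_spec f g
  have e' := congrArg (fun z => n ≫ z) e
  simp only [← Category.assoc, hf, hg] at e'
  simpa only [Category.assoc] using e'

theorem lift_μ {x : T ⟶ G.graph.arr i j} {y : T ⟶ G.graph.arr j k} {f : i ⟶ j} {g : j ⟶ k}
    (h : y ≫ G.graph.σ j k = x ≫ G.graph.τ i j) (hx : x = (x ≫ G.graph.σ i j) ≫ G.s f)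
    (hy : y = (x ≫ G.graph.τ i j) ≫ G.s g) :
    pullback.lift y x h ≫ G.μ i j k = (x ≫ G.graph.σ i j) ≫ G.s (f ≫ g) := by
  have aux : ∀ {i j : P.cat} {x : T ⟶ G.graph.arr i j} {u : T ⟶ P.P.obj i} {f : i ⟶ j},
      x = u ≫ G.s f → rest (x ≫ G.q f) = rest x := by
    intro i j x u f hx
    rw [hx, Category.assoc, (isPartialInverse_symm ((G.isGlueing i j).isPartialInverse f)).1,
      rest_comp_rest]
  have hr : rest (pullback.lift y x h) = rest x := by
    rw [← rest_comp_total (pullback.lift y x h) (pullback.snd _ _), pullback.lift_snd]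
  have hr' : rest (pullback.lift y x h) = rest y := by
    rw [← rest_comp_total (pullback.lift y x h) (pullback.fst _ _), pullback.lift_fst]
  rw [G.comp_μ (f := f) (g := g), ← Category.assoc, pullback.lift_snd_assoc]
  · rw [comp_rest, pullback.lift_snd_assoc, aux hx, ← hr, rest_comp_self]
  · rw [comp_rest, pullback.lift_fst_assoc, aux hy, ← hr', rest_comp_self]

/-- The section property leaves only a domain to compute. It is read off from the target of the
value, which is that of `y`. -/
theorem comp_s_σ {x : T ⟶ G.graph.arr i j} {y : T ⟶ G.graph.arr j k}
    (h : y ≫ G.graph.σ j k = x ≫ G.graph.τ i j) {n : T ⟶ T} {f : i ⟶ j} {g : j ⟶ k}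
    (hf : n ≫ rest (x ≫ G.q f) = n) (hg : n ≫ rest (y ≫ G.q g) = n) :
    ((n ≫ x ≫ G.graph.σ i j) ≫ G.s (f ≫ g)) ≫ G.graph.σ i k = n ≫ x ≫ G.graph.σ i j := by
  have e : rest ((n ≫ x ≫ G.graph.σ i j) ≫ G.s (f ≫ g)) = rest (n ≫ x ≫ G.graph.σ i j) := by
    rw [← rest_comp_total _ (G.graph.τ i k), G.rest_comp_s h hf hg, ← Category.assoc,
      rest_comp_total (n ≫ y) (G.graph.τ j k), ← rest_comp_total (n ≫ y) (G.graph.σ j k),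
      Category.assoc, h, ← Category.assoc, rest_comp_total (n ≫ x) (G.graph.τ i j),
      ← Category.assoc n x (G.graph.σ i j), rest_comp_total (n ≫ x) (G.graph.σ i j)]
  rw [Category.assoc, (G.isGlueing i k).s_comp_p, comp_rest, e, rest_comp_self]

/-- Maps out of a composable pair of generalised elements can be compared locally. -/
theorem pair_ext (x : T ⟶ G.graph.arr i j) (y : T ⟶ G.graph.arr j k) [IsTotal x] [IsTotal y]
    {Z : C} {m m' : T ⟶ Z} (H : ∀ (n : T ⟶ T) (f : i ⟶ j) (g : j ⟶ k),
      n ≫ rest (x ≫ G.q f) = n → n ≫ rest (y ≫ G.q g) = n → n ≫ m = n ≫ m') : m = m' := by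
  refine (G.isGlueing i j).ext_elem_total x fun f => ?_
  refine (G.isGlueing j k).ext_elem_total y fun g => ?_
  have := H (rest (y ≫ G.q g) ≫ rest (x ≫ G.q f)) f g (by rw [Category.assoc, rest_idem])
    (absorb_of_absorb (rest_idem _) _)
  simpa only [Category.assoc] using this

theorem μ_σ (i j k : P.cat) :
    G.μ i j k ≫ G.graph.σ i k = pullback.snd _ _ ≫ G.graph.σ i j := by
  refine G.pair_ext (pullback.snd (G.graph.σ j k) (G.graph.τ i j)) (pullback.fst _ _)
    fun n f g hf hg => ?_
  have e := G.comp_s_σ pullback.condition hf hg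
  rw [← Category.assoc, G.comp_μ hf hg]
  simpa only [Category.assoc] using e

theorem μ_τ (i j k : P.cat) :
    G.μ i j k ≫ G.graph.τ i k = pullback.fst _ _ ≫ G.graph.τ j k := by
  refine G.pair_ext (pullback.snd (G.graph.σ j k) (G.graph.τ i j)) (pullback.fst _ _)
    fun n f g hf hg => ?_
  have e := G.rest_comp_s pullback.condition hf hg
  rw [← Category.assoc, G.comp_μ hf hg]
  simpa only [Category.assoc] using e

theorem s_one_σ (i : P.cat) : G.s (𝟙 i) ≫ G.graph.σ i i = 𝟙 _ := by
  rw [(G.isGlueing i i).s_comp_p, G.rest_s, P.P.map_id, rest_id]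

theorem s_one_τ (i : P.cat) : G.s (𝟙 i) ≫ G.graph.τ i i = 𝟙 _ := by
  rw [G.s_τ, P.P.map_id]

theorem s_comp_σ (f : i ⟶ j) : G.s f ≫ G.graph.σ i j = rest (G.s f) :=
  (G.isGlueing i j).s_comp_p f

/-- On elements lying on sections, both bracketings lie on the section of a triple composite, and
associativity in `P` identifies the two. -/
theorem lift_μ_assoc {x : T ⟶ G.graph.arr i j} {y : T ⟶ G.graph.arr j k}
    {z : T ⟶ G.graph.arr k l} {f : i ⟶ j} {g : j ⟶ k} {h : k ⟶ l}
    (hyx : y ≫ G.graph.σ j k = x ≫ G.graph.τ i j) (hzy : z ≫ G.graph.σ k l = y ≫ G.graph.τ j k)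
    (hx : x = (x ≫ G.graph.σ i j) ≫ G.s f) (hy : y = (x ≫ G.graph.τ i j) ≫ G.s g)
    (hz : z = (y ≫ G.graph.τ j k) ≫ G.s h) :
    pullback.lift z (pullback.lift y x hyx ≫ G.μ i j k)
        (by rw [Category.assoc, μ_τ, pullback.lift_fst_assoc, hzy]) ≫ G.μ i k l =
      pullback.lift (pullback.lift z y hzy ≫ G.μ j k l) x
        (by rw [Category.assoc, μ_σ, pullback.lift_snd_assoc, hyx]) ≫ G.μ i j l := by
  have e1 : (pullback.lift y x hyx ≫ G.μ i j k) ≫ G.graph.σ i k = x ≫ G.graph.σ i j := by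
    rw [Category.assoc, μ_σ, pullback.lift_snd_assoc]
  have e2 : (pullback.lift y x hyx ≫ G.μ i j k) ≫ G.graph.τ i k = y ≫ G.graph.τ j k := by
    rw [Category.assoc, μ_τ, pullback.lift_fst_assoc]
  have h1 := G.lift_μ (f := f ≫ g) (g := h) (x := pullback.lift y x hyx ≫ G.μ i j k) (y := z)
    (by rw [e2, hzy]) (by rw [e1, G.lift_μ hyx hx hy]) (by rw [e2]; exact hz)
  have h2 := G.lift_μ (f := f) (g := g ≫ h) (x := x) (y := pullback.lift z y hzy ≫ G.μ j k l)
    (by rw [Category.assoc, μ_σ, pullback.lift_snd_assoc, hyx]) hx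
    (by rw [← hyx, G.lift_μ hzy (by rw [hyx]; exact hy) hz])
  rw [h1, h2, e1, Category.assoc f]

/-- The localised form of `lift_μ_assoc`: only the restrictions to `N` have to lie on sections, so
it applies in each chart. -/
theorem comp_lift_μ_assoc {x : T ⟶ G.graph.arr i j} {y : T ⟶ G.graph.arr j k}
    {z : T ⟶ G.graph.arr k l} {f : i ⟶ j} {g : j ⟶ k} {h : k ⟶ l} (N : T ⟶ T)
    (hyx : y ≫ G.graph.σ j k = x ≫ G.graph.τ i j) (hzy : z ≫ G.graph.σ k l = y ≫ G.graph.τ j k)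
    (hx : N ≫ x = (N ≫ x ≫ G.graph.σ i j) ≫ G.s f)
    (hy : N ≫ y = (N ≫ y ≫ G.graph.σ j k) ≫ G.s g)
    (hz : N ≫ z = (N ≫ z ≫ G.graph.σ k l) ≫ G.s h) :
    N ≫ pullback.lift z (pullback.lift y x hyx ≫ G.μ i j k)
        (by rw [Category.assoc, μ_τ, pullback.lift_fst_assoc, hzy]) ≫ G.μ i k l =
      N ≫ pullback.lift (pullback.lift z y hzy ≫ G.μ j k l) x
        (by rw [Category.assoc, μ_σ, pullback.lift_snd_assoc, hyx]) ≫ G.μ i j l := by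
  have key := G.lift_μ_assoc (x := N ≫ x) (y := N ≫ y) (z := N ≫ z)
    (by rw [Category.assoc, hyx, Category.assoc]) (by rw [Category.assoc, hzy, Category.assoc])
    (by rw [Category.assoc N]; exact hx) (by rw [Category.assoc N, ← hyx]; exact hy)
    (by rw [Category.assoc N, ← hzy]; exact hz)
  have e : ∀ (i j k : P.cat) (y : T ⟶ G.graph.arr j k) (x : T ⟶ G.graph.arr i j)
      (h : y ≫ G.graph.σ j k = x ≫ G.graph.τ i j),
      pullback.lift (N ≫ y) (N ≫ x) (by rw [Category.assoc, h, Category.assoc]) ≫ G.μ i j k =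
        N ≫ pullback.lift y x h ≫ G.μ i j k := fun i j k y x h => by
    refine Eq.trans ?_ (Category.assoc _ _ _)
    rw [comp_pullback_lift]
  simp only [e _ _ _ _ _ hyx, e _ _ _ _ _ hzy] at key
  rw [e, e] at key
  exact key

/-- The partite structure of an internalisation. -/
noncomputable def str : PartiteStr P.P.obj where
  graph := G.graph
  η i := G.s (𝟙 i)
  η_σ := G.s_one_σ
  η_τ := G.s_one_τ
  μ := G.μ
  μ_σ := G.μ_σ
  μ_τ := G.μ_τ
  unit_right i j := (G.isGlueing i j).hom_ext fun f => by
    have e : (G.s f ≫ G.graph.σ i j ≫ G.s (𝟙 i)) ≫ G.graph.σ i i = rest (G.s f) := by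
      rw [Category.assoc, Category.assoc, s_one_σ, Category.comp_id, s_comp_σ]
    rw [← Category.assoc, comp_pullback_lift, G.lift_μ (f := 𝟙 i) (g := f), e, Category.id_comp,
      rest_comp_self, Category.comp_id]
    · rw [e, ← s_comp_σ, Category.assoc]
    · have e' : (G.s f ≫ G.graph.σ i j ≫ G.s (𝟙 i)) ≫ G.graph.τ i i = rest (G.s f) := by
        rw [Category.assoc, Category.assoc, s_one_τ, Category.comp_id, s_comp_σ]
      rw [Category.comp_id, e', rest_comp_self]
  unit_left i j := (G.isGlueing i j).hom_ext fun f => by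
    rw [← Category.assoc, comp_pullback_lift, G.lift_μ (f := f) (g := 𝟙 j), Category.comp_id,
      s_comp_σ, Category.comp_id, rest_comp_self]
    · rw [Category.comp_id, s_comp_σ, rest_comp_self]
    · rw [Category.comp_id, Category.assoc]
  assoc i j k l := by
    intro R z yx
    have hyx : (yx ≫ pullback.fst _ _) ≫ G.graph.σ j k =
        (yx ≫ pullback.snd _ _) ≫ G.graph.τ i j := by
      rw [Category.assoc, pullback.condition, Category.assoc]
    have hzy : z ≫ G.graph.σ k l = (yx ≫ pullback.fst _ _) ≫ G.graph.τ j k := by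
      rw [Category.assoc]; exact pullback.condition
    have el : pullback.lift (yx ≫ pullback.fst _ _) (yx ≫ pullback.snd _ _) hyx = yx := by
      apply pullback.hom_ext
      · rw [pullback.lift_fst]
      · rw [pullback.lift_snd]
    -- The triple is restricted to a region where each of its three arrows lies in a chart.
    refine (G.isGlueing k l).ext_elem_total z fun h => ?_
    refine G.pair_ext (yx ≫ pullback.snd _ _) (yx ≫ pullback.fst _ _) fun n f g hf hg => ?_
    have hh : (n ≫ rest (z ≫ G.q h)) ≫ rest (z ≫ G.q h) = n ≫ rest (z ≫ G.q h) := by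
      rw [Category.assoc, rest_idem]
    obtain ⟨x1, -, -⟩ := G.comp_eq_of_absorb (absorb_of_absorb hf (z ≫ G.q h))
    obtain ⟨y1, -, -⟩ := G.comp_eq_of_absorb (absorb_of_absorb hg (z ≫ G.q h))
    obtain ⟨z1, -, -⟩ := G.comp_eq_of_absorb hh
    have key := G.comp_lift_μ_assoc _ hyx hzy x1 y1 z1
    simp only [el] at key
    simpa only [Category.assoc] using key

/-- The internalisation with given source and target maps. -/
noncomputable def internalisation : Internalisation P where
  str := G.str
  q := G.q
  s := G.s
  isGlueing := G.isGlueing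
  s_τ := G.s_τ
  η_eq _ := rfl
  s_μ {i j k} f g := by
    have hr : rest (P.P.map f ≫ G.s g) = rest (G.s (f ≫ g)) := by
      rw [← rest_comp_rest, G.rest_s, G.rest_s, Functor.map_comp, rest_comp_rest]
    have e1 : G.s f ≫ rest (G.graph.τ i j ≫ G.s g) = rest (G.s (f ≫ g)) ≫ G.s f := by
      rw [comp_rest, ← Category.assoc, G.s_τ, hr]
    have e2 : rest (G.s (f ≫ g)) ≫ rest (G.s f) = rest (G.s (f ≫ g)) := by
      rw [G.rest_s, G.rest_s, Functor.map_comp, rest_comp_comp]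
    have e3 : (G.s f ≫ rest (G.graph.τ i j ≫ G.s g)) ≫ G.graph.σ i j = rest (G.s (f ≫ g)) := by
      rw [e1, Category.assoc, s_comp_σ, e2]
    have e4 : (G.graph.τ i j ≫ G.s g) ≫ G.graph.σ j k =
        rest (G.graph.τ i j ≫ G.s g) ≫ G.graph.τ i j := by
      rw [Category.assoc, s_comp_σ, comp_rest]
    change G.s f ≫ pullback.lift (G.graph.τ i j ≫ G.s g) (rest (G.graph.τ i j ≫ G.s g)) e4 ≫
      G.μ i j k = _
    rw [← Category.assoc, comp_pullback_lift, G.lift_μ (f := f) (g := g), e3, rest_comp_self]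
    · rw [e3, e1]
    · rw [e1, Category.assoc, ← Category.assoc (G.s f), G.s_τ, Category.assoc, ← Category.assoc (G.s f),
        G.s_τ, ← hr, rest_comp_self]

end PreInternalisation

end RestrictionTheory

/-! ### Inverses in an internalisation, and the universal property of the unit. -/

namespace RestrictionTheory

open RestrictionCategory PartiteCategory

section OverHom

variable {C : Type u} [Category.{v} C] [RestrictionCategory C]

theorem RCatOver.Hom.ext_heq {P Q : RCatOver.{w} C} {F G : RCatOver.Hom P Q}
    (ho : ∀ X, F.functor.obj X = G.functor.obj X)
    (hm : ∀ {X Y : P.cat} (f : X ⟶ Y), HEq (F.functor.map f) (G.functor.map f))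
    (hα : ∀ X, HEq (F.α.app X) (G.α.app X)) : F = G := by
  obtain ⟨F, Fr, ⟨α, αn⟩, αt⟩ := F
  obtain ⟨G, Gr, ⟨β, βn⟩, βt⟩ := G
  obtain rfl : F = G := CategoryTheory.Functor.hext ho (fun X Y f => hm f)
  obtain rfl : α = β := funext fun X => eq_of_heq (hα X)
  rfl

/-- Naturality at `e`, with total components, says that the bisection assigned to `e` has the domain
of `α ≫ P e`. Restricting to this domain is therefore precomposition by `e` before applying the
functor. Consequently maps that agree on `e` have images that agree over `P e`. -/
theorem RCatOver.Hom.rest_α_comp_map {A : PartiteCategory.{w} C} {P : RCatOver.{w} C}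
    (M : RCatOver.Hom P (phiGOver A)) {i j : P.cat} {e : i ⟶ i} (he : rest e = e) (f : i ⟶ j) :
    rest (M.α.app i ≫ P.P.map e) ≫ (M.functor.map f).1.1 = (M.functor.map (e ≫ f)).1.1 := by
  have hr : rest (M.α.app i ≫ P.P.map e) = rest (M.functor.map e).1.1 := by
    rw [← M.α.naturality e]
    have := M.α_total i
    refine (rest_comp_total _ _).trans ?_
    exact rest_comp_total (M.functor.map e).1.1 (A.τ _ _)
  rw [hr, M.functor.map_comp]
  have e1 : M.functor.map e = rest (M.functor.map e) := by rw [← M.map_rest, he]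
  conv_rhs => rw [e1]
  exact (PhiHom.restr_comp_val (M.functor.map e).1 (M.functor.map f).1).symm

end OverHom

namespace Internalisation

variable {C : Type u} [Category.{v} C] [RestrictionCategory C] [JoinRestrictionCategory C]
  {P : RCatOver.{w} C} (J : Internalisation P)

theorem s_comp_σ {i j : P.cat} (f : i ⟶ j) : J.s f ≫ J.str.graph.σ i j = rest (J.s f) :=
  (J.isGlueing i j).s_comp_p f

theorem sHom_comp {i j k : P.cat} (f : i ⟶ j) (g : j ⟶ k) :
    (J.sHom (f ≫ g) : PhiHom (⟨i⟩ : PhiCat J.toPartite) ⟨k⟩) =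
      PhiHom.comp (J.sHom f) (J.sHom g) := Subtype.ext (J.s_μ f g).symm

theorem s_rest_comp {i j k : P.cat} (f : i ⟶ j) (g : i ⟶ k) :
    J.s (rest f ≫ g) = rest (J.s f) ≫ J.s g := by
  have e : J.sHom (rest f) = PhiHom.restr (J.sHom f) := Subtype.ext (J.s_rest f)
  have h := congrArg Subtype.val (J.sHom_comp (rest f) g)
  rw [e] at h
  exact h.trans (PhiHom.restr_comp_val (J.sHom f) (J.sHom g))

theorem s_mono {i j : P.cat} {f g : i ⟶ j} (h : f ≤ g) : J.s f ≤ J.s g := by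
  have := J.s_rest_comp f g
  rw [← (le_def _ _).1 h] at this
  exact this

/-- The inverse of the arrow on `s f` at a point is the arrow on the section of the partial inverse
of `f` at its target. Inversion therefore descends from `P f ≫ s (star f)`. -/
theorem isGroupoid (hP : IsInverseCategory P.cat) : J.toPartite.IsGroupoid := by
  choose star hstar using fun (i j : P.cat) (f : i ⟶ j) => isPartialIso_of_isInverseCategory hP f
  have hinv : ∀ {i j : P.cat} (f : i ⟶ j), P.P.map f ≫ P.P.map (star i j f) = rest (J.s f) :=
    fun f => by rw [← Functor.map_comp, (hstar _ _ f).1, P.map_rest, J.rest_s]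
  have hr : ∀ {i j : P.cat} (f : i ⟶ j), P.P.map f ≫ rest (J.s (star i j f)) = P.P.map f :=
    fun f => by rw [J.rest_s, ← P.map_rest, ← Functor.map_comp, (hstar _ _ f).comp_rest]
  have hι : ∀ i j : P.cat, ∃ d : J.str.graph.arr i j ⟶ J.str.graph.arr j i, IsTotal d ∧
      ∀ f : i ⟶ j, J.s f ≫ d = P.P.map f ≫ J.s (star i j f) := fun i j =>
    (J.isGlueing i j).exists_desc (fun f => P.P.map f ≫ J.s (star i j f))
      (fun f => by rw [← rest_comp_rest, hr, J.rest_s])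
      (fun f g => valEq_comp_ext fun e he hf hg hfg => by
        -- Partial inversion is monotone, so over `e` the value can be computed from `e ≫ f` alone,
        -- and hence is the same for `f` and `g`.
        have key : ∀ f : i ⟶ j, e ≫ rest f = e →
            P.P.map e ≫ P.P.map f ≫ J.s (star i j f) =
              P.P.map (e ≫ f) ≫ J.s (star i j (e ≫ f)) := fun f hf => by
          have hle : e ≫ f ≤ f := by
            have := rest_comp_le e f
            rwa [he] at this
          have hs := J.s_mono ((hstar i j (e ≫ f)).mono (hstar i j f) hle)
          rw [← Category.assoc, ← Functor.map_comp, ← hr (e ≫ f), Category.assoc,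
            ← (le_def _ _).1 hs]
          rw [hr]
        rw [key f hf, key g hg, hfg])
  choose ι ιt hι using hι
  have hstar2 : ∀ i j (f : i ⟶ j), star j i (star i j f) = f := fun i j f =>
    (hstar j i (star i j f)).unique (isPartialInverse_symm (hstar i j f))
  have hστ : ∀ i j, ι i j ≫ J.str.graph.σ j i = J.str.graph.τ i j := fun i j =>
    (J.isGlueing i j).hom_ext fun f => by
      rw [← Category.assoc, hι, Category.assoc, J.s_comp_σ, hr, J.s_τ]
  refine ⟨ι, ιt, fun i j => (J.isGlueing j i).hom_ext fun f => ?_, hστ, fun i j =>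
    (J.isGlueing i j).hom_ext fun f => ?_⟩
  · rw [← Category.assoc, hι, Category.assoc, hι, hstar2, ← Category.assoc, hinv, rest_comp_self,
      Category.comp_id]
  · have e1 : (J.s f ≫ ι i j) ≫ J.toPartite.σ j i =
        (J.s f ≫ 𝟙 _) ≫ J.toPartite.τ i j := by
      rw [Category.assoc]
      exact (congrArg (fun z => J.s f ≫ z) (hστ i j)).trans (by rw [Category.comp_id])
    have e2 : J.s f ≫ ι i j = ((J.s f ≫ 𝟙 _) ≫ J.toPartite.τ i j) ≫ J.s (star i j f) := by
      rw [hι, Category.comp_id]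
      exact congrArg (fun z => z ≫ J.s (star i j f)) (J.s_τ f).symm
    have key := mul_section (J.sHom f) (J.sHom (star i j f)) (rest (J.s f)) e1
      ((Category.comp_id _).trans (rest_comp_self _).symm) e2
    rw [← sHom_comp] at key
    -- The composite `f ≫ star f` is the idempotent `rest f`, whose section is a restriction of the
    -- identity section.
    have e3 : rest (J.s f) ≫ J.s (f ≫ star i j f) =
        J.s f ≫ J.str.graph.σ i j ≫ J.str.η i := by
      rw [(hstar i j f).1, J.s_rest, ← Category.assoc, rest_idem, ← Category.assoc,
        J.s_comp_σ]
    refine Eq.trans ?_ (key.trans e3)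
    refine (Category.assoc _ _ _).symm.trans ?_
    rw [comp_pullback_lift]
    rfl

/-- The section cover of an internalisation. -/
def sectionCover : SectionCover J.toPartite where
  H i j := (show P.cat from i) ⟶ (show P.cat from j)
  q f := J.q f
  s f := J.s f
  isGlueing i j :=
    { total := (J.isGlueing i j).total
      isPartialInverse := (J.isGlueing i j).isPartialInverse
      isLUB := (J.isGlueing i j).isLUB
      induces := fun _ _ => rfl }
  one i := 𝟙 (show P.cat from i)
  s_one i := (J.η_eq i).symm
  comp f g := f ≫ g
  s_comp f g := J.s_μ f g

/-- The composite with the unit records the values of the cofunctor on all sections `s f`, and these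
determine it. -/
theorem unit_comp_injective (hP : IsInverseCategory P.cat) (hJ : J.toPartite.IsGroupoid)
    {A : PartiteGroupoid.{w} C} (F F' : (⟨J.toPartite, hJ⟩ : PartiteGroupoid.{w} C) ⟶ A)
    (h : J.unit (P := ⟨P, hP⟩) hJ ≫ (PhiG C).map F = J.unit (P := ⟨P, hP⟩) hJ ≫ (PhiG C).map F') :
    F = F' := by
  obtain ⟨F⟩ := F
  obtain ⟨F'⟩ := F'
  have hidx : ∀ i, F.idx i = F'.idx i := fun i =>
    congrArg (fun M : (⟨P, hP⟩ : ICatOver.{w} C) ⟶ (PhiG C).obj A => (M.hom.functor.obj i).obj.idx) h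
  obtain ⟨idx, obj, arr, hs, ht, hu, hc⟩ := F
  obtain ⟨idx', obj', arr', hs', ht', hu', hc'⟩ := F'
  -- The remaining components have comparable types only after the two maps on indices are
  -- identified.
  obtain rfl : idx = idx' := funext hidx
  congr 1
  refine J.sectionCover.cofunctor_ext (fun i => ?_) (fun i j f => ?_)
  · have e : HEq _ _ := congr_arg_heq
      (fun M : (⟨P, hP⟩ : ICatOver.{w} C) ⟶ (PhiG C).obj A => M.hom.α.app i) h
    have e' := eq_of_heq e
    exact (Category.comp_id _).symm.trans (e'.trans (Category.comp_id _))
  · have e : HEq _ _ := congr_arg_heq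
      (fun M : (⟨P, hP⟩ : ICatOver.{w} C) ⟶ (PhiG C).obj A => (M.hom.functor.map f).1) h
    exact congrArg Subtype.val (eq_of_heq e)

/-- The data of a cofunctor from an internalisation of `P` obtained from a map out of `P`. -/
noncomputable def cofunctorData {A : PartiteCategory.{w} C} (M : RCatOver.Hom P (phiGOver A)) :
    J.sectionCover.CofunctorData A where
  idx i := (M.functor.obj i).obj.idx
  obj i := M.α.app i
  obj_total := M.α_total
  t {i j} f := (M.functor.map (show (show P.cat from i) ⟶ (show P.cat from j) from f)).1
  nat {i j} f := (M.α.naturality f).trans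
    (congrArg (fun z => M.α.app i ≫ z) (J.s_τ f).symm)
  t_one i := congrArg (fun z : M.functor.obj i ⟶ M.functor.obj i => z.1.1) (M.functor.map_id i)
  t_comp f g := congrArg (fun z => z.1) (M.functor.map_comp f g)
  agree {i j} f g := by
    change rest (M.α.app i ≫ J.s f ≫ J.q g) ≫ (M.functor.map f).1.1 =
      rest (M.α.app i ≫ J.s f ≫ J.q g) ≫ (M.functor.map g).1.1
    have e0 : J.s f ≫ J.q g = valEq P f g := (J.isGlueing i j).induces f g
    rw [e0]
    -- The pulled-back equality locus is the join of the domains of `α ≫ P e` over the idempotents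
    -- `e` on which `f` and `g` agree. On each of these `rest_α_comp_map` applies.
    have h0 := (isLUB_iff.1 (isLUB_precomp (M.α.app i) (isLUB_valEq P f g))).2
    have h1 := isLUB_postcomp h0 (M.functor.map f).1.1
    have h2 := isLUB_postcomp h0 (M.functor.map g).1.1
    rw [Set.image_image, Set.image_image] at h1 h2
    have e1 : (fun x => rest (M.α.app i ≫ x) ≫ (M.functor.map f).1.1) '' valEqSet P f g =
        (fun x => rest (M.α.app i ≫ x) ≫ (M.functor.map g).1.1) '' valEqSet P f g := by
      refine Set.image_congr fun x hx => ?_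
      obtain ⟨e, he, -, -, hfg, rfl⟩ := exists_of_mem_valEqSet hx
      exact (RCatOver.Hom.rest_α_comp_map M he f).trans
        ((congrArg (fun z => (M.functor.map z).1.1) hfg).trans (RCatOver.Hom.rest_α_comp_map M he g).symm)
    rw [e1] at h1
    exact h1.unique h2

theorem unit_comp_surjective (hP : IsInverseCategory P.cat) (hJ : J.toPartite.IsGroupoid)
    {A : PartiteGroupoid.{w} C} (M : (⟨P, hP⟩ : ICatOver.{w} C) ⟶ (PhiG C).obj A) :
    ∃ F : (⟨J.toPartite, hJ⟩ : PartiteGroupoid.{w} C) ⟶ A,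
      J.unit (P := ⟨P, hP⟩) hJ ≫ (PhiG C).map F = M := by
  refine ⟨ObjectProperty.homMk (J.cofunctorData M.hom).cofunctor, ObjectProperty.hom_ext _ ?_⟩
  refine RCatOver.Hom.ext_heq (fun _ => rfl) (fun {i j} f => heq_of_eq ?_)
    (fun i => heq_of_eq (Category.comp_id _))
  refine WideSubcategory.hom_ext _ ?_
  exact (J.cofunctorData M.hom).phiMapHom_cofunctor f

/-- Cofunctors out of an internalisation of `P` correspond to maps out of `P`. -/
noncomputable def homEquiv (hP : IsInverseCategory P.cat) (hJ : J.toPartite.IsGroupoid)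
    (A : PartiteGroupoid.{w} C) :
    ((⟨J.toPartite, hJ⟩ : PartiteGroupoid.{w} C) ⟶ A) ≃
      ((⟨P, hP⟩ : ICatOver.{w} C) ⟶ (PhiG C).obj A) :=
  Equiv.ofBijective (fun F => J.unit (P := ⟨P, hP⟩) hJ ≫ (PhiG C).map F)
    ⟨J.unit_comp_injective hP hJ, J.unit_comp_surjective hP hJ⟩

end Internalisation

end RestrictionTheory

/-! ### Joins and hyperconnectedness of categories of partial bisections. -/

namespace RestrictionTheory

open RestrictionCategory PartiteCategory

section PhiG

variable {C : Type u} [Category.{v} C] [RestrictionCategory C] {A : PartiteCategory.{w} C}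
  {i j k : PhiGCat A}

/-- The underlying map of a partial bisection. -/
abbrev bisectionVal (s : i ⟶ j) : A.obj i.obj.idx ⟶ A.arr i.obj.idx j.obj.idx := s.hom.1

theorem bisectionVal_ext {s t : i ⟶ j} (h : bisectionVal s = bisectionVal t) : s = t :=
  WideSubcategory.hom_ext _ (Subtype.ext h)

theorem bisectionVal_σ (s : i ⟶ j) :
    bisectionVal s ≫ A.σ i.obj.idx j.obj.idx = rest (bisectionVal s) := PhiHom.section_eq s.hom

theorem bisectionVal_rest (s : i ⟶ j) :
    bisectionVal (rest s) = rest (bisectionVal s) ≫ A.η i.obj.idx := rfl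

theorem bisectionVal_rest_comp (s : i ⟶ j) (t : i ⟶ k) :
    bisectionVal (rest s ≫ t) = rest (bisectionVal s) ≫ bisectionVal t :=
  PhiHom.restr_comp_val s.hom t.hom

theorem rest_bisectionVal_comp (s : i ⟶ j) (t : j ⟶ k) :
    rest (bisectionVal (s ≫ t)) =
      rest ((bisectionVal s ≫ A.τ i.obj.idx j.obj.idx) ≫ bisectionVal t) :=
  PhiHom.rest_comp_val s.hom t.hom

theorem bisectionVal_le_iff {s t : i ⟶ j} : bisectionVal s ≤ bisectionVal t ↔ s ≤ t := by
  rw [le_def, le_def, ← bisectionVal_rest_comp]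
  exact ⟨fun h => bisectionVal_ext h, fun h => congrArg bisectionVal h⟩

theorem bisectionVal_compatible_iff {s t : i ⟶ j} :
    Compatible (bisectionVal s) (bisectionVal t) ↔ Compatible s t := by
  rw [Compatible, Compatible, ← bisectionVal_rest_comp, ← bisectionVal_rest_comp]
  exact ⟨fun h => bisectionVal_ext h, fun h => congrArg bisectionVal h⟩

theorem isPartialInverse_bisectionVal_τ {s : i ⟶ j} {t : j ⟶ i} (h : IsPartialInverse s t) :
    IsPartialInverse (bisectionVal s ≫ A.τ i.obj.idx j.obj.idx)
      (bisectionVal t ≫ A.τ j.obj.idx i.obj.idx) := by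
  have aux : ∀ {i j : PhiGCat A} {s : i ⟶ j} {t : j ⟶ i}, IsPartialInverse s t →
      (phiGOver A).P.map s ≫ (phiGOver A).P.map t = rest ((phiGOver A).P.map s) := by
    intro i j s t h
    exact ((phiGOver A).P.map_comp s t).symm.trans
      ((congrArg (fun z => (phiGOver A).P.map z) h.1).trans ((phiGOver A).map_rest s))
  exact ⟨aux h, aux (isPartialInverse_symm h)⟩

theorem isLUB_of_bisectionVal {S : Set (i ⟶ j)} {f : i ⟶ j}
    (h : IsLUB (bisectionVal '' S) (bisectionVal f)) : IsLUB S f := by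
  refine ⟨fun s hs => bisectionVal_le_iff.1 (h.1 ⟨s, hs, rfl⟩), fun u hu => ?_⟩
  refine bisectionVal_le_iff.1 (h.2 ?_)
  rintro _ ⟨s, hs, rfl⟩
  exact bisectionVal_le_iff.2 (hu hs)

theorem bisectionVal_eq_of_idem {e : i ⟶ i} (he : rest e = e) :
    bisectionVal e = (bisectionVal e ≫ A.τ _ _) ≫ A.η _ := by
  conv_rhs => rw [← he, bisectionVal_rest, Category.assoc _ (A.η _), A.η_τ, Category.comp_id]
  exact congrArg bisectionVal he.symm

theorem exists_bisection_of_idem {x : A.obj i.obj.idx ⟶ A.obj i.obj.idx} (hx : rest x = x) :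
    ∃ e : i ⟶ i, rest e = e ∧ bisectionVal e ≫ A.τ _ _ = x := by
  have hr : rest (x ≫ A.η i.obj.idx) = x := by rw [rest_comp_total, hx]
  have hη : (x ≫ A.η i.obj.idx) ≫ A.τ _ _ = x := by
    rw [Category.assoc, A.η_τ, Category.comp_id]
  refine ⟨⟨⟨x ≫ A.η i.obj.idx, ?_⟩, ?_⟩, bisectionVal_ext ?_, hη⟩
  · change _ = rest _
    rw [hr, Category.assoc, A.η_σ, Category.comp_id]
  · change IsPartialIso ((x ≫ A.η i.obj.idx) ≫ A.τ _ _)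
    rw [hη, ← hx]
    exact isPartialIso_rest _
  · rw [bisectionVal_rest]
    exact congrArg (fun z => z ≫ A.η i.obj.idx) hr

/-- The inverse to projection sends an idempotent `x` to `x ≫ A.η`. No invertibility of arrows is
used. -/
theorem isHyperconnected_phiG (A : PartiteCategory.{w} C) : (phiGOver A).IsHyperconnected := by
  intro i
  constructor
  · rintro ⟨e, he⟩ ⟨d, hd⟩ hed
    have h := congrArg Subtype.val hed
    exact Subtype.ext (bisectionVal_ext ((bisectionVal_eq_of_idem he).trans
      ((congrArg (fun z => z ≫ A.η _) h).trans (bisectionVal_eq_of_idem hd).symm)))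
  · rintro ⟨x, hx⟩
    obtain ⟨e, he, hex⟩ := exists_bisection_of_idem (A := A) (i := i) hx
    exact ⟨⟨e, he⟩, Subtype.ext hex⟩

variable [JoinRestrictionCategory C]

/-- The join is formed in `C`. It is a partial section because postcomposition preserves joins, and
its target is a partial isomorphism because bicompatibility lets the partial inverses be joined too.
The conclusion concerns joins in `C`, which also makes precomposition tractable. -/
theorem exists_isLUB_bisection (hA : A.IsGroupoid) (S : Set (i ⟶ j))
    (hS : ∀ s ∈ S, ∀ t ∈ S, Bicompatible s t) :
    ∃ f : i ⟶ j, IsLUB (bisectionVal '' S) (bisectionVal f) := by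
  obtain ⟨f, hf⟩ := JoinRestrictionCategory.exists_join (bisectionVal '' S) (by
    rintro _ ⟨s, hs, rfl⟩ _ ⟨t, ht, rfl⟩
    exact bisectionVal_compatible_iff.2 (hS s hs t ht).1)
  have hσ : IsPartialSection (A.σ i.obj.idx j.obj.idx) f := by
    have h1 := isLUB_postcomp hf (A.σ i.obj.idx j.obj.idx)
    have h2 := (isLUB_iff.1 hf).2
    rw [Set.image_image] at h1 h2
    simp only [bisectionVal_σ] at h1
    exact h1.unique h2
  have hτ : IsPartialIso (f ≫ A.τ i.obj.idx j.obj.idx) := by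
    have h1 := isLUB_postcomp hf (A.τ i.obj.idx j.obj.idx)
    rw [Set.image_image] at h1
    obtain ⟨g, hg⟩ := JoinRestrictionCategory.exists_join
      {t | ∃ s ∈ S, IsPartialInverse (bisectionVal s ≫ A.τ i.obj.idx j.obj.idx) t} (by
        rintro t ⟨s, hs, hst⟩ t' ⟨s', hs', hst'⟩
        obtain ⟨-, r, r', hr, hr', hrr⟩ := hS s hs s' hs'
        obtain rfl := hst.unique (isPartialInverse_bisectionVal_τ hr)
        obtain rfl := hst'.unique (isPartialInverse_bisectionVal_τ hr')
        have := bisectionVal_compatible_iff.2 hrr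
        rw [Compatible] at this
        rw [Compatible, rest_comp_total, rest_comp_total, ← Category.assoc, this, Category.assoc])
    refine ⟨g, isPartialInverse_of_isLUB h1 hg ?_ ?_⟩
    · rintro _ ⟨s, hs, rfl⟩
      obtain ⟨t, ht⟩ := isPartialIso_of_isInverseCategory (isInverseCategory_phiG hA) s
      exact ⟨_, ⟨s, hs, isPartialInverse_bisectionVal_τ ht⟩, isPartialInverse_bisectionVal_τ ht⟩
    · rintro t ⟨s, hs, hst⟩
      exact ⟨_, ⟨s, hs, rfl⟩, hst⟩
  exact ⟨⟨⟨f, hσ⟩, hτ⟩, hf⟩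

theorem isJoinInverseCategory_phiG (hA : A.IsGroupoid) : IsJoinInverseCategory (PhiGCat A) where
  toIsInverseCategory := isInverseCategory_phiG hA
  exists_join S hS := by
    obtain ⟨f, hf⟩ := exists_isLUB_bisection hA S hS
    exact ⟨f, isLUB_of_bisectionVal hf⟩
  precomp_join {i' i j} g S hS f hf := by
    obtain ⟨f', hf'⟩ := exists_isLUB_bisection hA S hS
    -- Any join of bisections is the one computed in `C`, so it suffices to compare domains there.
    obtain rfl := hf.unique (isLUB_of_bisectionVal hf')
    apply isLUB_of_bisectionVal
    rw [isLUB_iff]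
    constructor
    · rintro _ ⟨_, ⟨s, hs, rfl⟩, rfl⟩
      exact bisectionVal_le_iff.2 (precomp_le g (hf.1 hs))
    · have h1 := (isLUB_iff.1
        (isLUB_precomp (bisectionVal g ≫ A.τ i'.obj.idx i.obj.idx) hf')).2
      rw [Set.image_image, Set.image_image] at h1
      rw [Set.image_image, Set.image_image, rest_bisectionVal_comp]
      simp only [rest_bisectionVal_comp]
      exact h1

theorem isJoinHyperconnected_phiG (A : PartiteGroupoid.{w} C) :
    isJoinHyperconnected C ((PhiG C).obj A) :=
  ⟨isJoinInverseCategory_phiG A.property, isHyperconnected_phiG A.obj⟩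

end PhiG

end RestrictionTheory

/-! ### When the unit is invertible. -/

namespace RestrictionTheory

open RestrictionCategory PartiteCategory

section Transfer

variable {C : Type u} [Category.{v} C] [RestrictionCategory C] {P Q : RCatOver.{w} C}

theorem RCatOver.map_le_map (P : RCatOver.{w} C) {i j : P.cat} {f g : i ⟶ j} (h : f ≤ g) :
    P.P.map f ≤ P.P.map g := by
  have e := congrArg (fun z => P.P.map z) ((le_def _ _).1 h)
  rw [Functor.map_comp, P.map_rest] at e
  exact e

/-- In an inverse category, maps with a common upper bound are bicompatible. -/
theorem bicompatible_of_le {A : Type u} [Category.{v} A] [RestrictionCategory A]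
    (hA : IsInverseCategory A) {X Y : A} {s t h : X ⟶ Y} (hs : s ≤ h) (ht : t ≤ h) :
    Bicompatible s t := by
  obtain ⟨s', hs'⟩ := isPartialIso_of_isInverseCategory hA s
  obtain ⟨t', ht'⟩ := isPartialIso_of_isInverseCategory hA t
  obtain ⟨h', hh'⟩ := isPartialIso_of_isInverseCategory hA h
  exact ⟨compatible_of_le hs ht, s', t', hs', ht',
    compatible_of_le (hs'.mono hh' hs) (ht'.mono hh' ht)⟩

variable (F : RCatOver.Hom P Q)

theorem RCatOver.Hom.map_compatible {i j : P.cat} {f g : i ⟶ j} (h : Compatible f g) :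
    Compatible (F.functor.map f) (F.functor.map g) := by
  rw [Compatible] at *
  rw [← F.map_rest, ← F.map_rest, ← Functor.map_comp, h, Functor.map_comp]

theorem RCatOver.Hom.map_bicompatible {i j : P.cat} {f g : i ⟶ j} (h : Bicompatible f g) :
    Bicompatible (F.functor.map f) (F.functor.map g) := by
  obtain ⟨h, s, t, hs, ht, hst⟩ := h
  exact ⟨F.map_compatible h, _, _, isPartialInverse_map F hs, isPartialInverse_map F ht,
    F.map_compatible hst⟩

section Faithful

variable {F} (hF : ∀ i j : P.cat, Function.Injective (fun f : i ⟶ j => F.functor.map f))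
include hF

theorem RCatOver.Hom.map_le_iff {i j : P.cat} {f g : i ⟶ j} :
    F.functor.map f ≤ F.functor.map g ↔ f ≤ g := by
  rw [le_def, le_def, ← F.map_rest, ← Functor.map_comp]
  exact (hF i j).eq_iff

theorem RCatOver.Hom.map_compatible_iff {i j : P.cat} {f g : i ⟶ j} :
    Compatible (F.functor.map f) (F.functor.map g) ↔ Compatible f g := by
  rw [Compatible, Compatible, ← F.map_rest, ← F.map_rest, ← Functor.map_comp, ← Functor.map_comp]
  exact (hF i j).eq_iff

/-- Maps whose images have a common upper bound are bicompatible. -/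
theorem RCatOver.Hom.bicompatible_of_map_le (hP : IsInverseCategory P.cat)
    (hQ : IsInverseCategory Q.cat) {i j : P.cat} {f g : i ⟶ j}
    {h : F.functor.obj i ⟶ F.functor.obj j} (hf : F.functor.map f ≤ h)
    (hg : F.functor.map g ≤ h) : Bicompatible f g := by
  obtain ⟨s, hs⟩ := isPartialIso_of_isInverseCategory hP f
  obtain ⟨t, ht⟩ := isPartialIso_of_isInverseCategory hP g
  obtain ⟨h', hh'⟩ := isPartialIso_of_isInverseCategory hQ h
  refine ⟨(RCatOver.Hom.map_compatible_iff hF).1 (compatible_of_le hf hg), s, t, hs, ht,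
    (RCatOver.Hom.map_compatible_iff hF).1 (compatible_of_le
      ((isPartialInverse_map F hs).mono hh' hf) ((isPartialInverse_map F ht).mono hh' hg))⟩

end Faithful

theorem RCatOver.Hom.isLUB_map_iff
    {F : RCatOver.Hom P Q} (hF : ∀ i j : P.cat, Function.Bijective (fun f : i ⟶ j => F.functor.map f))
    {i j : P.cat} {S : Set (i ⟶ j)} {f : i ⟶ j} :
    IsLUB ((fun f => F.functor.map f) '' S) (F.functor.map f) ↔ IsLUB S f := by
  have hle := fun {i j : P.cat} {f g : i ⟶ j} =>
    RCatOver.Hom.map_le_iff (fun i j => (hF i j).1) (f := f) (g := g)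
  constructor
  · refine fun h => ⟨fun s hs => hle.1 (h.1 ⟨s, hs, rfl⟩), fun u hu => hle.1 (h.2 ?_)⟩
    rintro _ ⟨s, hs, rfl⟩
    exact hle.2 (hu hs)
  · refine fun h => ⟨?_, fun u hu => ?_⟩
    · rintro _ ⟨s, hs, rfl⟩
      exact hle.2 (h.1 hs)
    · obtain ⟨v, rfl⟩ := (hF i j).2 u
      exact hle.2 (h.2 fun s hs => hle.1 (hu ⟨s, hs, rfl⟩))

/-- A restriction functor that is bijective on hom-sets is an order isomorphism there and preserves
bicompatibility. Joins can thus be formed in the codomain and pulled back. -/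
theorem RCatOver.Hom.isJoinInverseCategory
    {F : RCatOver.Hom P Q} (hF : ∀ i j : P.cat, Function.Bijective (fun f : i ⟶ j => F.functor.map f))
    (hP : IsInverseCategory P.cat) (hQ : IsJoinInverseCategory Q.cat) :
    IsJoinInverseCategory P.cat where
  toIsInverseCategory := hP
  exists_join {i j} S hS := by
    obtain ⟨f, hf⟩ := hQ.exists_join ((fun f => F.functor.map f) '' S) (by
      rintro _ ⟨s, hs, rfl⟩ _ ⟨t, ht, rfl⟩
      exact F.map_bicompatible (hS s hs t ht))
    obtain ⟨f, rfl⟩ := (hF i j).2 f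
    exact ⟨f, (RCatOver.Hom.isLUB_map_iff hF).1 hf⟩
  precomp_join {i' i j} g S hS f hf := by
    have h := hQ.precomp_join (F.functor.map g) ((fun f => F.functor.map f) '' S) (by
      rintro _ ⟨s, hs, rfl⟩ _ ⟨t, ht, rfl⟩
      exact F.map_bicompatible (hS s hs t ht)) _ ((RCatOver.Hom.isLUB_map_iff hF).2 hf)
    refine (RCatOver.Hom.isLUB_map_iff hF).1 ?_
    rw [Set.image_image] at h ⊢
    simpa only [Functor.map_comp] using h

end Transfer

namespace Internalisation

variable {C : Type u} [Category.{v} C] [RestrictionCategory C] [JoinRestrictionCategory C]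
  {P : RCatOver.{w} C} (J : Internalisation P)

/-- The unit map of an internalisation, as a map of restriction categories over `C`. -/
noncomputable def unitHom (hP : IsInverseCategory P.cat) (hJ : J.toPartite.IsGroupoid) :
    RCatOver.Hom P (phiGOver J.toPartite) := (J.unit (P := ⟨P, hP⟩) hJ).hom

variable (hP : IsInverseCategory P.cat) (hJ : J.toPartite.IsGroupoid)

theorem bijective_of_isIso_unit (h : IsIso (J.unit (P := ⟨P, hP⟩) hJ)) (i j : P.cat) :
    Function.Bijective (fun f : i ⟶ j => (J.unitHom hP hJ).functor.map f) := by
  let G : RCatOver.Hom (phiGOver J.toPartite) P := (inv (J.unit (P := ⟨P, hP⟩) hJ)).hom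
  have h1 : (J.unitHom hP hJ).functor ⋙ G.functor = 𝟭 _ :=
    congrArg (fun M : (⟨P, hP⟩ : ICatOver.{w} C) ⟶ ⟨P, hP⟩ => M.hom.functor)
      (IsIso.hom_inv_id (J.unit (P := ⟨P, hP⟩) hJ))
  have h2 : G.functor ⋙ (J.unitHom hP hJ).functor = 𝟭 _ :=
    congrArg (fun M : (PhiG C).obj ⟨J.toPartite, hJ⟩ ⟶ (PhiG C).obj ⟨J.toPartite, hJ⟩ =>
      M.hom.functor) (IsIso.inv_hom_id (J.unit (P := ⟨P, hP⟩) hJ))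
  let E := CategoryTheory.Equivalence.mk _ _ (eqToIso h1.symm) (eqToIso h2)
  have hE : (J.unitHom hP hJ).functor.IsEquivalence := E.isEquivalence_functor
  exact ⟨fun f g hfg => (J.unitHom hP hJ).functor.map_injective hfg,
    (J.unitHom hP hJ).functor.map_surjective⟩

/-- The unit is the identity on objects with identity transformation, so the inverses on hom-sets
assemble into a strict inverse over `C`. -/
theorem isIso_unit_of_bijective (h : ∀ i j : P.cat,
    Function.Bijective (fun f : i ⟶ j => (J.unitHom hP hJ).functor.map f)) :
    IsIso (J.unit (P := ⟨P, hP⟩) hJ) := by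
  let U := J.unitHom hP hJ
  let e : ∀ i j : PhiGCat J.toPartite,
      ((show P.cat from i.obj.idx) ⟶ (show P.cat from j.obj.idx)) ≃ (i ⟶ j) :=
    fun i j => Equiv.ofBijective _ (h i.obj.idx j.obj.idx)
  have he : ∀ {i j : PhiGCat J.toPartite} (s : i ⟶ j), U.functor.map ((e i j).symm s) = s :=
    fun {i j} s => (e i j).apply_symm_apply s
  let G : PhiGCat J.toPartite ⥤ P.cat :=
    { obj := fun i => i.obj.idx
      map := fun {i j} s => (e i j).symm s
      map_id := fun i => (e i i).injective
        (((e i i).apply_symm_apply _).trans (U.functor.map_id _).symm)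
      map_comp := fun {i j k} s t => (e i k).injective
        (((e i k).apply_symm_apply _).trans (Eq.symm ((U.functor.map_comp _ _).trans
          (congrArg₂ (fun a b => a ≫ b) (he s) (he t))))) }
  let V : RCatOver.Hom (phiGOver J.toPartite) P :=
    { functor := G
      map_rest := fun {i j} s => (e i i).injective
        (((e i i).apply_symm_apply _).trans (Eq.symm ((U.map_rest _).trans
          (congrArg (fun z => rest z) (he s)))))
      α :=
        { app := fun i => 𝟙 (P.P.obj i.obj.idx)
          naturality := fun i j s => by
            have e1 : P.P.map (G.map s) = bisectionVal s ≫ J.toPartite.τ _ _ :=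
              (J.s_τ _).symm.trans
                (congrArg (fun z => bisectionVal z ≫ J.toPartite.τ _ _) (he s))
            exact (Category.comp_id _).trans (e1.trans (Category.id_comp _).symm) }
      α_total := fun _ => isTotal_id }
  refine ⟨⟨ObjectProperty.homMk V, ObjectProperty.hom_ext _ ?_, ObjectProperty.hom_ext _ ?_⟩⟩
  · exact RCatOver.Hom.ext_heq (fun _ => rfl)
      (fun {i j} f => heq_of_eq ((e ⟨⟨i⟩⟩ ⟨⟨j⟩⟩).symm_apply_apply f))
      (fun i => heq_of_eq (Category.comp_id _))
  · exact RCatOver.Hom.ext_heq (fun _ => rfl) (fun {i j} s => heq_of_eq (he s))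
      (fun i => heq_of_eq (Category.comp_id _))

theorem isJoinHyperconnected_of_bijective (h : ∀ i j : P.cat,
    Function.Bijective (fun f : i ⟶ j => (J.unitHom hP hJ).functor.map f)) :
    isJoinHyperconnected C ⟨P, hP⟩ := by
  refine ⟨RCatOver.Hom.isJoinInverseCategory h hP (isJoinInverseCategory_phiG hJ), fun i => ?_⟩
  have hval : ∀ e : i ⟶ i, bisectionVal ((J.unitHom hP hJ).functor.map e) ≫
    J.toPartite.τ i i = P.P.map e := fun e => J.s_τ e
  constructor
  · rintro ⟨e, he⟩ ⟨d, hd⟩ hed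
    refine Subtype.ext ((h i i).1 (bisectionVal_ext ?_))
    have he' : rest ((J.unitHom hP hJ).functor.map e) = (J.unitHom hP hJ).functor.map e := by
      rw [← (J.unitHom hP hJ).map_rest, he]
    have hd' : rest ((J.unitHom hP hJ).functor.map d) = (J.unitHom hP hJ).functor.map d := by
      rw [← (J.unitHom hP hJ).map_rest, hd]
    refine (bisectionVal_eq_of_idem he').trans (Eq.trans ?_ (bisectionVal_eq_of_idem hd').symm)
    exact congrArg (fun z => z ≫ J.toPartite.η i)
      ((hval e).trans ((congrArg Subtype.val hed).trans (hval d).symm))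
  · rintro ⟨x, hx⟩
    obtain ⟨e, he, hex⟩ := exists_bisection_of_idem (A := J.toPartite) (i := ⟨⟨i⟩⟩) hx
    obtain ⟨d, rfl⟩ := (h i i).2 e
    refine ⟨⟨d, (h i i).1 ?_⟩, Subtype.ext ((hval d).symm.trans hex)⟩
    exact ((J.unitHom hP hJ).map_rest d).trans he

include hP in
-- Equal sections force `f` and `g` to have the same domain and to agree, in the sense of `valEq`,
-- on all of it. The join `k` of the maps `e ≫ f`, over idempotents `e` with `e ≫ f = e ≫ g`, is
-- below both. Hyperconnectedness reflects the fact that its domain is all of `rest f`, so `f = k =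
-- g`.
theorem s_injective_of_isJoinHyperconnected (h : IsJoinInverseCategory P.cat)
    (hh : P.IsHyperconnected) {i j : P.cat} {f g : i ⟶ j} (hfg : J.s f = J.s g) : f = g := by
  have hinj : ∀ {d e : i ⟶ i}, rest d = d → rest e = e → P.P.map d = P.P.map e → d = e :=
    fun hd he hde => congrArg Subtype.val ((hh i).1 (a₁ := ⟨_, hd⟩) (a₂ := ⟨_, he⟩)
      (Subtype.ext hde))
  have hrfg : rest f = rest g := hinj (rest_rest f) (rest_rest g) (by
    rw [P.map_rest, P.map_rest, ← J.rest_s, ← J.rest_s, hfg])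
  have hv : valEq P f g = P.P.map (rest f) := by
    rw [hrfg, P.map_rest, ← valEq_self]
    exact ((J.isGlueing i j).induces f g).symm.trans
      ((congrArg (fun z => z ≫ J.q g) hfg).trans ((J.isGlueing i j).induces g g))
  let E : Set (i ⟶ i) := {e | rest e = e ∧ e ≫ rest f = e ∧ e ≫ f = e ≫ g}
  have hle : ∀ e ∈ E, ∀ f : i ⟶ j, e ≫ f ≤ f := fun e he f => by
    have := rest_comp_le e f
    rwa [he.1] at this
  obtain ⟨k, hk⟩ := h.exists_join ((fun e => e ≫ f) '' E) (by
    rintro _ ⟨e, he, rfl⟩ _ ⟨d, hd, rfl⟩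
    exact bicompatible_of_le hP (hle e he f) (hle d hd f))
  have hkf : k ≤ f := hk.2 (by rintro _ ⟨e, he, rfl⟩; exact hle e he f)
  have hkg : k ≤ g := hk.2 (by
    rintro _ ⟨e, he, rfl⟩
    dsimp only
    rw [he.2.2]
    exact hle e he g)
  have hr : P.P.map (rest f) ≤ P.P.map (rest k) := by
    rw [← hv]
    refine (isLUB_valEq P f g).2 fun x hx => ?_
    obtain ⟨e, he, hf, -, hfg, rfl⟩ := exists_of_mem_valEqSet hx
    have h1 := rest_le_rest (hk.1 ⟨e, ⟨he, hf, hfg⟩, rfl⟩)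
    dsimp only at h1
    rw [rest_comp_of_idem he, hf] at h1
    exact P.map_le_map h1
  have hr' : rest f ≤ rest k := by
    rw [rest_le_iff]
    refine hinj (by rw [rest_rest_comp, rest_rest]) (rest_rest f) ?_
    have := (le_def _ _).1 hr
    rw [← P.map_rest, rest_rest] at this
    rw [Functor.map_comp, ← this]
  rw [← eq_of_le_of_rest_le hkf hr', eq_of_le_of_rest_le hkg (hrfg ▸ hr')]

/-- The idempotent `v ≫ q f` is the locus where the bisection `v` coincides with `s f`. Lifted to an
idempotent `e f` of `P`, it gives a map `e f ≫ f` whose section is the restriction of `v`. The join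
of these maps has section `v`. -/
theorem surjective_of_isJoinHyperconnected (h : IsJoinInverseCategory P.cat)
    (hh : P.IsHyperconnected) (i j : P.cat) :
    Function.Surjective (fun f : i ⟶ j => (J.unitHom hP hJ).functor.map f) := by
  intro s
  let v := bisectionVal (A := J.toPartite) (i := ⟨⟨i⟩⟩) (j := ⟨⟨j⟩⟩) s
  have hG := J.isGlueing i j
  have hvσ : v ≫ J.str.graph.σ i j = rest v :=
    bisectionVal_σ (A := J.toPartite) (i := ⟨⟨i⟩⟩) (j := ⟨⟨j⟩⟩) s
  have hx : ∀ f : i ⟶ j, rest (v ≫ J.q f) = v ≫ J.q f := fun f => by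
    have := precomp_le v (hG.q_le f)
    rw [hvσ] at this
    exact rest_eq_of_le_rest this
  have hidem : ∀ x : P.P.obj i ⟶ P.P.obj i, rest x = x →
      ∃ e : i ⟶ i, rest e = e ∧ P.P.map e = x := fun x hx => by
    obtain ⟨⟨e, he⟩, hex⟩ := (hh i).2 ⟨x, hx⟩
    exact ⟨e, he, congrArg Subtype.val hex⟩
  have hinj : ∀ {d e : i ⟶ i}, rest d = d → rest e = e → P.P.map d = P.P.map e → d = e :=
    fun hd he hde => congrArg Subtype.val ((hh i).1 (a₁ := ⟨_, hd⟩) (a₂ := ⟨_, he⟩)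
      (Subtype.ext hde))
  choose e he hex using fun f : i ⟶ j => hidem _ (hx f)
  obtain ⟨d, hd, hdx⟩ := hidem (rest v) (rest_rest v)
  have hsv : ∀ f, J.s (e f ≫ f) = (v ≫ J.q f) ≫ v := fun f => by
    have e1 : rest (v ≫ J.q f) ≫ v = (rest (v ≫ J.q f) ≫ v ≫ J.str.graph.σ i j) ≫ J.s f :=
      hG.rest_comp_eq v f
    rw [hvσ, rest_comp_comp, hx f] at e1
    rw [e1, ← he f, J.s_rest_comp, J.rest_s, ← P.map_rest, he, hex]
  have hsle : ∀ f, J.s (e f ≫ f) ≤ v := fun f => by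
    rw [hsv, ← hx f]
    exact rest_comp_le _ _
  have hUle : ∀ f, (J.unitHom hP hJ).functor.map (e f ≫ f) ≤ s := fun f =>
    bisectionVal_le_iff.1 (hsle f)
  have hfaith : ∀ i j : P.cat, Function.Injective
      (fun f : i ⟶ j => (J.unitHom hP hJ).functor.map f) := fun i j f g hfg =>
    J.s_injective_of_isJoinHyperconnected hP h hh
      (congrArg (fun z => bisectionVal (A := J.toPartite) (i := ⟨⟨i⟩⟩) (j := ⟨⟨j⟩⟩) z) hfg)
  -- The images all lie below `s`. Faithfulness, known from `s_injective_of_isJoinHyperconnected`,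
  -- turns this into bicompatibility in `P`.
  obtain ⟨k, hk⟩ := h.exists_join (Set.range fun f => e f ≫ f) (by
    rintro _ ⟨f, rfl⟩ _ ⟨g, rfl⟩
    exact RCatOver.Hom.bicompatible_of_map_le hfaith hP (isInverseCategory_phiG hJ)
      (hUle f) (hUle g))
  have hkd : rest k ≤ d := by
    -- Each `e f ≫ f` is supported on the lift `d` of the domain of `v`, so `d ≫ k` is still an
    -- upper bound.
    have hub : k ≤ d ≫ k := hk.2 (by
      rintro _ ⟨f, rfl⟩
      have h1 : e f ≫ d = e f := by
        refine hinj (by rw [rest_comp_of_idem (he f), hd]) (he f) ?_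
        rw [Functor.map_comp, hex, hdx, ← hx f, rest_comp_comp]
      have h2 : d ≫ e f ≫ f = e f ≫ f := by
        have hc : d ≫ e f = e f ≫ d := by rw [← he f, ← hd, rest_comm]
        rw [← Category.assoc, hc, h1]
      have h3 := precomp_le d (hk.1 ⟨f, rfl⟩)
      dsimp only at h3
      rwa [h2] at h3)
    have h1 := (rest_le_rest hub).trans (rest_comp_le_rest d k)
    rwa [hd] at h1
  have hvk : v ≤ J.s k := by
    -- The loci `v ≫ q f` join to the domain of `v`, so `v` is the join of its restrictions to them.
    have h1 := isLUB_postcomp_range (hG.isLUB_comp v) v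
    rw [hvσ, rest_comp_self] at h1
    refine h1.2 ?_
    rintro _ ⟨f, rfl⟩
    dsimp only
    rw [← hsv]
    exact J.s_mono (hk.1 ⟨f, rfl⟩)
  have hr : rest (J.s k) ≤ rest v := by
    rw [J.rest_s, ← P.map_rest, ← hdx]
    exact P.map_le_map hkd
  refine ⟨k, bisectionVal_ext (A := J.toPartite) (i := ⟨⟨i⟩⟩) (j := ⟨⟨j⟩⟩) ?_⟩
  exact (eq_of_le_of_rest_le hvk hr).symm

theorem isIso_unit_iff : IsIso (J.unit (P := ⟨P, hP⟩) hJ) ↔ isJoinHyperconnected C ⟨P, hP⟩ :=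
  ⟨fun h => J.isJoinHyperconnected_of_bijective hP hJ (J.bijective_of_isIso_unit hP hJ h),
    fun h => J.isIso_unit_of_bijective hP hJ fun i j =>
      ⟨fun _ _ hfg => J.s_injective_of_isJoinHyperconnected hP h.1 h.2
        (congrArg (fun z => bisectionVal (A := J.toPartite) (i := ⟨⟨i⟩⟩) (j := ⟨⟨j⟩⟩) z) hfg),
      J.surjective_of_isJoinHyperconnected hP hJ h.1 h.2 i j⟩⟩

end Internalisation

end RestrictionTheory

/-! ### Étale groupoids: partial bisections cover, and externalisation is full and faithful on maps
out of them. -/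

namespace RestrictionTheory

open RestrictionCategory PartiteCategory

section Etale

variable {C : Type u} [Category.{v} C] [RestrictionCategory C] {X Y Z : C}

theorem isTotal_of_isIso (f : X ⟶ Y) [IsIso f] : IsTotal f :=
  have : IsTotal (f ≫ inv f) := by rw [IsIso.hom_inv_id]; infer_instance
  isTotal_of_comp f (inv f)

theorem isPartialIso_of_isIso (f : X ⟶ Y) [IsIso f] : IsPartialIso f := by
  refine ⟨inv f, ?_, ?_⟩
  · rw [IsIso.hom_inv_id, (isTotal_of_isIso f).rest_eq]
  · rw [IsIso.inv_hom_id, (isTotal_of_isIso (inv f)).rest_eq]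

/-- A partial inverse of a map below `p` is a partial section of `p`. -/
theorem IsPartialInverse.isPartialSection {p q : X ⟶ Y} {s : Y ⟶ X} (h : IsPartialInverse q s)
    (hq : q ≤ p) : IsPartialSection p s := by
  have h2 : q = rest q ≫ p := hq
  change s ≫ p = rest s
  rw [← h.2, h2, ← Category.assoc, (isPartialInverse_symm h).comp_rest]

variable [JoinRestrictionCategory C]

/-- A partial section of an étale map has a partial inverse below this map. -/
theorem IsEtaleMap.exists_isPartialInverse {p : X ⟶ Y} (hp : IsEtaleMap p) {s : Y ⟶ X}
    (hs : IsPartialSection p s) : ∃ q, q ≤ p ∧ IsPartialInverse q s := by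
  obtain ⟨S, hS, hSp⟩ := hp
  have hs' : s ≫ p = rest s := hs
  have hle : ∀ t ∈ S, s ≫ t ≤ rest s := fun t ht => hs' ▸ precomp_le s (hSp.1 ht)
  have hid : ∀ t ∈ S, rest (s ≫ t) = s ≫ t := fun t ht => rest_eq_of_le_rest (hle t ht)
  -- For `t` in `S`, the idempotent `s ≫ t` is the locus where `s` is inverse to `t`. The map `t ≫ s
  -- ≫ t` is the part of `t` with values in this locus; these parts join to the required `q`.
  have hub : ∀ m ∈ (fun t => t ≫ s ≫ t) '' S, m ≤ p := by
    rintro _ ⟨t, ht, rfl⟩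
    refine le_trans ?_ (hSp.1 ht)
    have := precomp_le t ((hle t ht).trans (rest_le_id s))
    rwa [Category.comp_id] at this
  obtain ⟨q, hq⟩ := JoinRestrictionCategory.exists_join _ (pairwiseCompatible_of_le hub)
  refine ⟨q, hq.2 hub, ?_, ?_⟩
  · have h1 := isLUB_postcomp hq s
    have h2 := (isLUB_iff.1 hq).2
    rw [Set.image_image] at h1 h2
    have e : (fun t => (t ≫ s ≫ t) ≫ s) '' S = (fun t => rest (t ≫ s ≫ t)) '' S := by
      refine Set.image_congr fun t ht => ?_
      obtain ⟨t', htt⟩ := hS t ht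
      -- On the locus `s ≫ t` the section `s` coincides with the partial inverse `t'` of `t`.
      have e1 : (s ≫ t) ≫ s = (s ≫ t) ≫ t' := by
        rw [Category.assoc _ t t', htt.1, comp_rest, hid t ht]
      have e2 : t ≫ s ≫ t = rest (t ≫ s ≫ t) ≫ t := by
        conv_lhs => rw [← hid t ht, comp_rest]
      calc (t ≫ s ≫ t) ≫ s = t ≫ (s ≫ t) ≫ s := Category.assoc _ _ _
        _ = (t ≫ s ≫ t) ≫ t' := by rw [e1]; simp only [Category.assoc]
        _ = rest (t ≫ s ≫ t) ≫ rest t := by rw [e2, Category.assoc, htt.1, ← e2]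
        _ = rest (t ≫ s ≫ t) := rest_comp_comp _ _
    rw [e] at h1
    exact h1.unique h2
  · have h1 := isLUB_precomp s hq
    -- After precomposition by `s`, each part of `t` becomes the idempotent `s ≫ t`, and these join
    -- to `s ≫ p`.
    have h2 := isLUB_precomp s hSp
    rw [Set.image_image] at h1
    have e : (fun t => s ≫ t ≫ s ≫ t) '' S = (fun t => s ≫ t) '' S := by
      refine Set.image_congr fun t ht => ?_
      have := rest_idem (s ≫ t)
      rw [hid t ht] at this
      exact (Category.assoc _ _ _).symm.trans this
    rw [e] at h1
    exact (h1.unique h2).trans hs'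

theorem IsLocalHomeo.precomp_iso {f : X ⟶ Y} [IsIso f] {g : Y ⟶ Z} (hg : IsLocalHomeo g) :
    IsLocalHomeo (f ≫ g) := by
  obtain ⟨ht, S, hS, hg⟩ := hg
  have := isTotal_of_isIso f
  refine ⟨inferInstance, _, ?_, isLUB_precomp f hg⟩
  rintro _ ⟨s, hs, rfl⟩
  exact isPartialIso_comp (isPartialIso_of_isIso f) (hS s hs)

theorem IsLocalHomeo.postcomp_iso {f : X ⟶ Y} {g : Y ⟶ Z} [IsIso g] (hf : IsLocalHomeo f) :
    IsLocalHomeo (f ≫ g) := by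
  obtain ⟨ht, S, hS, hf⟩ := hf
  have := isTotal_of_isIso g
  refine ⟨inferInstance, _, ?_, isLUB_postcomp hf g⟩
  rintro _ ⟨s, hs, rfl⟩
  exact isPartialIso_comp (hS s hs) (isPartialIso_of_isIso g)

end Etale

section EtaleGroupoids

variable {C : Type u} [Category.{v} C] [RestrictionCategory C] [JoinRestrictionCategory C]

theorem PartiteCategory.IsGroupoid.isLocalHomeo_τ {A : PartiteCategory.{w} C} (hA : A.IsGroupoid)
    (h : ∀ i j, IsLocalHomeo (A.σ i j)) (i j : A.I) : IsLocalHomeo (A.τ i j) := by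
  obtain ⟨ι, -, hι, hστ, -⟩ := hA
  have : IsIso (ι i j) := ⟨ι j i, hι j i, hι i j⟩
  rw [← hστ]
  exact (h j i).precomp_iso

theorem exists_isPartialInverse_bisectionVal {A : PartiteCategory.{w} C}
    (h : ∀ i j, IsLocalHomeo (A.σ i j)) {i j : PhiGCat A} (f : i ⟶ j) :
    ∃ q, q ≤ A.σ i.obj.idx j.obj.idx ∧ IsPartialInverse q (bisectionVal f) :=
  (h _ _).2.exists_isPartialInverse (bisectionVal_σ f)

/-- The source maps of an étale partite groupoid are the joins of the partial inverses of its
partial bisections. -/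
theorem isLUB_of_isPartialInverse_bisectionVal {A : PartiteCategory.{w} C} (hA : A.IsGroupoid)
    (h : ∀ i j, IsLocalHomeo (A.σ i j)) {i j : PhiGCat A}
    (q : (i ⟶ j) → (A.arr i.obj.idx j.obj.idx ⟶ A.obj i.obj.idx))
    (hle : ∀ f, q f ≤ A.σ i.obj.idx j.obj.idx)
    (hq : ∀ f, IsPartialInverse (q f) (bisectionVal f)) :
    IsLUB (Set.range q) (A.σ i.obj.idx j.obj.idx) := by
  refine ⟨by rintro _ ⟨f, rfl⟩; exact hle f, fun u hu => ?_⟩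
  obtain ⟨-, S, hS, hSσ⟩ := h i.obj.idx j.obj.idx
  obtain ⟨hτ, T, hT, hTτ⟩ := hA.isLocalHomeo_τ h i.obj.idx j.obj.idx
  refine hSσ.2 fun s hs => ?_
  -- The target is total, so the domains of the partial isomorphisms `t` below it cover, and `s` is
  -- the join of its restrictions to them.
  have hT' := isLUB_postcomp (isLUB_iff.1 hTτ).2 s
  rw [hτ.rest_eq, Category.id_comp, Set.image_image] at hT'
  refine hT'.2 ?_
  rintro _ ⟨t, ht, rfl⟩
  obtain ⟨s', hss⟩ := hS s hs
  have hinv : IsPartialInverse (rest t ≫ s) (s' ≫ rest t) :=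
    IsPartialInverse.comp ⟨by rw [rest_rest, rest_idem], by rw [rest_rest, rest_idem]⟩ hss
  have hle' : rest t ≫ s ≤ A.σ i.obj.idx j.obj.idx := (rest_comp_le t s).trans (hSσ.1 hs)
  -- Restricting to the domain of `t` makes the section a bisection: its target is `s' ≫ t`, a
  -- composite of partial isomorphisms.
  let f : i ⟶ j := ⟨⟨s' ≫ rest t, hinv.isPartialSection hle'⟩, by
    change IsPartialIso ((s' ≫ rest t) ≫ A.τ _ _)
    rw [Category.assoc, rest_comp_eq_of_le (hTτ.1 ht)]
    exact isPartialIso_comp ⟨s, isPartialInverse_symm hss⟩ (hT t ht)⟩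
  have e : q f = rest t ≫ s :=
    (isPartialInverse_symm (hq f)).unique (isPartialInverse_symm hinv)
  exact e.ge.trans (hu ⟨f, rfl⟩)

/-- The cover of an étale partite groupoid by all of its partial bisections. -/
noncomputable def bisectionCover {A : PartiteCategory.{w} C} (hA : A.IsGroupoid)
    (h : ∀ i j, IsLocalHomeo (A.σ i j)) : SectionCover A where
  H i j := (⟨⟨i⟩⟩ : PhiGCat A) ⟶ ⟨⟨j⟩⟩
  q f := (exists_isPartialInverse_bisectionVal h f).choose
  s f := bisectionVal f
  isGlueing i j :=
    { total := A.str.graph.σ_total i j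
      isPartialInverse := fun f => (exists_isPartialInverse_bisectionVal h f).choose_spec.2
      isLUB := isLUB_of_isPartialInverse_bisectionVal hA h _
        (fun f => (exists_isPartialInverse_bisectionVal h f).choose_spec.1)
        (fun f => (exists_isPartialInverse_bisectionVal h f).choose_spec.2)
      induces := fun _ _ => rfl }
  one i := 𝟙 (⟨⟨i⟩⟩ : PhiGCat A)
  s_one _ := rfl
  comp f g := f ≫ g
  s_comp _ _ := rfl

/-- The image of a cofunctor records its values on every partial bisection, and for étale `A` these
form a section cover. -/
theorem phiG_map_injective {A B : PartiteGroupoid.{w} C} (hA : isEtaleGroupoid C A)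
    (F F' : A ⟶ B) (h : (PhiG C).map F = (PhiG C).map F') : F = F' := by
  obtain ⟨F⟩ := F
  obtain ⟨F'⟩ := F'
  have hidx : ∀ i, F.idx i = F'.idx i := fun i =>
    congrArg (fun M : (PhiG C).obj A ⟶ (PhiG C).obj B =>
      (M.hom.functor.obj (⟨⟨i⟩⟩ : PhiGCat A.obj)).obj.idx) h
  obtain ⟨idx, obj, arr, hs, ht, hu, hc⟩ := F
  obtain ⟨idx', obj', arr', hs', ht', hu', hc'⟩ := F'
  obtain rfl : idx = idx' := funext hidx
  congr 1
  refine (bisectionCover A.property hA).cofunctor_ext (fun i => ?_) (fun i j f => ?_)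
  · have e : HEq _ _ := congr_arg_heq
      (fun M : (PhiG C).obj A ⟶ (PhiG C).obj B => M.hom.α.app (⟨⟨i⟩⟩ : PhiGCat A.obj)) h
    exact eq_of_heq e
  · have e : HEq _ _ := congr_arg_heq
      (fun M : (PhiG C).obj A ⟶ (PhiG C).obj B => (M.hom.functor.map
        (show (⟨⟨i⟩⟩ : PhiGCat A.obj) ⟶ ⟨⟨j⟩⟩ from f)).1) h
    exact congrArg Subtype.val (eq_of_heq e)

/-- The data of a cofunctor out of an étale partite groupoid obtained from a map between the
categories of partial bisections. -/
noncomputable def bisectionCofunctorData {A B : PartiteCategory.{w} C} (hA : A.IsGroupoid)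
    (h : ∀ i j, IsLocalHomeo (A.σ i j)) (M : RCatOver.Hom (phiGOver A) (phiGOver B)) :
    (bisectionCover hA h).CofunctorData B where
  idx i := (M.functor.obj (⟨⟨i⟩⟩ : PhiGCat A)).obj.idx
  obj i := M.α.app (⟨⟨i⟩⟩ : PhiGCat A)
  obj_total i := M.α_total (⟨⟨i⟩⟩ : PhiGCat A)
  t {i j} f := (M.functor.map (show (⟨⟨i⟩⟩ : PhiGCat A) ⟶ ⟨⟨j⟩⟩ from f)).1
  nat {i j} f := M.α.naturality (show (⟨⟨i⟩⟩ : PhiGCat A) ⟶ ⟨⟨j⟩⟩ from f)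
  t_one i := congrArg (fun z => z.1.1) (M.functor.map_id (⟨⟨i⟩⟩ : PhiGCat A))
  t_comp f g := congrArg (fun z => z.1) (M.functor.map_comp
    (show (⟨⟨_⟩⟩ : PhiGCat A) ⟶ ⟨⟨_⟩⟩ from f) (show (⟨⟨_⟩⟩ : PhiGCat A) ⟶ ⟨⟨_⟩⟩ from g))
  agree {i j} f g := by
    have hG := (bisectionCover hA h).isGlueing i j
    -- The locus where the bisections `f` and `g` coincide lifts to an idempotent `e` with `e ≫ f =
    -- e ≫ g`, so `rest_α_comp_map` gives agreement of the images.
    obtain ⟨e, he, hex⟩ := exists_bisection_of_idem (i := (⟨⟨i⟩⟩ : PhiGCat A)) (hG.rest_φ f g)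
    have hre : rest (bisectionVal e) = (bisectionCover hA h).s f ≫ (bisectionCover hA h).q g := by
      rw [← rest_comp_total (bisectionVal e) (A.τ i i)]
      exact (congrArg rest hex).trans (hG.rest_φ f g)
    have key : ∀ k : (⟨⟨i⟩⟩ : PhiGCat A) ⟶ ⟨⟨j⟩⟩,
        bisectionVal (e ≫ k) = rest (bisectionVal e) ≫ bisectionVal k := fun k =>
      (congrArg (fun z => bisectionVal (z ≫ k)) he.symm).trans (bisectionVal_rest_comp e k)
    have hfg : e ≫ (show (⟨⟨i⟩⟩ : PhiGCat A) ⟶ ⟨⟨j⟩⟩ from f) =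
        e ≫ (show (⟨⟨i⟩⟩ : PhiGCat A) ⟶ ⟨⟨j⟩⟩ from g) := by
      refine bisectionVal_ext ((key f).trans (Eq.trans ?_ (key g).symm))
      rw [hre]
      exact hG.φ_comp_s f g
    have aux := fun k => M.rest_α_comp_map (j := (⟨⟨j⟩⟩ : PhiGCat A)) he k
    have e3 : M.α.app (⟨⟨i⟩⟩ : PhiGCat A) ≫ (phiGOver A).P.map e =
      M.α.app (⟨⟨i⟩⟩ : PhiGCat A) ≫ (bisectionCover hA h).s f ≫ (bisectionCover hA h).q g :=
      congrArg (fun z => M.α.app (⟨⟨i⟩⟩ : PhiGCat A) ≫ z) hex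
    rw [e3] at aux
    exact (aux f).trans ((congrArg (fun z => (M.functor.map z).1.1) hfg).trans (aux g).symm)

theorem phiG_map_surjective {A B : PartiteGroupoid.{w} C} (hA : isEtaleGroupoid C A)
    (M : (PhiG C).obj A ⟶ (PhiG C).obj B) : ∃ F : A ⟶ B, (PhiG C).map F = M := by
  refine ⟨ObjectProperty.homMk (bisectionCofunctorData A.property hA M.hom).cofunctor,
    ObjectProperty.hom_ext _ ?_⟩
  refine RCatOver.Hom.ext_heq (fun _ => rfl) (fun {i j} f => heq_of_eq ?_)
    (fun i => HEq.rfl)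
  refine WideSubcategory.hom_ext _ ?_
  exact (bisectionCofunctorData A.property hA M.hom).phiMapHom_cofunctor f

end EtaleGroupoids

end RestrictionTheory

/-! ### Invariance of étaleness under isomorphism. -/

namespace RestrictionTheory

open RestrictionCategory PartiteCategory

/-- A weak form of the two-out-of-six property of isomorphisms. -/
theorem isIso_of_three {C : Type u} [Category.{v} C] {X Y Z W : C}
    (f : X ⟶ Y) (g : Y ⟶ Z) (h : Z ⟶ W) [IsIso (f ≫ g)]
    [IsIso (g ≫ h)] : IsIso f := by
  have e1 : inv (f ≫ g) ≫ f ≫ g = 𝟙 _ := IsIso.inv_hom_id _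
  have e2 : g ≫ h ≫ inv (g ≫ h) = 𝟙 _ := by
    rw [← Category.assoc]; exact IsIso.hom_inv_id _
  have e3 : (inv (f ≫ g) ≫ f) = h ≫ inv (g ≫ h) := by
    calc _ = (inv (f ≫ g) ≫ f) ≫ g ≫ h ≫ inv (g ≫ h) := by rw [e2, Category.comp_id]
      _ = (inv (f ≫ g) ≫ f ≫ g) ≫ h ≫ inv (g ≫ h) := by simp only [Category.assoc]
      _ = _ := by rw [e1, Category.id_comp]
  have : IsIso g := ⟨h ≫ inv (g ≫ h), e2, by rw [← e3, Category.assoc, e1]⟩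
  exact IsIso.of_isIso_comp_right f g

section EtaleIso

variable {C : Type u} [Category.{v} C] [RestrictionCategory C] {A B D : PartiteCategory.{w} C}

/-- Taking an arbitrary `K` equal to the identity allows substitution. For a concrete composite, the
equation of cofunctors would need transport along an equality of index maps. -/
theorem Cofunctor.isIso_obj_of_eq_id {K : Cofunctor A A} (h : K = Cofunctor.id A) (i : A.I) :
    IsIso (K.obj i) := by
  subst h
  change IsIso (𝟙 _)
  infer_instance

theorem Cofunctor.isIso_arr_of_eq_id {K : Cofunctor A A} (h : K = Cofunctor.id A) (i j : A.I) :
    IsIso (K.arr i j) := by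
  subst h
  change IsIso (pullback.fst (A.σ i j) (𝟙 _))
  infer_instance

/-- The action on arrows of a cofunctor which is invertible on objects. -/
noncomputable def Cofunctor.isoArr (F : Cofunctor A B) [∀ i, IsIso (F.obj i)] (i j : A.I) :
    A.arr i j ⟶ B.arr (F.idx i) (F.idx j) :=
  inv (pullback.fst (A.σ i j) (F.obj i)) ≫ F.arr i j

theorem Cofunctor.lift_isoArr (F : Cofunctor A B) [∀ i, IsIso (F.obj i)] {i j : A.I} {T : C}
    (x : T ⟶ A.arr i j) (b : T ⟶ B.obj (F.idx i)) (h : x ≫ A.σ i j = b ≫ F.obj i) :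
    F.act x b h = x ≫ F.isoArr i j := by
  have e : x ≫ inv (pullback.fst (A.σ i j) (F.obj i)) = pullback.lift x b h := by
    rw [IsIso.comp_inv_eq, pullback.lift_fst]
  rw [isoArr, ← Category.assoc, e]
  rfl

theorem Cofunctor.vcompArr_eq (F : Cofunctor A B) (G : Cofunctor B D) [∀ i, IsIso (F.obj i)]
    [∀ i, IsIso (G.obj i)] (i j : A.I) :
    vcompArr F G i j = pullback.fst _ _ ≫ F.isoArr i j ≫ G.isoArr (F.idx i) (F.idx j) := by
  refine (G.lift_isoArr _ _ _).trans ?_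
  refine (congrArg (fun z => z ≫ G.isoArr _ _) (F.lift_isoArr _ _ _)).trans ?_
  exact Category.assoc _ _ _

theorem isIso_isoArr_comp {F : Cofunctor A B} {G : Cofunctor B A} [∀ i, IsIso (F.obj i)]
    [∀ i, IsIso (G.obj i)] (h : Cofunctor.vcomp F G = Cofunctor.id A) (i j : A.I) :
    IsIso (F.isoArr i j ≫ G.isoArr (F.idx i) (F.idx j)) := by
  have h1 : IsIso (Cofunctor.vcompArr F G i j) := Cofunctor.isIso_arr_of_eq_id h i j
  have h2 : IsIso (G.obj (F.idx i) ≫ F.obj i) := inferInstance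
  rw [Cofunctor.vcompArr_eq] at h1
  exact IsIso.of_isIso_comp_left (pullback.fst (A.σ i j) (G.obj (F.idx i) ≫ F.obj i)) _

variable [JoinRestrictionCategory C]

/-- The source map of `B` is that of `A` composed with isomorphisms on both sides. Components of `F`
and `G` cannot be called mutually inverse directly, since indices return only up to propositional
equality. Consecutive composites are isomorphisms, though, and `isIso_of_three` extracts the
individual components. -/
theorem isLocalHomeo_σ_of_inverse (F : Cofunctor A B) (G : Cofunctor B A)
    (hFG : Cofunctor.vcomp F G = Cofunctor.id A) (hGF : Cofunctor.vcomp G F = Cofunctor.id B)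
    (hA : ∀ i j, IsLocalHomeo (A.σ i j)) (i j : B.I) : IsLocalHomeo (B.σ i j) := by
  have h1 : ∀ i, IsIso (G.obj (F.idx i) ≫ F.obj i) := Cofunctor.isIso_obj_of_eq_id hFG
  have h2 : ∀ i, IsIso (F.obj (G.idx i) ≫ G.obj i) := Cofunctor.isIso_obj_of_eq_id hGF
  have h3 : ∀ i, IsIso (G.obj i) := fun i => by
    have := isIso_of_three (G.obj (F.idx (G.idx i))) (F.obj (G.idx i)) (G.obj i)
    have : IsIso (F.obj (G.idx i)) :=
      IsIso.of_isIso_comp_left (G.obj (F.idx (G.idx i))) _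
    exact IsIso.of_isIso_comp_left (F.obj (G.idx i)) _
  have h4 : ∀ i, IsIso (F.obj i) := fun i => IsIso.of_isIso_comp_left (G.obj (F.idx i)) _
  have h5 := isIso_isoArr_comp hFG (G.idx i) (G.idx j)
  have h6 := isIso_isoArr_comp hGF i j
  have h7 : IsIso (G.isoArr i j) :=
    isIso_of_three _ (F.isoArr (G.idx i) (G.idx j)) (G.isoArr (F.idx (G.idx i)) (F.idx (G.idx j)))
  have e : B.σ i j = G.isoArr i j ≫ A.σ (G.idx i) (G.idx j) ≫ G.obj i := by
    rw [← Category.assoc, Cofunctor.isoArr, Category.assoc (inv _), G.source, Category.assoc,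
      IsIso.eq_inv_comp, pullback.condition]
  rw [e]
  exact (hA _ _).postcomp_iso.precomp_iso

theorem isEtaleGroupoid_of_iso {A B : PartiteGroupoid.{w} C} (f : A ⟶ B) [IsIso f]
    (hA : isEtaleGroupoid C A) : isEtaleGroupoid C B :=
  isLocalHomeo_σ_of_inverse f.hom (inv f).hom
    (congrArg (fun z => z.hom) (IsIso.hom_inv_id f))
    (congrArg (fun z => z.hom) (IsIso.inv_hom_id f)) hA

theorem Internalisation.isEtaleGroupoid {P : RCatOver.{w} C} (J : Internalisation P)
    (hJ : J.toPartite.IsGroupoid) : isEtaleGroupoid C ⟨J.toPartite, hJ⟩ := fun i j =>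
  ⟨(J.isGlueing i j).total, Set.range fun f => J.q f, by
    rintro _ ⟨f, rfl⟩
    exact ⟨_, (J.isGlueing i j).isPartialInverse f⟩, (J.isGlueing i j).isLUB⟩

end EtaleIso

/-! ### The adjunction, its counit, and the restricted equivalence. -/

section Adjunction

variable {C : Type u} [Category.{v} C] [RestrictionCategory C] [JoinRestrictionCategory C]

/-- If the counit is invertible, `A` is isomorphic to an étale internalisation. For étale `A`,
fullness of `PhiG` provides `G` lying over the unit, and the triangle identity makes it inverse to
the counit on both sides. -/
theorem isIso_counit_iff {Ψ : ICatOver.{w} C ⥤ PartiteGroupoid.{w} C} (adj : Ψ ⊣ PhiG C)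
    (hΨ : ∀ P, isEtaleGroupoid C (Ψ.obj P)) (A : PartiteGroupoid.{w} C) :
    IsIso (adj.counit.app A) ↔ isEtaleGroupoid C A := by
  refine ⟨fun _ => isEtaleGroupoid_of_iso (adj.counit.app A) (hΨ _), fun hA => ?_⟩
  obtain ⟨G, hG⟩ := phiG_map_surjective hA (adj.unit.app ((PhiG C).obj A))
  refine ⟨G, ?_, ?_⟩
  -- This composite starts at an object in the image of the left adjoint, so it is compared after
  -- transposition. The other composite starts at `A`, where faithfulness on maps out of an étale
  -- groupoid applies.
  · apply (adj.homEquiv _ _).injective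
    rw [adj.homEquiv_unit, adj.homEquiv_unit, Functor.map_comp, adj.right_triangle_components_assoc,
      hG]
    exact (Category.comp_id _).symm.trans
      (congrArg (fun z => _ ≫ z) ((PhiG C).map_id _).symm)
  · apply phiG_map_injective hA
    rw [Functor.map_comp, hG, adj.right_triangle_components]
    exact (CategoryTheory.Functor.map_id _ _).symm

/-- The left adjoint to externalisation given by a choice of internalisations. -/
noncomputable def internalisationFunctor (J : ∀ P : ICatOver.{w} C, Internalisation P.obj) :
    ICatOver.{w} C ⥤ PartiteGroupoid.{w} C :=
  Adjunction.leftAdjointOfEquiv (G := PhiG C)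
    (F_obj := fun P => ⟨(J P).toPartite, (J P).isGroupoid P.property⟩)
    (fun P A => (J P).homEquiv P.property ((J P).isGroupoid P.property) A)
    (fun P A B g h => by
      change _ ≫ (PhiG C).map (h ≫ g) = (_ ≫ (PhiG C).map h) ≫ (PhiG C).map g
      rw [Functor.map_comp, Category.assoc])

/-- Internalisation is left adjoint to externalisation. -/
noncomputable def internalisationAdjunction
    (J : ∀ P : ICatOver.{w} C, Internalisation P.obj) : internalisationFunctor J ⊣ PhiG C :=
  Adjunction.adjunctionOfEquivLeft _ _

theorem internalisationAdjunction_unit (J : ∀ P : ICatOver.{w} C, Internalisation P.obj)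
    (P : ICatOver.{w} C) : (internalisationAdjunction J).unit.app P =
      (J P).unit ((J P).isGroupoid P.property) := by
  change (J P).unit _ ≫ (PhiG C).map (𝟙 _) = _
  rw [CategoryTheory.Functor.map_id, Category.comp_id]

/-- An adjunction restricts to an adjoint equivalence between full subcategories of objects at
which the unit and the counit are invertible. -/
theorem exists_restricted_adjunction {D : Type*} [Category* D] {E : Type*} [Category* E]
    {L : D ⥤ E} {R : E ⥤ D} (adj : L ⊣ R) {PD : ObjectProperty D} {PE : ObjectProperty E}
    (hL : ∀ X : PD.FullSubcategory, PE (L.obj X.obj))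
    (hR : ∀ Y : PE.FullSubcategory, PD (R.obj Y.obj))
    (hu : ∀ X, PD X → IsIso (adj.unit.app X)) (hc : ∀ Y, PE Y → IsIso (adj.counit.app Y)) :
    ∃ adj' : PE.lift (PD.ι ⋙ L) hL ⊣ PD.lift (PE.ι ⋙ R) hR,
      (∀ X, (adj'.unit.app X).hom = adj.unit.app X.obj) ∧
      (∀ Y, (adj'.counit.app Y).hom = adj.counit.app Y.obj) ∧
      (PE.lift (PD.ι ⋙ L) hL).IsEquivalence ∧ (PD.lift (PE.ι ⋙ R) hR).IsEquivalence := by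
  let adj' : PE.lift (PD.ι ⋙ L) hL ⊣ PD.lift (PE.ι ⋙ R) hR :=
    { unit :=
        { app := fun X => ObjectProperty.homMk (adj.unit.app X.obj)
          naturality := fun _ _ f => ObjectProperty.hom_ext _ (adj.unit.naturality f.hom) }
      counit :=
        { app := fun Y => ObjectProperty.homMk (adj.counit.app Y.obj)
          naturality := fun _ _ f => ObjectProperty.hom_ext _ (adj.counit.naturality f.hom) }
      left_triangle_components := fun X =>
        ObjectProperty.hom_ext _ (adj.left_triangle_components X.obj)
      right_triangle_components := fun Y =>
        ObjectProperty.hom_ext _ (adj.right_triangle_components Y.obj) }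
  have h1 : ∀ X, IsIso (adj'.unit.app X) := fun X => by
    have := hu X.obj X.property
    exact ⟨ObjectProperty.homMk (inv (adj.unit.app X.obj)),
      ObjectProperty.hom_ext _ (IsIso.hom_inv_id (adj.unit.app X.obj)),
      ObjectProperty.hom_ext _ (IsIso.inv_hom_id (adj.unit.app X.obj))⟩
  have h2 : ∀ Y, IsIso (adj'.counit.app Y) := fun Y => by
    have := hc Y.obj Y.property
    exact ⟨ObjectProperty.homMk (inv (adj.counit.app Y.obj)),
      ObjectProperty.hom_ext _ (IsIso.hom_inv_id (adj.counit.app Y.obj)),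
      ObjectProperty.hom_ext _ (IsIso.inv_hom_id (adj.counit.app Y.obj))⟩
  exact ⟨adj', fun _ => rfl, fun _ => rfl, adj'.toEquivalence.isEquivalence_functor,
    adj'.toEquivalence.isEquivalence_inverse⟩

end Adjunction

end RestrictionTheory

open RestrictionTheory

theorem mainTheorem5 (C : Type u) [Category.{v} C] [RestrictionCategory C]
    [JoinRestrictionCategory C] (hC : HasLocalGlueings C) :
    (∀ P : ICatOver.{w} C, Nonempty (Internalisation P.obj)) ∧
    ∀ J : (∀ P : ICatOver.{w} C, Internalisation P.obj),
      ∃ (hJ : ∀ P, (J P).toPartite.IsGroupoid)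
        (Ψ : ICatOver.{w} C ⥤ PartiteGroupoid.{w} C)
        (hΨ : ∀ P, Ψ.obj P = ⟨(J P).toPartite, hJ P⟩)
        (adj : Ψ ⊣ PhiG C),
        (∀ P, adj.unit.app P ≫ (PhiG C).map (eqToHom (hΨ P)) = (J P).unit (hJ P)) ∧
        (∀ P, IsIso (adj.unit.app P) ↔ isJoinHyperconnected C P) ∧
        (∀ A, IsIso (adj.counit.app A) ↔ isEtaleGroupoid C A) ∧
        ∃ (hE : ∀ P : (isJoinHyperconnected.{w} C).FullSubcategory,
            isEtaleGroupoid C (Ψ.obj P.obj))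
          (hΦ : ∀ A : (isEtaleGroupoid.{w} C).FullSubcategory,
            isJoinHyperconnected C ((PhiG C).obj A.obj))
          (adj' : (isEtaleGroupoid C).lift ((isJoinHyperconnected C).ι ⋙ Ψ) hE ⊣
            (isJoinHyperconnected C).lift ((isEtaleGroupoid C).ι ⋙ PhiG C) hΦ),
          (∀ P, (adj'.unit.app P).hom = adj.unit.app P.obj) ∧
          (∀ A, (adj'.counit.app A).hom = adj.counit.app A.obj) ∧
          ((isEtaleGroupoid C).lift ((isJoinHyperconnected C).ι ⋙ Ψ) hE).IsEquivalence ∧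
          ((isJoinHyperconnected C).lift ((isEtaleGroupoid C).ι ⋙ PhiG C) hΦ).IsEquivalence := by
  refine ⟨fun P => ⟨(PreInternalisation.nonempty hC P.obj).some.internalisation⟩, fun J => ?_⟩
  have hu : ∀ P, IsIso ((internalisationAdjunction J).unit.app P) ↔
      isJoinHyperconnected C P := fun P => by
    rw [internalisationAdjunction_unit]
    exact (J P).isIso_unit_iff P.property _
  have hc := isIso_counit_iff (internalisationAdjunction J) (fun P => (J P).isEtaleGroupoid _)
  refine ⟨fun P => (J P).isGroupoid P.property, internalisationFunctor J, fun _ => rfl,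
    internalisationAdjunction J, fun P => ?_, hu, hc, fun P => (J P.obj).isEtaleGroupoid _,
    fun A => isJoinHyperconnected_phiG A.obj, ?_⟩
  -- The functor has the chosen internalisations as its values by definition, so the comparison
  -- `eqToHom` is an identity.
  · refine Eq.trans ?_ (internalisationAdjunction_unit J P)
    exact (congrArg (fun z => _ ≫ z) ((PhiG C).map_id _)).trans (Category.comp_id _)
  · generalize internalisationAdjunction J = adj at hu hc
    exact exists_restricted_adjunction adj _ _ (fun P => (hu P).2) (fun A => (hc A).2)
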